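/- Let $G$ be a connected complex simple Lie group with Lie algebra $\mathfrak g$, realized as a linear group: $\mathfrak g\subset\mathfrak{gl}_n(\mathbb C)$ is a simple Lie subalgebra and $G\subset GL_n(\mathbb C)$ is the subgroup generated by $\exp(\mathfrak g)$ (every connected complex simple Lie group is of this form). Fix a Cartan subalgebra $\mathfrak h$ and simple roots $\alpha_1,\dots,\alpha_r$, and let $Z_1,\dots,Z_r$ be the basis of $\mathfrak h$ dual to them. Let $\alpha_{\mathtt i}$ be a cominuscule simple root, i.e. $\alpha(Z_{\mathtt i})\in\{-1,0,1\}$ for every root $\alpha$. Put $\mathfrak g_k=\{A\in\mathfrak g : [Z_{\mathtt i},A]=kA\}$ and $\mathfrak p=\mathfrak g_{\ge0}=\mathfrak g_0\oplus\mathfrak g_1$. Let $P=\{g\in G:\mathrm{Ad}_g\mathfrak p=\mathfrak p\}$ be the parabolic subgroup with Lie algebra $\mathfrak p$, $X=G/P$, and $o=P/P\in X$. Let $W$ be the Weyl group, $W_{\mathfrak p}$ the Weyl group of $\mathfrak g_0$, and $W^{\mathfrak p}$ the set of minimal length representatives of the right cosets $W_{\mathfrak p}\backslash W$. Let $w\in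 W^{\mathfrak p}$ be neither the identity nor the longest element of $W^{\mathfrak p}$. Put $\Delta(w)=w\Delta^-\cap\Delta^+$, $\mathfrak n_w=\bigoplus_{\alpha\in\Delta(w)}\mathfrak g_{-\alpha}$, $N_w=\exp(\mathfrak n_w)$, and let $Y_w=\overline{N_w\cdot o}\subset X$ be the Zariski closure. There are a unique set $\mathtt J$ of indices of simple roots with $\mathtt i\notin\mathtt J$ and a unique integer $a\ge0$ such that, with $Z_w=\sum_{j\in\mathtt J}Z_j$ and $\mathfrak g_{k,\ell}=\{A\in\mathfrak g_k:[Z_w,A]=\ell A\}$, the stabilizer of $\mathfrak n_w$ in $\mathfrak g_0$ is $\mathfrak g_{0,\ge0}$ and $\mathfrak n_w=\mathfrak g_{-1,0}\oplus\cdots\oplus\mathfrak g_{-1,-a}$. For this pair $(\mathtt J,a)$: 1. Among the Lie subalgebras $\mathfrak s\subset\mathfrak g$ with $\mathfrak n_w\subset\mathfrak s$ and $\mathfrak s\equiv\mathfrak n_w$ mod $\mathfrak g_{\ge0}$ (that is, $\mathfrak s+\mathfrak g_{\ge0}=\mathfrak n_w+\mathfrak g_{\ge0}$) there is a largest one, $\mathfrak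 g_w$, and $\mathfrak g_w=\mathfrak n_w\oplus\mathfrak g_{0,\ge0}\oplus\mathfrak g_{1,\ge a}$. 2. $\mathfrak g$ is the direct sum of the eigenspaces of $\mathrm{ad}(Z_w-aZ_{\mathtt i})$ with integer eigenvalues, $\mathfrak g_w$ is the sum of those with eigenvalue $\ge0$, and $\mathfrak g_w$ is a parabolic subalgebra (it contains a Borel subalgebra). 3. The stabilizer $\{g\in G : gY_w=Y_w\}$ is the parabolic subgroup $G_w$ associated with $\mathfrak g_w$: it equals $\{g\in G:\mathrm{Ad}_g\mathfrak g_w=\mathfrak g_w\}$, it equals the connected subgroup generated by $\exp(\mathfrak g_w)$, and its Lie algebra is $\mathfrak g_w$. -/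

import Mathlib

open scoped Pointwise

attribute [local instance 100] LieRing.ofAssociativeRing

noncomputable section

namespace Cominuscule

open LieAlgebra LieAlgebra.IsKilling Module

section LieAlgebraPart

variable {L : Type*} [LieRing L] [LieAlgebra ℂ L]

/-- The `Z`-eigenspace `{A ∈ 𝔤 | [Z, A] = k A}`. -/
def gradedPiece (Z : L) (k : ℤ) : Submodule ℂ L :=
  End.eigenspace (ad ℂ L Z) (k : ℂ)

/-- The nonnegative part `⊕_{k ≥ 0} {A | [Z, A] = k A}` of the grading by `Z`. -/
def nonnegPart (Z : L) : Submodule ℂ L :=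
  ⨆ k : ℕ, gradedPiece Z k

/-- The bigraded piece `𝔤_{k,l}` for a pair of grading elements. -/
def bigradedPiece (Z Z' : L) (k l : ℤ) : Submodule ℂ L :=
  gradedPiece Z k ⊓ gradedPiece Z' l

/-- `𝔤_{k, ≥ m} = ⊕_{l ≥ m} 𝔤_{k,l}`. -/
def bigradedGE (Z Z' : L) (k m : ℤ) : Submodule ℂ L :=
  ⨆ l : ℤ, ⨆ _ : m ≤ l, bigradedPiece Z Z' k l

/-- A Borel subalgebra is a maximal solvable subalgebra. -/
def IsBorelSubalgebra (𝔟 : LieSubalgebra ℂ L) : Prop :=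
  Maximal (fun 𝔰 : LieSubalgebra ℂ L ↦ LieAlgebra.IsSolvable 𝔰) 𝔟

/-- A parabolic subalgebra is a subalgebra that contains a Borel subalgebra. -/
def IsParabolicSubalgebra (𝔮 : LieSubalgebra ℂ L) : Prop :=
  ∃ 𝔟 : LieSubalgebra ℂ L, IsBorelSubalgebra 𝔟 ∧ 𝔟 ≤ 𝔮

variable [FiniteDimensional ℂ L] [IsKilling ℂ L] {H : LieSubalgebra ℂ L} [H.IsCartanSubalgebra]

/-- The root space `𝔤_α`. -/
def rootPiece (α : H.root) : Submodule ℂ L :=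
  (rootSpace H α.1).toSubmodule

/-- The root space `𝔤_{-α}`. -/
def negRootPiece (α : H.root) : Submodule ℂ L :=
  (rootSpace H (-α.1 : H → ℂ)).toSubmodule

/-- `Δ(𝔰)`: the roots whose root space lies in `𝔰`. -/
def rootsIn (𝔰 : Submodule ℂ L) : Set H.root :=
  {α | rootPiece α ≤ 𝔰}

variable (b : (rootSystem H).Base)

/-- The element `Z_j` of the basis of `𝔥` dual to the simple roots. -/
def dualElement (j : b.support) : H :=
  (evalEquiv ℂ H).symm (b.toWeightBasis.coord j)

open scoped Classical in
theorem root_dualElement (j k : b.support) :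
    (k : H.root).1 (dualElement b j) = if k = j then 1 else 0 := by
  have h : (rootSystem H).root k (dualElement b j) = b.toWeightBasis.coord j
      ((rootSystem H).root k) :=
    apply_evalEquiv_symm_apply ℂ H ((rootSystem H).root k) (b.toWeightBasis.coord j)
  rw [Basis.coord_apply, RootPairing.Base.toWeightBasis_repr_root, Finsupp.single_apply] at h
  exact h

/-- `Z_j` as an element of `𝔤`. -/
def gradingElement (j : b.support) : L :=
  (dualElement b j : L)

/-- `Z_J = ∑_{j ∈ J} Z_j`. -/
def markingElement (J : Finset b.support) : L :=
  ∑ j ∈ J, gradingElement b j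

/-- The simple root `α_i` is cominuscule: `ad Z_i` has its eigenvalues in `{-1, 0, 1}`. -/
def IsCominuscule (i : b.support) : Prop :=
  ∀ α : H.root, α.1 (dualElement b i) ∈ ({-1, 0, 1} : Set ℂ)

/-- The word length of an element of the Weyl group with respect to the simple reflections. -/
def weylLength (w : (rootSystem H).weylGroup) : ℕ :=
  sInf {m | ∃ l : List b.support, l.length = m ∧
    (l.map fun j ↦ RootPairing.weylGroup.ofIdx (rootSystem H) j).prod = w}

/-- The Weyl group `W_𝔭` of the Levi factor `𝔤_0`, generated by the reflections in `Δ(𝔤_0)`. -/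
def leviWeylGroup (i : b.support) : Subgroup (rootSystem H).weylGroup :=
  Subgroup.closure (RootPairing.weylGroup.ofIdx (rootSystem H) ''
    rootsIn (gradedPiece (gradingElement b i) 0))

/-- The Hasse diagram `W^𝔭`: minimal length representatives of the right cosets `W_𝔭 w`. -/
def hasseDiagram (i : b.support) : Set (rootSystem H).weylGroup :=
  {w | ∀ u ∈ leviWeylGroup b i, weylLength b w ≤ weylLength b (u * w)}

/-- `w` is a longest element of `W^𝔭`. -/
def IsLongest (i : b.support) (w : (rootSystem H).weylGroup) : Prop :=
  w ∈ hasseDiagram b i ∧ ∀ w' ∈ hasseDiagram b i, weylLength b w' ≤ weylLength b w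

/-- The inversion set `Δ(w) = wΔ⁻ ∩ Δ⁺`. -/
def inversionSet (w : (rootSystem H).weylGroup) : Set H.root :=
  ((rootSystem H).weylGroupToPerm w '' {α | ¬ b.IsPos α}) ∩ {α | b.IsPos α}

/-- `𝔫_w = ⊕_{α ∈ Δ(w)} 𝔤_{-α}`. -/
def inversionSubspace (w : (rootSystem H).weylGroup) : Submodule ℂ L :=
  ⨆ α ∈ inversionSet b w, negRootPiece α

/-- The pair `(J, a)` attached to `w`: `J` is a set of simple roots other than `α_i` for which the
stabilizer of `𝔫_w` in `𝔤_0` is `𝔤_{0, ≥ 0}`, and `𝔫_w = 𝔤_{-1,0} ⊕ ⋯ ⊕ 𝔤_{-1,-a}`, both with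
respect to the bigrading by `Z_i` and `Z_w = Z_J`. -/
structure IsMarking (i : b.support) (w : (rootSystem H).weylGroup) (J : Finset b.support) (a : ℕ) :
    Prop where
  notMem : i ∉ J
  stabilizer : ∀ A ∈ gradedPiece (gradingElement b i) 0,
    (∀ X ∈ inversionSubspace b w, ⁅A, X⁆ ∈ inversionSubspace b w) ↔
      A ∈ bigradedGE (gradingElement b i) (markingElement b J) 0 0
  inversionSubspace_eq : inversionSubspace b w =
    ⨆ l : ℕ, ⨆ _ : l ≤ a,
      bigradedPiece (gradingElement b i) (markingElement b J) (-1) (-(l : ℤ))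

end LieAlgebraPart

section GroupPart

variable {n : Type*} [Fintype n] [DecidableEq n]

/-- The connected Lie subgroup of `GL_n(ℂ)` with Lie algebra `𝔤 ⊆ 𝔤𝔩_n(ℂ)`, that is, the subgroup
generated by `exp(𝔤)`. -/
def connectedGroup (𝔤 : LieSubalgebra ℂ (Matrix n n ℂ)) : Subgroup (GL n ℂ) :=
  Subgroup.closure {u | ∃ X ∈ 𝔤, (u : Matrix n n ℂ) = NormedSpace.exp X}

variable {𝔤 : LieSubalgebra ℂ (Matrix n n ℂ)}

/-- The matrix of an element of `G`. -/
def toMatrix (u : connectedGroup 𝔤) : Matrix n n ℂ :=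
  ((u : GL n ℂ) : Matrix n n ℂ)

/-- `exp(S)` as a subset of `G`, for a subset `S` of `𝔤`. -/
def expSet (S : Set 𝔤) : Set (connectedGroup 𝔤) :=
  {u | ∃ X ∈ S, toMatrix u = NormedSpace.exp (X : Matrix n n ℂ)}

/-- The normalizer `{g ∈ G | Ad_g 𝔮 = 𝔮}` of a subspace `𝔮 ⊆ 𝔤`, where `Ad_g X = g X g⁻¹`. For a
parabolic subalgebra `𝔮` this is the parabolic subgroup associated with `𝔮`. -/
def adNormalizer (𝔮 : Submodule ℂ 𝔤) : Subgroup (connectedGroup 𝔤) where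
  carrier := {u | ∀ X : Matrix n n ℂ, X ∈ 𝔮.map 𝔤.toSubmodule.subtype ↔
    toMatrix u * X * toMatrix u⁻¹ ∈ 𝔮.map 𝔤.toSubmodule.subtype}
  one_mem' := by
    intro X
    simp [toMatrix]
  mul_mem' := by
    intro u v hu hv X
    rw [hv X, hu]
    simp [toMatrix, mul_assoc]
  inv_mem' := by
    intro u hu X
    rw [hu (toMatrix u⁻¹ * X * toMatrix u⁻¹⁻¹)]
    simp [toMatrix, ← mul_assoc]

/-- The Lie algebra of a subgroup `Q` of `G`, as a subset of `𝔤`. -/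
def lieAlgebraOf (Q : Subgroup (connectedGroup 𝔤)) : Set 𝔤 :=
  {X | ∀ t : ℝ, ∃ u ∈ Q, toMatrix u = NormedSpace.exp ((t : ℂ) • (X : Matrix n n ℂ))}

/-- A subset of `G/P` is Zariski closed (for the quotient of the Zariski topology of `G`) if its
preimage in `G` is the zero locus of a set of polynomials in the matrix entries. -/
def IsZariskiClosed {P : Subgroup (connectedGroup 𝔤)} (C : Set (connectedGroup 𝔤 ⧸ P)) : Prop :=
  ∃ S : Set (MvPolynomial (n × n) ℂ), ∀ u : connectedGroup 𝔤,
    (u : connectedGroup 𝔤 ⧸ P) ∈ C ↔ ∀ f ∈ S, f.eval (fun e ↦ toMatrix u e.1 e.2) = 0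

/-- The Zariski closure of a subset of `G/P`. -/
def zariskiClosure {P : Subgroup (connectedGroup 𝔤)} (T : Set (connectedGroup 𝔤 ⧸ P)) :
    Set (connectedGroup 𝔤 ⧸ P) :=
  ⋂₀ {C | IsZariskiClosed C ∧ T ⊆ C}

variable [IsKilling ℂ 𝔤] {H : LieSubalgebra ℂ 𝔤} [H.IsCartanSubalgebra]
  (b : (rootSystem H).Base)

/-- The maximal parabolic subgroup `P` of `G` with Lie algebra `𝔭 = 𝔤_{≥ 0}`, the nonnegative part
of the grading by `Z_i`. -/
def maximalParabolic (i : b.support) : Subgroup (connectedGroup 𝔤) :=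
  adNormalizer (nonnegPart (gradingElement b i))

/-- The Schubert variety `Y_w ⊆ X = G/P`: the Zariski closure of `N_w · o`, where
`N_w = exp(𝔫_w)` and `o = P/P`. -/
def schubertVariety (i : b.support) (w : (rootSystem H).weylGroup) :
    Set (connectedGroup 𝔤 ⧸ maximalParabolic b i) :=
  zariskiClosure ((fun u : connectedGroup 𝔤 ↦ (u : connectedGroup 𝔤 ⧸ maximalParabolic b i)) ''
    expSet (inversionSubspace b w : Set 𝔤))

end GroupPart

end Cominuscule

end

/-! Pull the grading by `Z_i` back along `w`: let `ε(α)` be the coefficient of `α_i` in `wα`, a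
value in `{-1, 0, 1}` because `α_i` is cominuscule, and let `p(α)` be the sum of the coefficients in
`α` of those simple roots that have `ε = 1`. On positive roots both `p` and `p - ε` are nonnegative.
For `j ≠ i` the root `w⁻¹α_j` is positive, of degree `0`, and not a sum of two positive roots of
degree `0`; such a root contains at most one simple root of degree `1` (`IsTernary.count_le_one`).
Hence `p ∘ w⁻¹` takes the values `0` or `1` at the `α_j` with `j ≠ i` and a value `-a ≤ 0` at `α_i`,
that is, it is evaluation at `Z_J - a Z_i`, the "level". This is the source of `(J, a)`
(`exists_isRootMarking`).

In these terms `𝔫_w` is the part of degree `-1` and level `≥ 0`, and `𝔤_w` is the whole part of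
level `≥ 0`. It contains the `w`-translate of the standard Borel subalgebra because `p ≥ 0` on
positive roots. It is the largest admissible subalgebra because root vectors of negative level in
degree `0` move `𝔫_w` out of itself, while those in degree `1` bracket with `𝔫_w` into negative
level of degree `0` (`schubertSubalgebra_isGreatest`).

The group statement is a cycle of inclusions: `exp 𝔤_w` lies in the stabilizer of `Y_w`, the
stabilizer lies in the normalizer of `𝔤_w`, and the normalizer is generated by `exp 𝔤_w`.

For the first two, the preimage of `Y_w` in `G` is the Zariski hull of `N_w P`, and the Lie algebra
of the stabilizer consists of the `A` whose derivations preserve the polynomials vanishing on `N_w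
P` (`lieAlgebraOf_stabilizer`). Elements of `𝔤_w` are tangent to `N_w P` at each of its points.
Conversely, explicit polynomials vanishing on `N_w P` bound the tangent space at `1` by `𝔫_w + 𝔭`,
and maximality of `𝔤_w` does the rest (`infinitesimalStabilizer_eq`). A group normalizes its own Lie
algebra.

The last inclusion is the connectedness of parabolic subgroups (`adNormalizer_le_expSubgroup`). An
element of the normalizer is joined to `1` by an entire curve in `G`. The curve meets the big cell
`exp(𝔤_{<0}) · N(𝔤_{≥0})` wherever a certain entire function is nonzero, which is a connected set of
parameters; on it, membership of the second factor in the subgroup generated by `exp 𝔤_{≥0}` is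
locally constant. -/

noncomputable section

namespace Cominuscule

open LieAlgebra LieAlgebra.IsKilling Module

/-! ### Length, exchange and inversion sets in the Weyl group. -/

section WeylLength

variable {L : Type*} [LieRing L] [LieAlgebra ℂ L] [FiniteDimensional ℂ L] [IsKilling ℂ L]
  {H : LieSubalgebra ℂ L} [H.IsCartanSubalgebra] (b : (rootSystem H).Base)

/-- The simple reflection `s_j`, or more generally the reflection in a root. -/
abbrev refl (α : H.root) : (rootSystem H).weylGroup := RootPairing.weylGroup.ofIdx (rootSystem H) α

/-- The action of the Weyl group on the roots. -/
abbrev act (w : (rootSystem H).weylGroup) (α : H.root) : H.root :=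
  (rootSystem H).weylGroupToPerm w α

theorem act_mul (v w : (rootSystem H).weylGroup) (α : H.root) : act (v * w) α = act v (act w α) := by
  simp only [act, map_mul, Equiv.Perm.mul_apply]

@[simp] theorem act_one (α : H.root) : act (1 : (rootSystem H).weylGroup) α = α := by
  simp only [act, map_one, Equiv.Perm.one_apply]

@[simp] theorem act_act_inv (w : (rootSystem H).weylGroup) (α : H.root) :
    act w (act w⁻¹ α) = α := by
  rw [← act_mul, mul_inv_cancel, act_one]

@[simp] theorem act_inv_act (w : (rootSystem H).weylGroup) (α : H.root) :
    act w⁻¹ (act w α) = α := by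
  rw [← act_mul, inv_mul_cancel, act_one]

theorem act_refl (α β : H.root) : act (refl α) β = (rootSystem H).reflectionPerm α β := rfl

theorem refl_mul_self (α : H.root) : refl α * refl α = 1 := by
  have : (refl α)⁻¹ = refl α := Subtype.ext (RootPairing.Equiv.reflection_inv _ α)
  nth_rewrite 1 [← this]
  exact inv_mul_cancel _

theorem refl_inv (α : H.root) : (refl α)⁻¹ = refl α := by
  rw [inv_eq_iff_mul_eq_one, refl_mul_self]

theorem refl_act_refl (α β : H.root) : refl (act (refl α) β) = refl α * refl β * refl α := by
  apply Subtype.ext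
  apply RootPairing.Equiv.weightHom_injective
  change (RootPairing.Equiv.reflection _ _).weightEquiv =
    (RootPairing.Equiv.weightHom _) (RootPairing.Equiv.reflection _ α *
      RootPairing.Equiv.reflection _ β * RootPairing.Equiv.reflection _ α)
  simp only [map_mul, RootPairing.Equiv.weightHom_apply, RootPairing.Equiv.reflection_weightEquiv]
  exact RootPairing.reflection_reflectionPerm _

theorem refl_reflectionPerm_self (α : H.root) :
    refl ((rootSystem H).reflectionPerm α α) = refl α := by
  rw [← act_refl, refl_act_refl, refl_mul_self, one_mul]

/-- The product of a word in the simple reflections. -/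
abbrev wordProd (l : List b.support) : (rootSystem H).weylGroup :=
  (l.map fun j : b.support ↦ refl (j : H.root)).prod

theorem exists_wordProd_refl (α : H.root) : ∃ l, wordProd b l = refl α := by
  induction α using RootPairing.Base.induction_reflect (b := b) with
  | h₀ α h => simpa only [refl_reflectionPerm_self] using h
  | h₁ α h => exact ⟨[⟨α, h⟩], by simp [wordProd]⟩
  | h₂ α j h hj =>
    obtain ⟨l, hl⟩ := h
    refine ⟨⟨j, hj⟩ :: (l ++ [⟨j, hj⟩]), ?_⟩
    rw [← act_refl, refl_act_refl, ← hl]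
    simp [wordProd, mul_assoc]

theorem exists_wordProd (w : (rootSystem H).weylGroup) : ∃ l, wordProd b l = w := by
  obtain ⟨w, hw⟩ := w
  induction hw using RootPairing.weylGroup.induction with
  | mem α => exact exists_wordProd_refl b α
  | one => exact ⟨[], rfl⟩
  | mul x y hx hy h₁ h₂ =>
    obtain ⟨l₁, h₁⟩ := h₁
    obtain ⟨l₂, h₂⟩ := h₂
    refine ⟨l₁ ++ l₂, ?_⟩
    rw [wordProd, List.map_append, List.prod_append]
    exact congrArg₂ (· * ·) h₁ h₂

theorem weylLength_eq_sInf (w : (rootSystem H).weylGroup) :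
    weylLength b w = sInf {m | ∃ l : List b.support, l.length = m ∧ wordProd b l = w} := by
  -- In the definition of length the coercion from simple roots to roots is elaborated as a monadic
  -- bind on the list; this turns it into a `map`.
  have h (l : List b.support) : (do let a ← l; pure (a : H.root)) = l.map (↑) := by
    induction l <;> simp_all
  simp only [weylLength, h, List.map_map, Function.comp_def, wordProd]

theorem weylLength_wordProd_le (l : List b.support) : weylLength b (wordProd b l) ≤ l.length := by
  rw [weylLength_eq_sInf]
  exact Nat.sInf_le ⟨l, rfl, rfl⟩

theorem exists_reduced_word (w : (rootSystem H).weylGroup) :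
    ∃ l, l.length = weylLength b w ∧ wordProd b l = w := by
  obtain ⟨l, hl⟩ := exists_wordProd b w
  rw [weylLength_eq_sInf]
  exact Nat.sInf_mem (s := {m | ∃ l : List b.support, l.length = m ∧ wordProd b l = w})
    ⟨l.length, l, rfl, hl⟩

theorem not_isPos_reflectionPerm_self {α : H.root} (h : b.IsPos α) :
    ¬ b.IsPos ((rootSystem H).reflectionPerm α α) := by
  have := RootPairing.Base.IsPos.neg_iff_not b α
  exact fun h' ↦ (this.1 h') h

/-- A simple reflection makes only its own simple root negative. Carrying `β` through the word from
the left, positivity can therefore be lost only at a letter equal to the root carried so far;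
deleting that letter amounts to multiplying by the reflection in `β`. -/
theorem exists_exchange (l : List b.support) (β : H.root) (hβ : b.IsPos β)
    (h : ¬ b.IsPos (act (wordProd b l)⁻¹ β)) :
    ∃ l' : List b.support, l'.length + 1 = l.length ∧ wordProd b l' = refl β * wordProd b l := by
  induction l generalizing β with
  | nil =>
    refine absurd ?_ h
    simpa [wordProd, -map_inv, -MonoidHom.domRestrict_apply] using hβ
  | cons j l ih =>
    have hw : wordProd b (j :: l) = refl (j : H.root) * wordProd b l := by simp [wordProd]
    by_cases hj : β = j
    · refine ⟨l, rfl, ?_⟩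
      rw [hw, hj, ← mul_assoc, refl_mul_self, one_mul]
    · have h1 : b.IsPos (act (refl (j : H.root)) β) := hβ.reflectionPerm j.2 hj
      rw [hw, mul_inv_rev, act_mul, refl_inv] at h
      obtain ⟨l', hl', hl''⟩ := ih _ h1 h
      refine ⟨j :: l', by simp [hl'], ?_⟩
      rw [hw]
      have : wordProd b (j :: l') = refl (j : H.root) * wordProd b l' := by simp [wordProd]
      rw [this, hl'', refl_act_refl]
      simp only [← mul_assoc, refl_mul_self, one_mul]

theorem weylLength_refl_mul_lt {w : (rootSystem H).weylGroup} {β : H.root} (hβ : b.IsPos β)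
    (h : ¬ b.IsPos (act w⁻¹ β)) : weylLength b (refl β * w) < weylLength b w := by
  obtain ⟨l, hl, rfl⟩ := exists_reduced_word b w
  obtain ⟨l', hl', hl''⟩ := exists_exchange b l β hβ h
  rw [← hl'']
  have := weylLength_wordProd_le b l'
  omega

theorem weylLength_le_refl_mul_add_one (w : (rootSystem H).weylGroup) (j : b.support) :
    weylLength b w ≤ weylLength b (refl (j : H.root) * w) + 1 := by
  obtain ⟨l, hl, hl'⟩ := exists_reduced_word b (refl (j : H.root) * w)
  have := weylLength_wordProd_le b (j :: l)
  have hw : wordProd b (j :: l) = w := by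
    simp only [wordProd, List.map_cons, List.prod_cons] at hl' ⊢
    rw [hl', ← mul_assoc, refl_mul_self, one_mul]
  rw [hw] at this
  simpa [hl] using this

/-- The first letter `j` of a reduced word works: were `w⁻¹α_j` positive, the exchange property
applied to `s_j w` would make `w` shorter than `s_j w`, which is spelled by the tail of the word. -/
theorem exists_simple_not_isPos {w : (rootSystem H).weylGroup} (hw : w ≠ 1) :
    ∃ j : b.support, ¬ b.IsPos (act w⁻¹ j) := by
  obtain ⟨l, hl, hlw⟩ := exists_reduced_word b w
  cases l with
  | nil => exact absurd hlw.symm (by simpa [wordProd] using hw)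
  | cons j l =>
    refine ⟨j, fun hpos ↦ ?_⟩
    have hw : refl (j : H.root) * w = wordProd b l := by
      rw [← hlw]
      simp only [wordProd, List.map_cons, List.prod_cons]
      rw [← mul_assoc, refl_mul_self, one_mul]
    have hneg : ¬ b.IsPos (act (refl (j : H.root) * w)⁻¹ j) := by
      intro h
      rw [mul_inv_rev, act_mul, refl_inv, act_refl] at h
      have h2 : act w⁻¹ ((rootSystem H).reflectionPerm j j) =
          (rootSystem H).reflectionPerm (act w⁻¹ j) (act w⁻¹ j) := by
        apply (rootSystem H).root.injective
        rw [← RootPairing.weylGroup_apply_root, RootPairing.root_reflectionPerm,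
          RootPairing.root_reflectionPerm, RootPairing.reflection_apply_self,
          RootPairing.reflection_apply_self, smul_neg, RootPairing.weylGroup_apply_root]
      rw [h2] at h
      exact not_isPos_reflectionPerm_self b hpos h
    have h1 := weylLength_refl_mul_lt b (RootPairing.Base.isPos_of_mem_support j.2) hneg
    rw [← mul_assoc, refl_mul_self, one_mul, hw] at h1
    have h2 := weylLength_wordProd_le b l
    simp only [List.length_cons] at hl
    omega

theorem mem_inversionSet {w : (rootSystem H).weylGroup} {α : H.root} :
    α ∈ inversionSet b w ↔ b.IsPos α ∧ ¬ b.IsPos (act w⁻¹ α) := by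
  constructor
  · rintro ⟨⟨β, hβ, rfl⟩, h⟩
    exact ⟨h, by rw [act_inv_act]; exact hβ⟩
  · rintro ⟨h1, h2⟩
    exact ⟨⟨act w⁻¹ α, h2, act_act_inv w α⟩, h1⟩

/-- A simple inversion `α_j` of `v` is also one of `w`. Multiplying both by `s_j` on the left
shortens both and keeps the inclusion, since `s_j` permutes the positive roots other than `α_j`. -/
theorem weylLength_le_of_inversionSet_subset {v w : (rootSystem H).weylGroup}
    (h : inversionSet b v ⊆ inversionSet b w) : weylLength b v ≤ weylLength b w := by
  induction hn : weylLength b v using Nat.strong_induction_on generalizing v w with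
  | _ n ih =>
    subst hn
    by_cases hv : v = 1
    · subst hv
      exact (weylLength_wordProd_le b []).trans (Nat.zero_le _)
    · obtain ⟨j, hj⟩ := exists_simple_not_isPos b hv
      have hjp := RootPairing.Base.isPos_of_mem_support j.2
      have hjw := ((mem_inversionSet b).1 (h ((mem_inversionSet b).2 ⟨hjp, hj⟩))).2
      have h1 := weylLength_refl_mul_lt b hjp hj
      have h2 := weylLength_refl_mul_lt b hjp hjw
      have h3 := weylLength_le_refl_mul_add_one b v j
      have key : inversionSet b (refl (j : H.root) * v) ⊆ inversionSet b (refl (j : H.root) * w) := by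
        intro β hβ
        rw [mem_inversionSet] at hβ ⊢
        obtain ⟨hβ1, hβ2⟩ := hβ
        rw [mul_inv_rev, act_mul, refl_inv] at hβ2 ⊢
        -- `α_j` itself is no longer an inversion of `s_j v`, because `v⁻¹ s_j α_j = -v⁻¹α_j` is
        -- positive.
        by_cases hβj : β = j
        · subst hβj
          exfalso
          apply hβ2
          have h2 : act v⁻¹ (act (refl (j : H.root)) j) =
              (rootSystem H).reflectionPerm (act v⁻¹ j) (act v⁻¹ j) := by
            apply (rootSystem H).root.injective
            rw [← RootPairing.weylGroup_apply_root, act_refl, RootPairing.root_reflectionPerm,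
              RootPairing.root_reflectionPerm, RootPairing.reflection_apply_self,
              RootPairing.reflection_apply_self, smul_neg, RootPairing.weylGroup_apply_root]
          rw [h2]
          exact (RootPairing.Base.IsPos.neg_iff_not b _).2 hj
        · have hp : b.IsPos (act (refl (j : H.root)) β) := hβ1.reflectionPerm j.2 hβj
          exact ⟨hβ1, ((mem_inversionSet b).1 (h ((mem_inversionSet b).2 ⟨hp, hβ2⟩))).2⟩
      have := ih _ h1 key rfl
      omega

end WeylLength

/-! ### Gradings of the roots with values in `{-1, 0, 1}`. -/

section RootCombinatorics

variable {L : Type*} [LieRing L] [LieAlgebra ℂ L] [FiniteDimensional ℂ L] [IsKilling ℂ L]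
  {H : LieSubalgebra ℂ L} [H.IsCartanSubalgebra] {b : (rootSystem H).Base}

/-- The root `γ` is the sum of the roots `α` and `β`. -/
abbrev IsSum (α β γ : H.root) : Prop :=
  (rootSystem H).root γ = (rootSystem H).root α + (rootSystem H).root β

theorem IsSum.symm {α β γ : H.root} (h : IsSum α β γ) : IsSum β α γ := by
  rw [IsSum, h, add_comm]

theorem IsSum.height {α β γ : H.root} (h : IsSum α β γ) :
    b.height γ = b.height α + b.height β :=
  b.height_add h

theorem pairingIn_add_left {α β γ : H.root} (h : IsSum α β γ) (δ : H.root) :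
    (rootSystem H).pairingIn ℤ γ δ =
      (rootSystem H).pairingIn ℤ α δ + (rootSystem H).pairingIn ℤ β δ := by
  apply (algebraMap ℤ ℂ).injective_int
  rw [map_add]
  simp only [RootPairing.algebraMap_pairingIn, ← RootPairing.root_coroot_eq_pairing]
  rw [h, map_add, LinearMap.add_apply]

theorem exists_isSum_of_pairingIn_neg {α β : H.root} (hα : b.IsPos α) (hβ : b.IsPos β)
    (h : (rootSystem H).pairingIn ℤ α β < 0) : ∃ γ, IsSum α β γ := by
  refine RootPairing.root_add_root_mem_of_pairingIn_neg _ h fun h' ↦ ?_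
  rw [RootPairing.root_eq_neg_iff] at h'
  exact not_isPos_reflectionPerm_self b hβ (h' ▸ hα)

theorem exists_isSum_of_sub {α β γ ε : H.root} (hβ : b.IsPos β) (hγ : b.IsPos γ)
    (h : (rootSystem H).root ε = (rootSystem H).root α + (rootSystem H).root β +
      (rootSystem H).root γ) (hδ : (rootSystem H).pairingIn ℤ α ε > 0) : ∃ δ, IsSum β γ δ := by
  have hne : α ≠ ε := by
    rintro rfl
    have h0 : (rootSystem H).root β = - (rootSystem H).root γ := by
      rw [eq_neg_iff_add_eq_zero]; simpa [add_assoc] using h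
    rw [RootPairing.root_eq_neg_iff] at h0
    exact not_isPos_reflectionPerm_self b hγ (h0 ▸ hβ)
  have := RootPairing.root_sub_root_mem_of_pairingIn_pos _ hδ hne
  rw [← RootPairing.neg_mem_range_root_iff] at this
  obtain ⟨δ, hδ⟩ := this
  exact ⟨δ, by rw [IsSum, hδ, h]; abel⟩

/-- If `α + β` and `α + β + γ` are roots, then so is one of `α + γ`, `β + γ`. -/
theorem IsSum.exchange {α β γ δ ε : H.root} (hα : b.IsPos α) (hβ : b.IsPos β) (hγ : b.IsPos γ)
    (h₁ : IsSum α β δ) (h₂ : IsSum δ γ ε) :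
    (∃ φ, IsSum α γ φ ∧ IsSum φ β ε) ∨ (∃ φ, IsSum β γ φ ∧ IsSum α φ ε) := by
  suffices (∃ φ, IsSum α γ φ) ∨ (∃ φ, IsSum β γ φ) by
    rcases this with ⟨φ, h⟩ | ⟨φ, h⟩
    · exact .inl ⟨φ, h, by rw [IsSum, h, h₂, h₁]; abel⟩
    · exact .inr ⟨φ, h, by rw [IsSum, h, h₂, h₁]; abel⟩
  have hsum : (rootSystem H).root ε = (rootSystem H).root α + (rootSystem H).root β +
      (rootSystem H).root γ := by rw [h₂, h₁]
  -- If `α` pairs positively with `ε`, then `ε - α = β + γ` is a root; the same holds with `α` and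
  -- `β` interchanged.
  by_cases hαε : (rootSystem H).pairingIn ℤ α ε > 0
  · exact .inr (exists_isSum_of_sub hβ hγ hsum hαε)
  by_cases hβε : (rootSystem H).pairingIn ℤ β ε > 0
  · exact .inl (exists_isSum_of_sub hα hγ (by rw [hsum]; abel) hβε)
  -- Otherwise `δ = α + β` pairs nonpositively with `ε = δ + γ`. As `δ` pairs positively with
  -- itself, `γ` pairs negatively with `δ`, hence with `α` or with `β`.
  have hδε : (rootSystem H).pairingIn ℤ ε δ ≤ 0 := by
    have h3 := pairingIn_add_left h₁ ε
    by_contra! h4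
    rw [RootPairing.zero_lt_pairingIn_iff'] at h4
    omega
  have hγδ : (rootSystem H).pairingIn ℤ δ γ < 0 := by
    have h3 := pairingIn_add_left h₂ δ
    rw [RootPairing.pairingIn_same] at h3
    rw [RootPairing.pairingIn_lt_zero_iff]
    omega
  rw [pairingIn_add_left h₁ γ] at hγδ
  by_cases h5 : (rootSystem H).pairingIn ℤ α γ < 0
  · exact .inl (exists_isSum_of_pairingIn_neg hα hγ h5)
  · exact .inr (exists_isSum_of_pairingIn_neg hβ hγ (by omega))

theorem exists_isSum_simple {γ : H.root} (hγ : b.IsPos γ) (hs : γ ∉ b.support) :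
    ∃ α β, IsSum α β γ ∧ b.IsPos α ∧ β ∈ b.support := by
  obtain ⟨j, hj, hj'⟩ := hγ.exists_mem_support_pos_pairingIn
  rw [RootPairing.zero_lt_pairingIn_iff'] at hj'
  have hne : γ ≠ j := fun h ↦ hs (h ▸ hj)
  obtain ⟨k, hk⟩ := RootPairing.root_sub_root_mem_of_pairingIn_pos _ hj' hne
  refine ⟨k, j, by rw [IsSum, hk]; abel, hγ.sub hj hk, hj⟩

/-- A function on the roots that is additive where sums are defined. -/
def IsAdditive (f : H.root → ℤ) : Prop :=
  ∀ α β γ, IsSum α β γ → f γ = f α + f β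

/-- `ε` is a grading of the roots with values in `{-1, 0, 1}`, and `p` counts the simple roots of
degree `1` that occur in a root. -/
structure IsTernary (b : (rootSystem H).Base) (ε p : H.root → ℤ) : Prop where
  add_deg : IsAdditive ε
  add_count : IsAdditive p
  deg_le : ∀ α, ε α ≤ 1
  le_deg : ∀ α, -1 ≤ ε α
  count_of_eq_one : ∀ α ∈ b.support, ε α = 1 → p α = 1
  count_of_ne_one : ∀ α ∈ b.support, ε α ≠ 1 → p α = 0

variable {ε p : H.root → ℤ}

/-- The count of simple roots of degree `-1`. -/
theorem IsTernary.neg (h : IsTernary b ε p) : IsTernary b (-ε) (p - ε) where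
  add_deg α β γ hs := by simp [h.add_deg _ _ _ hs]; ring
  add_count α β γ hs := by simp [h.add_deg _ _ _ hs, h.add_count _ _ _ hs]; ring
  deg_le α := by have := h.le_deg α; simp; omega
  le_deg α := by have := h.deg_le α; simp; omega
  count_of_eq_one α hα h1 := by
    have h1 : ε α = -1 := by simpa [neg_eq_iff_eq_neg] using h1
    simp [h1, h.count_of_ne_one α hα (by omega)]
  count_of_ne_one α hα h1 := by
    have h2 := h.le_deg α
    have h3 := h.deg_le α
    have h1 : ε α ≠ -1 := by simpa [neg_eq_iff_eq_neg] using h1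
    by_cases h4 : ε α = 1
    · simp [h4, h.count_of_eq_one α hα h4]
    · have : ε α = 0 := by omega
      simp [this, h.count_of_ne_one α hα h4]

theorem IsTernary.count_nonneg (h : IsTernary b ε p) {α : H.root} (hα : b.IsPos α) : 0 ≤ p α := by
  have hs (α) (hα : α ∈ b.support) : 0 ≤ p α := by
    by_cases h1 : ε α = 1
    · simp [h.count_of_eq_one α hα h1]
    · simp [h.count_of_ne_one α hα h1]
  refine hα.induction_on_add hs fun α j γ hγ hα hj ↦ ?_
  rw [h.add_count _ _ _ hγ]; have := hs j hj; omega

/-- A positive root of degree `-1` in which a simple root of degree `1` occurs splits off a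
positive root of degree `0` with the same property. -/
theorem IsTernary.exists_split_neg (h : IsTernary b ε p) {μ : H.root} (hμ : b.IsPos μ)
    (hε : ε μ = -1) (hp : 1 ≤ p μ) :
    ∃ μ₁ η, IsSum μ₁ η μ ∧ b.IsPos μ₁ ∧ b.IsPos η ∧ ε μ₁ = -1 ∧ ε η = 0 ∧ 1 ≤ p η := by
  refine (hμ.induction_on_add (p := fun μ ↦ b.IsPos μ ∧ (ε μ = -1 → 1 ≤ p μ →
    ∃ μ₁ η, IsSum μ₁ η μ ∧ b.IsPos μ₁ ∧ b.IsPos η ∧ ε μ₁ = -1 ∧ ε η = 0 ∧ 1 ≤ p η))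
    (fun α hα ↦ ?_) (fun α j γ hγ ih hj ↦ ?_)).2 hε hp
  · refine ⟨RootPairing.Base.isPos_of_mem_support hα, fun h1 h2 ↦ ?_⟩
    have := h.count_of_ne_one α hα (by omega)
    omega
  · obtain ⟨hα, ih⟩ := ih
    have hjp := RootPairing.Base.isPos_of_mem_support hj
    refine ⟨hα.add hjp hγ, fun h1 h2 ↦ ?_⟩
    rw [h.add_deg _ _ _ hγ] at h1
    rw [h.add_count _ _ _ hγ] at h2
    have b1 := h.le_deg α; have b2 := h.deg_le α; have b3 := h.le_deg j; have b4 := h.deg_le j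
    have hj1 : p j = 0 := h.count_of_ne_one j hj (by omega)
    -- A simple root of degree `0` is absorbed into one of the two summands by `IsSum.exchange`. A
    -- simple root of degree `-1` is itself the first summand.
    by_cases hj0 : ε j = 0
    · obtain ⟨μ₁, η, hs, hμ₁, hη, e1, e2, e3⟩ := ih (by omega) (by omega)
      rcases hs.exchange hμ₁ hη hjp hγ with ⟨φ, s1, s2⟩ | ⟨φ, s1, s2⟩
      · exact ⟨φ, η, s2, hμ₁.add hjp s1, hη, by rw [h.add_deg _ _ _ s1]; omega, e2, e3⟩
      · exact ⟨μ₁, φ, s2, hμ₁, hη.add hjp s1, e1, by rw [h.add_deg _ _ _ s1]; omega,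
          by rw [h.add_count _ _ _ s1]; omega⟩
    · exact ⟨j, α, IsSum.symm hγ, hjp, hα, by omega, by omega, by omega⟩

/-- A positive root of degree `0` in which a simple root of degree `1` occurs is the sum of positive
roots of degrees `-1` and `1`. -/
theorem IsTernary.exists_split_zero (h : IsTernary b ε p) {ν : H.root} (hν : b.IsPos ν)
    (hε : ε ν = 0) (hp : 1 ≤ p ν) :
    ∃ μ π, IsSum μ π ν ∧ b.IsPos μ ∧ b.IsPos π ∧ ε μ = -1 ∧ ε π = 1 := by
  refine (hν.induction_on_add (p := fun ν ↦ b.IsPos ν ∧ (ε ν = 0 → 1 ≤ p ν →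
    ∃ μ π, IsSum μ π ν ∧ b.IsPos μ ∧ b.IsPos π ∧ ε μ = -1 ∧ ε π = 1))
    (fun α hα ↦ ?_) (fun α j γ hγ ih hj ↦ ?_)).2 hε hp
  · refine ⟨RootPairing.Base.isPos_of_mem_support hα, fun h1 h2 ↦ ?_⟩
    have := h.count_of_ne_one α hα (by omega)
    omega
  · obtain ⟨hα, ih⟩ := ih
    have hjp := RootPairing.Base.isPos_of_mem_support hj
    refine ⟨hα.add hjp hγ, fun h1 h2 ↦ ?_⟩
    rw [h.add_deg _ _ _ hγ] at h1
    rw [h.add_count _ _ _ hγ] at h2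
    have b1 := h.le_deg α; have b2 := h.deg_le α; have b3 := h.le_deg j; have b4 := h.deg_le j
    by_cases hj0 : ε j = 0
    · have hj1 : p j = 0 := h.count_of_ne_one j hj (by omega)
      obtain ⟨μ, π, hs, hμ, hπ, e1, e2⟩ := ih (by omega) (by omega)
      rcases hs.exchange hμ hπ hjp hγ with ⟨φ, s1, s2⟩ | ⟨φ, s1, s2⟩
      · exact ⟨φ, π, s2, hμ.add hjp s1, hπ, by rw [h.add_deg _ _ _ s1]; omega, e2⟩
      · exact ⟨μ, φ, s2, hμ, hπ.add hjp s1, e1, by rw [h.add_deg _ _ _ s1]; omega⟩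
    · by_cases hj2 : ε j = 1
      · exact ⟨α, j, hγ, hα, hjp, by omega, by omega⟩
      · exact ⟨j, α, IsSum.symm hγ, hjp, hα, by omega, by omega⟩

/-- A positive root of degree `0` that is not a sum of two positive roots of degree `0`. -/
structure IsIndecomposable (b : (rootSystem H).Base) (ε : H.root → ℤ) (β : H.root) : Prop where
  isPos : b.IsPos β
  deg : ε β = 0
  indec : ∀ x y, IsSum x y β → b.IsPos x → b.IsPos y → ε x = 0 → ε y ≠ 0

/-- Start from any splitting with a summand of degree `0`. If that summand decomposes in degree `0`,
`IsSum.exchange` lets one of its two pieces move to the other side, so its height drops until it is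
indecomposable. -/
theorem IsTernary.exists_split_indecomposable (h : IsTernary b ε p) {μ : H.root} (hμ : b.IsPos μ)
    (hs : μ ∉ b.support) (hε : ε μ = -1) :
    ∃ μ₁ μ₂, IsSum μ₁ μ₂ μ ∧ b.IsPos μ₁ ∧ ε μ₁ = -1 ∧ IsIndecomposable b ε μ₂ := by
  have key : ∀ n : ℕ, ∀ μ₁ μ₂, IsSum μ₁ μ₂ μ → b.IsPos μ₁ → b.IsPos μ₂ → ε μ₂ = 0 →
      (b.height μ₂).toNat = n →
      ∃ μ₁ μ₂, IsSum μ₁ μ₂ μ ∧ b.IsPos μ₁ ∧ ε μ₁ = -1 ∧ IsIndecomposable b ε μ₂ := by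
    intro n
    induction n using Nat.strong_induction_on with
    | _ n ih =>
      intro μ₁ μ₂ hsum hμ₁ hμ₂ h0 hn
      by_cases hi : IsIndecomposable b ε μ₂
      · refine ⟨μ₁, μ₂, hsum, hμ₁, ?_, hi⟩
        have := h.add_deg _ _ _ hsum
        omega
      · have : ∃ x y, IsSum x y μ₂ ∧ b.IsPos x ∧ b.IsPos y ∧ ε x = 0 ∧ ε y = 0 := by
          by_contra! hc
          exact hi ⟨hμ₂, h0, hc⟩
        obtain ⟨x, y, hxy, hx, hy, hx0, hy0⟩ := this
        have hh := hxy.height (b := b)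
        have hx' : 0 < b.height x := hx
        have hy' : 0 < b.height y := hy
        rcases hxy.exchange hx hy hμ₁ hsum.symm with ⟨φ, s1, s2⟩ | ⟨φ, s1, s2⟩
        · exact ih _ (by omega) φ y s2 (hx.add hμ₁ s1) hy hy0 rfl
        · exact ih _ (by omega) φ x s2.symm (hy.add hμ₁ s1) hx hx0 rfl
  obtain ⟨α, j, hs', hα, hj⟩ := exists_isSum_simple hμ hs
  have hjp := RootPairing.Base.isPos_of_mem_support hj
  have b1 := h.le_deg α; have b2 := h.deg_le α; have b3 := h.le_deg j; have b4 := h.deg_le j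
  have := h.add_deg _ _ _ hs'
  by_cases hj0 : ε j = 0
  · exact key _ α j hs' hα hjp hj0 rfl
  · exact key _ j α hs'.symm hjp hα (by omega) rfl

/-- Induction on the height of `μ = μ₁ + μ₂`, with `μ₂` indecomposable of degree `0`. Here `μ₁ + ν`
is not a root, as it would decompose `β` in degree `0`; so `g = μ₂ + ν` is a root, and induction for
`β = μ₁ + g` gives `p μ₁ = 0`. If `p μ₂ ≠ 0`, then `μ₂ = σ + π` with degrees `-1` and `1`.
Exchanging with `ν` and then with `μ₁` leads in every case to a root of degree `±2`, to `μ₁ + ν`, or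
to a decomposition of `β` in degree `0`. -/
theorem IsTernary.count_eq_zero_of_isSum (h : IsTernary b ε p) {β : H.root}
    (hβ : IsIndecomposable b ε β)
    {μ ν : H.root} (hs : IsSum μ ν β) (hμ : b.IsPos μ) (hν : b.IsPos ν) (hεμ : ε μ = -1) :
    p μ = 0 := by
  induction hn : (b.height μ).toNat using Nat.strong_induction_on generalizing μ ν with
  | _ n ih' =>
    by_cases hsupp : μ ∈ b.support
    · exact h.count_of_ne_one μ hsupp (by omega)
    obtain ⟨μ₁, μ₂, hs', hμ₁, hεμ₁, hi⟩ := h.exists_split_indecomposable hμ hsupp hεμ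
    have hμ₂ := hi.isPos
    have hεν : ε ν = 1 := by
      have := h.add_deg _ _ _ hs
      have := hβ.deg
      omega
    have hno : ¬ ∃ φ, IsSum μ₁ ν φ := by
      rintro ⟨φ, hφ⟩
      have e1 : ε φ = 0 := by rw [h.add_deg _ _ _ hφ]; omega
      exact hβ.indec φ μ₂ (by rw [IsSum, hφ, hs, hs']; abel) (hμ₁.add hν hφ) hμ₂ e1 hi.deg
    have h1 : b.height μ = b.height μ₁ + b.height μ₂ := hs'.height
    have h2 : b.height β = b.height μ + b.height ν := hs.height
    have hμ₁' : 0 < b.height μ₁ := hμ₁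
    have hμ₂' : 0 < b.height μ₂ := hμ₂
    have hν' : 0 < b.height ν := hν
    rcases hs'.exchange hμ₁ hμ₂ hν hs with ⟨φ, s1, -⟩ | ⟨g, s1, s2⟩
    · exact absurd ⟨φ, s1⟩ hno
    have hg := hμ₂.add hν s1
    have hp1 : p μ₁ = 0 := ih' _ (by omega) s2 hμ₁ hg hεμ₁ rfl
    have hp2 : p μ₂ = 0 := by
      by_contra hp
      have hp0 := h.count_nonneg hμ₂
      obtain ⟨σ, π, t1, hσ, hπ, e1, e2⟩ := h.exists_split_zero hμ₂ hi.deg (by omega)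
      rcases t1.exchange hσ hπ hν s1 with ⟨ρ, u1, u2⟩ | ⟨ρ, u1, -⟩
      · have hρ := hσ.add hν u1
        have eρ : ε ρ = 0 := by rw [h.add_deg _ _ _ u1]; omega
        rcases u2.exchange hρ hπ hμ₁ s2.symm with ⟨f, v1, v2⟩ | ⟨f, v1, v2⟩
        · rcases u1.exchange hσ hν hμ₁ v1 with ⟨f', x1, -⟩ | ⟨f', x1, -⟩
          · have := h.add_deg _ _ _ x1
            have := h.le_deg f'
            omega
          · exact hno ⟨f', x1.symm⟩
        · exact hβ.indec ρ f v2 hρ (hπ.add hμ₁ v1) eρ (by rw [h.add_deg _ _ _ v1]; omega)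
      · have := h.add_deg _ _ _ u1
        have := h.deg_le ρ
        omega
    rw [h.add_count _ _ _ hs', hp1, hp2, add_zero]

/-- In an indecomposable root of degree `0` at most one simple root of degree `1` occurs. -/
theorem IsTernary.count_le_one (h : IsTernary b ε p) {β : H.root}
    (hβ : IsIndecomposable b ε β) : p β ≤ 1 := by
  have key : ∀ μ ν, IsSum μ ν β → b.IsPos μ → b.IsPos ν → ε μ = -1 → p β ≤ 1 := by
    intro μ ν hs hμ hν hε
    have h1 := h.count_eq_zero_of_isSum hβ hs hμ hν hε
    have hεν : ε ν = 1 := by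
      have := h.add_deg _ _ _ hs
      have := hβ.deg
      omega
    have hi (γ) : IsIndecomposable b (-ε) γ ↔ IsIndecomposable b ε γ := by
      constructor
      · rintro ⟨a1, a2, a3⟩
        exact ⟨a1, by simpa using a2, by simpa using a3⟩
      · rintro ⟨a1, a2, a3⟩
        exact ⟨a1, by simpa using a2, by simpa using a3⟩
    -- The same lemma for the opposite grading, whose count is `p - ε`: from `ε ν = 1` it follows
    -- that `p ν = 1`, while `p μ = 0`.
    have h2 := h.neg.count_eq_zero_of_isSum ((hi β).2 hβ) hs.symm hν hμ (by simp [hεν])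
    rw [Pi.sub_apply, hεν] at h2
    rw [h.add_count _ _ _ hs]
    omega
  by_cases hsupp : β ∈ b.support
  · have := h.count_of_ne_one β hsupp (by have := hβ.deg; omega)
    omega
  · obtain ⟨α, j, hs, hα, hj⟩ := exists_isSum_simple hβ.isPos hsupp
    have hjp := RootPairing.Base.isPos_of_mem_support hj
    have b1 := h.le_deg α; have b2 := h.deg_le α; have b3 := h.le_deg j; have b4 := h.deg_le j
    have := h.add_deg _ _ _ hs
    have := hβ.deg
    have := hβ.indec α j hs hα hjp
    by_cases hα0 : ε α = -1
    · exact key α j hs hα hjp hα0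
    · exact key j α hs.symm hjp hα (by omega)

end RootCombinatorics

/-! ### The pair `(J, a)` at the level of roots. -/

section MarkingRoots

variable {L : Type*} [LieRing L] [LieAlgebra ℂ L] [FiniteDimensional ℂ L] [IsKilling ℂ L]
  {H : LieSubalgebra ℂ L} [H.IsCartanSubalgebra] (b : (rootSystem H).Base)

/-- The coefficient of the simple root `α_j` in a root. -/
def coeff (j : b.support) (α : H.root) : ℤ :=
  (b.exists_root_eq_sum_int α).choose j

theorem root_eq_sum_coeff (α : H.root) :
    (rootSystem H).root α = ∑ j : b.support, coeff b j α • (rootSystem H).root j := by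
  obtain ⟨-, -, h⟩ := (b.exists_root_eq_sum_int α).choose_spec
  rw [h, ← Finset.sum_coe_sort]
  simp [coeff]

theorem coeff_nonneg {α : H.root} (h : b.IsPos α) (j : b.support) : 0 ≤ coeff b j α := by
  obtain ⟨-, h₁, -⟩ := (b.exists_root_eq_sum_int α).choose_spec
  rcases h₁ with h₁ | h₁
  · exact h₁.le j
  · exfalso
    have : b.height α ≤ 0 := Finset.sum_nonpos fun k _ ↦ h₁.le k
    have h' : 0 < b.height α := h
    omega

theorem coe_coeff (j : b.support) (α : H.root) : (coeff b j α : ℂ) = α.1 (dualElement b j) := by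
  classical
  have h : (rootSystem H).root α (dualElement b j) = coeff b j α := by
    rw [root_eq_sum_coeff b α, LinearMap.sum_apply]
    rw [Finset.sum_eq_single j]
    · rw [LinearMap.smul_apply]
      have := root_dualElement b j j
      rw [if_pos rfl] at this
      rw [show (rootSystem H).root j (dualElement b j) = 1 from this]
      simp
    · intro k _ hk
      have := root_dualElement b j k
      rw [if_neg hk] at this
      rw [LinearMap.smul_apply, show (rootSystem H).root k (dualElement b j) = 0 from this]
      simp
    · simp
  exact h.symm

theorem coeff_isAdditive (j : b.support) : IsAdditive (coeff b j) := by
  intro α β γ h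
  have : ((coeff b j γ : ℤ) : ℂ) = ((coeff b j α + coeff b j β : ℤ) : ℂ) := by
    push_cast
    simp only [coe_coeff]
    exact LinearMap.congr_fun h (dualElement b j)
  exact_mod_cast this

open scoped Classical in
theorem coeff_simple (j k : b.support) : coeff b j k = if k = j then 1 else 0 := by
  have h := root_dualElement b j k
  rw [← coe_coeff] at h
  split_ifs at h ⊢ <;> exact_mod_cast h

/-- The root `-α`. -/
abbrev negRoot (α : H.root) : H.root := (rootSystem H).reflectionPerm α α

theorem root_negRoot (α : H.root) : (rootSystem H).root (negRoot α) = -(rootSystem H).root α := by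
  rw [RootPairing.root_reflectionPerm, RootPairing.reflection_apply_self]

theorem negRoot_apply (α : H.root) (x : H) : (negRoot α).1 x = -α.1 x :=
  LinearMap.congr_fun (root_negRoot α) x

@[simp] theorem negRoot_negRoot (α : H.root) : negRoot (negRoot α) = α := by
  apply (rootSystem H).root.injective
  rw [root_negRoot, root_negRoot, neg_neg]

theorem isPos_negRoot {α : H.root} : b.IsPos (negRoot α) ↔ ¬ b.IsPos α :=
  RootPairing.Base.IsPos.neg_iff_not b α

theorem coeff_negRoot (j : b.support) (α : H.root) : coeff b j (negRoot α) = -coeff b j α := by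
  have : ((coeff b j (negRoot α) : ℤ) : ℂ) = ((-coeff b j α : ℤ) : ℂ) := by
    push_cast
    rw [coe_coeff, coe_coeff, negRoot_apply]
  exact_mod_cast this

theorem coeff_nonpos {α : H.root} (h : ¬ b.IsPos α) (j : b.support) : coeff b j α ≤ 0 := by
  have := coeff_nonneg b ((isPos_negRoot b).2 h) j
  rw [coeff_negRoot] at this
  omega

theorem act_isSum (w : (rootSystem H).weylGroup) {α β γ : H.root} (h : IsSum α β γ) :
    IsSum (act w α) (act w β) (act w γ) := by
  rw [IsSum, ← RootPairing.weylGroup_apply_root, ← RootPairing.weylGroup_apply_root,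
    ← RootPairing.weylGroup_apply_root, h, smul_add]

theorem act_negRoot (w : (rootSystem H).weylGroup) (α : H.root) :
    act w (negRoot α) = negRoot (act w α) := by
  apply (rootSystem H).root.injective
  rw [← RootPairing.weylGroup_apply_root, root_negRoot, root_negRoot, smul_neg,
    RootPairing.weylGroup_apply_root]

theorem IsAdditive.eq_of_simple {f g : H.root → ℤ} (hf : IsAdditive f) (hg : IsAdditive g)
    (hf' : ∀ α, f (negRoot α) = -f α) (hg' : ∀ α, g (negRoot α) = -g α)
    (h : ∀ j : b.support, f j = g j) (α : H.root) : f α = g α := by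
  induction α using RootPairing.Base.induction_add (b := b) with
  | h₀ α h => rw [hf', hg', h]
  | h₁ α hα => exact h ⟨α, hα⟩
  | h₂ α j γ hs ih hj => rw [hf _ _ _ hs, hg _ _ _ hs, ih, h ⟨j, hj⟩]

/-- A positive root in which `α_i` does not occur is built by successively adding simple roots other
than `α_i`, and `w` keeps each of these positive. -/
theorem isPos_of_forall_simple {w : (rootSystem H).weylGroup} {i : b.support}
    (h : ∀ j : b.support, j ≠ i → b.IsPos (act w j)) {α : H.root} (hα : b.IsPos α)
    (hi : coeff b i α = 0) : b.IsPos (act w α) := by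
  refine (hα.induction_on_add (p := fun α ↦ b.IsPos α ∧ (coeff b i α = 0 → b.IsPos (act w α)))
    (fun α hα ↦ ?_) (fun α j γ hγ ih hj ↦ ?_)).2 hi
  · refine ⟨RootPairing.Base.isPos_of_mem_support hα, fun h0 ↦ h ⟨α, hα⟩ ?_⟩
    rintro rfl
    have := coeff_simple b ⟨α, hα⟩ ⟨α, hα⟩
    rw [if_pos rfl] at this
    simp only at this
    omega
  · have hjp := RootPairing.Base.isPos_of_mem_support hj
    refine ⟨ih.1.add hjp hγ, fun h0 ↦ ?_⟩
    rw [coeff_isAdditive b i _ _ _ hγ] at h0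
    have h1 := coeff_nonneg b ih.1 i
    have h2 := coeff_nonneg b hjp i
    refine (ih.2 (by omega)).add (h ⟨j, hj⟩ ?_) (act_isSum w hγ)
    rintro rfl
    have := coeff_simple b ⟨j, hj⟩ ⟨j, hj⟩
    rw [if_pos rfl] at this
    simp only at this
    omega

variable {b}

theorem IsCominuscule.coeff_le {i : b.support} (hi : IsCominuscule b i) (α : H.root) :
    coeff b i α ≤ 1 ∧ -1 ≤ coeff b i α := by
  have := hi α
  rw [← coe_coeff] at this
  simp only [Set.mem_insert_iff, Set.mem_singleton_iff] at this
  have h : coeff b i α = -1 ∨ coeff b i α = 0 ∨ coeff b i α = 1 := by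
    rcases this with h | h | h
    · left; exact_mod_cast h
    · right; left; exact_mod_cast h
    · right; right; exact_mod_cast h
  omega

theorem lie_gradingElement_of_mem (j : b.support) {α : H.root} {x : L} (hx : x ∈ rootPiece α) :
    ⁅gradingElement b j, x⁆ = (coeff b j α : ℂ) • x := by
  rw [coe_coeff]
  exact lie_eq_smul_of_mem_rootSpace hx (dualElement b j)

/-- Otherwise `s_j w` would be a shorter representative of the coset of `w`, since `s_j` belongs to
the Weyl group of the Levi factor. -/
theorem isPos_of_mem_hasseDiagram {i : b.support} {w : (rootSystem H).weylGroup}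
    (hw : w ∈ hasseDiagram b i) {j : b.support} (hj : j ≠ i) : b.IsPos (act w⁻¹ j) := by
  by_contra h
  have h1 := weylLength_refl_mul_lt b (RootPairing.Base.isPos_of_mem_support j.2) h
  have h2 := hw (refl (j : H.root)) (Subgroup.subset_closure ⟨j, ?_, rfl⟩)
  · omega
  · intro x hx
    rw [gradedPiece, End.mem_eigenspace_iff, ad_apply, lie_gradingElement_of_mem i hx, coeff_simple,
      if_neg hj]

theorem coeff_of_mem_inversionSet {i : b.support} (hi : IsCominuscule b i)
    {w : (rootSystem H).weylGroup} (hw : w ∈ hasseDiagram b i) {α : H.root}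
    (hα : α ∈ inversionSet b w) : coeff b i α = 1 := by
  rw [mem_inversionSet] at hα
  have h1 := coeff_nonneg b hα.1 i
  have h2 := (hi.coeff_le α).1
  by_contra h
  exact hα.2 (isPos_of_forall_simple b (fun j hj ↦ isPos_of_mem_hasseDiagram hw hj) hα.1 (by omega))

/-- Inversions of elements of `W^𝔭` have degree `1`. If all roots of degree `1` were inversions of
`w`, its inversion set would contain that of every element of `W^𝔭`, and `w` would be longest. -/
theorem exists_notMem_inversionSet {i : b.support} (hi : IsCominuscule b i)
    {w : (rootSystem H).weylGroup} (hw : w ∈ hasseDiagram b i) (hl : ¬ IsLongest b i w) :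
    ∃ α, coeff b i α = 1 ∧ α ∉ inversionSet b w := by
  by_contra! h
  refine hl ⟨hw, fun w' hw' ↦ weylLength_le_of_inversionSet_subset b fun α hα ↦ ?_⟩
  exact h α (coeff_of_mem_inversionSet hi hw' hα)

/-- The value of `Z_J - a Z_i` on a root. -/
def level (i : b.support) (J : Finset b.support) (a : ℕ) (α : H.root) : ℤ :=
  ∑ j ∈ J, coeff b j α - a * coeff b i α

theorem sum_coeff_isAdditive (J : Finset b.support) : IsAdditive fun α ↦ ∑ j ∈ J, coeff b j α := by
  intro α β γ h
  simp only [coeff_isAdditive b _ _ _ _ h, Finset.sum_add_distrib]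

theorem level_isAdditive (i : b.support) (J : Finset b.support) (a : ℕ) :
    IsAdditive (level i J a) := by
  intro α β γ h
  simp only [level, coeff_isAdditive b _ _ _ _ h, Finset.sum_add_distrib]
  ring

theorem level_negRoot (i : b.support) (J : Finset b.support) (a : ℕ) (α : H.root) :
    level i J a (negRoot α) = -level i J a α := by
  simp only [level, coeff_negRoot, Finset.sum_neg_distrib]
  ring

/-- The root-theoretic content of a marking `(J, a)` of `w`. -/
structure IsRootMarking (i : b.support) (w : (rootSystem H).weylGroup) (J : Finset b.support)
    (a : ℕ) : Prop where
  notMem : i ∉ J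
  mem_inversionSet_iff : ∀ α, coeff b i α = 1 → (α ∈ inversionSet b w ↔ level i J a α ≤ 0)
  exists_of_level_neg : ∀ η, coeff b i η = 0 → level i J a η < 0 →
    ∃ γ ∈ inversionSet b w, ∃ γ' ∉ inversionSet b w, IsSum γ' η γ
  exists_of_level_neg' : ∀ β, coeff b i β = 1 → level i J a β < 0 →
    ∃ γ δ, coeff b i γ = 1 ∧ level i J a γ ≤ 0 ∧ level i J a β < level i J a γ ∧ IsSum γ δ β
  level_nonneg : ∀ α, b.IsPos (act w⁻¹ α) → 0 ≤ level i J a α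

-- The level is `p ∘ w⁻¹`, where `p` counts simple roots of degree `1` for the grading pulled back
-- by `w`. Every field then becomes a statement about positive roots for that grading: nonnegativity
-- of `p` and of `p - ε`, or one of the splitting lemmas.
open scoped Classical in
theorem exists_isRootMarking {i : b.support} (hi : IsCominuscule b i)
    {w : (rootSystem H).weylGroup} (hw : w ∈ hasseDiagram b i) (hw1 : w ≠ 1) :
    ∃ J a, IsRootMarking i w J a := by
  set ε : H.root → ℤ := fun α ↦ coeff b i (act w α) with hε
  set K : Finset b.support := Finset.univ.filter fun k ↦ ε k = 1 with hK
  set p : H.root → ℤ := fun α ↦ ∑ k ∈ K, coeff b k α with hp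
  have hps (k : b.support) : p k = if ε k = 1 then 1 else 0 := by
    simp only [hp, coeff_simple, Finset.sum_ite_eq, hK, Finset.mem_filter, Finset.mem_univ,
      true_and]
  have T : IsTernary b ε p :=
    { add_deg := fun α β γ h ↦ coeff_isAdditive b i _ _ _ (act_isSum w h)
      add_count := sum_coeff_isAdditive K
      deg_le := fun α ↦ (hi.coeff_le _).1
      le_deg := fun α ↦ (hi.coeff_le _).2
      count_of_eq_one := fun α hα h ↦ by have := hps ⟨α, hα⟩; rwa [if_pos h] at this
      count_of_ne_one := fun α hα h ↦ by have := hps ⟨α, hα⟩; rwa [if_neg h] at this }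
  have hpn (α) : p (negRoot α) = -p α := by simp only [hp, coeff_negRoot, Finset.sum_neg_distrib]
  have hεn (α) : ε (negRoot α) = -ε α := by simp only [hε, act_negRoot, coeff_negRoot]
  have hεi (α) : ε (act w⁻¹ α) = coeff b i α := by simp only [hε, act_act_inv]
  have hpos : ∀ j : b.support, j ≠ i → b.IsPos (act w⁻¹ j) :=
    fun j hj ↦ isPos_of_mem_hasseDiagram hw hj
  have hipos : ¬ b.IsPos (act w⁻¹ i) := by
    obtain ⟨j, hj⟩ := exists_simple_not_isPos b hw1
    by_cases hji : j = i
    · exact hji ▸ hj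
    · exact absurd (hpos j hji) hj
  -- Positive roots with `ε = 0` stay positive under `w`, so a decomposition in degree `0` would
  -- write the simple root `α_j`, of height `1`, as a sum of two positive roots.
  have hind (j : b.support) (hj : j ≠ i) : IsIndecomposable b ε (act w⁻¹ j) := by
    refine ⟨hpos j hj, by rw [hεi, coeff_simple, if_neg hj], fun x y hxy hx hy hx0 hy0 ↦ ?_⟩
    have aux (x : H.root) (hx : b.IsPos x) (hx0 : ε x = 0) : b.IsPos (act w x) := by
      by_contra hc
      have := isPos_of_forall_simple b hpos ((isPos_negRoot b).2 hc)
        (by rw [coeff_negRoot]; simpa [hε] using hx0)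
      rw [act_negRoot, act_inv_act, isPos_negRoot] at this
      exact this hx
    have hs := act_isSum w hxy
    rw [act_act_inv] at hs
    have h1 : 0 < b.height (act w x) := aux x hx hx0
    have h2 : 0 < b.height (act w y) := aux y hy hy0
    have h3 := hs.height (b := b)
    rw [RootPairing.Base.height_one_of_mem_support j.2] at h3
    omega
  have hcount (j : b.support) (hj : j ≠ i) : p (act w⁻¹ j) = 0 ∨ p (act w⁻¹ j) = 1 := by
    have h1 := T.count_le_one (hind j hj)
    have h2 := T.count_nonneg (hpos j hj)
    omega
  have hicount : p (act w⁻¹ i) ≤ 0 := by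
    have := T.count_nonneg ((isPos_negRoot b).2 hipos)
    rw [hpn] at this
    omega
  set J : Finset b.support := Finset.univ.filter fun j ↦ j ≠ i ∧ p (act w⁻¹ j) = 1 with hJ
  -- No truncation occurs: `w ≠ 1` forces `w⁻¹α_i` to be negative, so `p` is nonpositive there.
  set a : ℕ := (-p (act w⁻¹ i)).toNat with ha
  have haz : (a : ℤ) = -p (act w⁻¹ i) := by omega
  have hlev : ∀ α, level i J a α = p (act w⁻¹ α) := by
    refine IsAdditive.eq_of_simple b (level_isAdditive i J a)
      (fun α β γ h ↦ T.add_count _ _ _ (act_isSum _ h)) (level_negRoot i J a)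
      (fun α ↦ by rw [act_negRoot, hpn]) fun j ↦ ?_
    simp only [level, coeff_simple, Finset.sum_ite_eq]
    by_cases hj : j = i
    · subst hj
      rw [if_neg (by simp [hJ]), if_pos rfl, haz]
      ring
    · rw [if_neg hj]
      rcases hcount j hj with h | h
      · rw [if_neg (by simp [hJ, h]), h]; ring
      · rw [if_pos (by simp [hJ, h, hj]), h]; ring
  refine ⟨J, a, by simp [hJ], fun α hα ↦ ?_, fun η hη hη' ↦ ?_, fun β hβ hβ' ↦ ?_, fun α hα ↦ ?_⟩
  · have hαp : b.IsPos α := by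
      by_contra h
      have := coeff_nonpos b h i
      omega
    rw [mem_inversionSet, hlev]
    refine ⟨fun h ↦ ?_, fun h ↦ ⟨hαp, fun h' ↦ ?_⟩⟩
    · have := T.count_nonneg ((isPos_negRoot b).2 h.2)
      rw [hpn] at this
      omega
    -- If `w⁻¹α` is positive and has `ε = 1`, then `p - ε ≥ 0` gives level at least `1`.
    · have h1 := T.neg.count_nonneg h'
      rw [Pi.sub_apply, hεi] at h1
      omega
  · rw [hlev] at hη'
    have hpos' : b.IsPos (negRoot (act w⁻¹ η)) := by
      rw [isPos_negRoot]
      intro h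
      have := T.count_nonneg h
      omega
    -- From `-w⁻¹η = μ + π` one gets `-wμ = wπ + η`, where `-wμ` is an inversion of `w` and `wπ` is
    -- not.
    obtain ⟨μ, π, hs, hμ, hπ, e1, e2⟩ := T.exists_split_zero hpos'
      (by rw [hεn, hεi, hη, neg_zero]) (by rw [hpn]; omega)
    have hs' := act_isSum w hs
    rw [act_negRoot, act_act_inv] at hs'
    refine ⟨act w (negRoot μ), ?_, act w π, ?_, ?_⟩
    · have : coeff b i (act w (negRoot μ)) = 1 := by
        rw [act_negRoot, coeff_negRoot]
        have : coeff b i (act w μ) = -1 := e1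
        omega
      rw [mem_inversionSet, act_inv_act, isPos_negRoot, not_not]
      refine ⟨?_, hμ⟩
      by_contra h
      have := coeff_nonpos b h i
      omega
    · rw [mem_inversionSet, act_inv_act]
      exact fun h ↦ h.2 hπ
    · rw [IsSum, root_negRoot] at hs'
      rw [IsSum, act_negRoot, root_negRoot]
      rw [neg_eq_iff_eq_neg] at hs'
      rw [hs']
      abel
  · rw [hlev] at hβ'
    have hpos' : b.IsPos (negRoot (act w⁻¹ β)) := by
      rw [isPos_negRoot]
      intro h
      have := T.count_nonneg h
      omega
    -- From `-w⁻¹β = μ + η` one gets `β = -wμ - wη`. The summand `-wμ` has level `-p μ ≤ 0`, and the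
    -- level of `β` is smaller because `p η ≥ 1`.
    obtain ⟨μ, η, hs, hμ, hη, e1, e2, e3⟩ := T.exists_split_neg hpos'
      (by rw [hεn, hεi, hβ]) (by rw [hpn]; omega)
    have h4 := T.add_count _ _ _ hs
    rw [hpn] at h4
    have h5 := T.count_nonneg hμ
    have hs' := act_isSum w hs
    rw [act_negRoot, act_act_inv] at hs'
    refine ⟨act w (negRoot μ), act w (negRoot η), ?_, ?_, ?_, ?_⟩
    · rw [act_negRoot, coeff_negRoot]
      have : coeff b i (act w μ) = -1 := e1
      omega
    · rw [hlev, act_inv_act, hpn]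
      omega
    · rw [hlev, hlev, act_inv_act, hpn]
      omega
    · rw [IsSum, act_negRoot, act_negRoot, root_negRoot, root_negRoot]
      rw [IsSum, root_negRoot] at hs'
      rw [← neg_add, ← hs', neg_neg]
  · rw [hlev]
    exact T.count_nonneg hα

end MarkingRoots

/-! ### Sums of root spaces and subspaces stable under the Cartan subalgebra. -/

section WeightSum

open LieModule

variable {L : Type*} [LieRing L] [LieAlgebra ℂ L] [FiniteDimensional ℂ L] [IsKilling ℂ L]
  {H : LieSubalgebra ℂ L} [H.IsCartanSubalgebra]

/-- The bracket of nonzero root vectors is nonzero if the sum of the roots is a root. -/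
theorem lie_ne_zero_of_isSum {α β γ : H.root} (h : IsSum α β γ) {x y : L} (hx : x ∈ rootPiece α)
    (hy : y ∈ rootPiece β) (hx0 : x ≠ 0) (hy0 : y ≠ 0) : ⁅x, y⁆ ≠ 0 := by
  have hα : (-α.1 : Weight ℂ H L).IsNonZero := (H.isNonZero_coe_root α).neg
  have hβ : β.1.IsNonZero := H.isNonZero_coe_root β
  -- The triple is taken for `-α`, so that `f ∈ 𝔤_α`. Then `n` applications of `f` lead from the top
  -- `v` of the string to `𝔤_β`, and one more is still nonzero because `α + β` lies on the string.
  -- Root spaces are lines, so `x` and `y` are multiples of `f` and `fⁿ v`.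
  obtain ⟨v, hv, hv0⟩ := (chainTop (-α.1 : Weight ℂ H L) β.1).exists_ne_zero
  obtain ⟨h', e, f, isSl2, he, hf⟩ := exists_isSl2Triple_of_weight_isNonZero hα
  obtain rfl := isSl2.h_eq_coroot hα he hf
  have prim : isSl2.HasPrimitiveVectorWith v (chainLength (-α.1) β.1 : ℂ) :=
    have := lie_mem_genWeightSpace_of_mem_genWeightSpace he hv
    ⟨hv0, (chainLength_smul _ _ hv).symm, by rwa [genWeightSpace_add_chainTop _ _ hα] at this⟩
  set n := chainTopCoeff (-α.1 : Weight ℂ H L) β.1 with hn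
  have htop : ((chainTop (-α.1 : Weight ℂ H L) β.1 : Weight ℂ H L) : H → ℂ) =
      (n : ℕ) • (-α.1 : H → ℂ) + β.1 := by
    rw [coe_chainTop']; rfl
  have hlen : n + 1 ≤ chainLength (-α.1) β.1 := by
    by_contra hc
    have := rootSpace_neg_nsmul_add_chainTop_of_lt (-α.1) β.1 hα (n := n + 1) (by omega)
    apply γ.1.genWeightSpace_ne_bot
    rw [← this]
    congr 1
    rw [htop]
    funext z
    have hz : γ.1 z = α.1 z + β.1 z := LinearMap.congr_fun h z
    simp only [Weight.coe_neg, Pi.add_apply, Pi.neg_apply, Pi.smul_apply, smul_neg]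
    rw [hz, succ_nsmul]
    ring
  have hne := prim.pow_toEnd_f_ne_zero_of_eq_nat rfl hlen
  have hmem : ((toEnd ℂ L L f) ^ n) v ∈ rootSpace H β.1 := by
    have := toEnd_pow_apply_mem hf hv n
    convert! this using 2
    rw [htop]
    funext z
    simp
  have hne' : ((toEnd ℂ L L f) ^ n) v ≠ 0 := prim.pow_toEnd_f_ne_zero_of_eq_nat rfl (by omega)
  obtain ⟨c, hc⟩ : ∃ c : ℂ, c • ((toEnd ℂ L L f) ^ n) v = y := by
    simpa [Subtype.ext_iff] using (finrank_eq_one_iff_of_nonzero' ⟨_, hmem⟩ (by simpa using hne')).mp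
      (finrank_rootSpace_eq_one _ hβ) ⟨y, hy⟩
  have hf' : f ∈ rootSpace H α.1 := by
    convert! hf using 2
    simp
  obtain ⟨d, hd⟩ : ∃ d : ℂ, d • f = x := by
    simpa [Subtype.ext_iff] using (finrank_eq_one_iff_of_nonzero' ⟨f, hf'⟩ (by simpa using isSl2.f_ne_zero)).mp
      (finrank_rootSpace_eq_one _ (H.isNonZero_coe_root α)) ⟨x, hx⟩
  rw [← hc, ← hd, smul_lie, lie_smul, smul_ne_zero_iff, smul_ne_zero_iff]
  refine ⟨?_, ?_, ?_⟩
  · rintro rfl; simp at hd; exact hx0 hd.symm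
  · rintro rfl; simp at hc; exact hy0 hc.symm
  · rw [pow_succ'] at hne
    exact hne

set_option linter.unusedSectionVars false in
open scoped Classical in
theorem isInternal_rootSpace :
    DirectSum.IsInternal fun χ : Weight ℂ H L ↦ (rootSpace H χ).toSubmodule := by
  rw [DirectSum.isInternal_submodule_iff_iSupIndep_and_iSup_eq_top]
  refine ⟨?_, ?_⟩
  · exact LieSubmodule.iSupIndep_toSubmodule.2 (iSupIndep_genWeightSpace' ℂ H L)
  · rw [← LieSubmodule.iSup_toSubmodule, iSup_genWeightSpace_eq_top']
    rfl

open scoped Classical in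
/-- The component of an element of `L` in the root space `L_χ`. -/
def comp (χ : Weight ℂ H L) : L →ₗ[ℂ] L :=
  letI := isInternal_rootSpace (L := L) (H := H).chooseDecomposition
  (rootSpace H χ).toSubmodule.subtype ∘ₗ
    DirectSum.component ℂ (Weight ℂ H L) (fun χ ↦ (rootSpace H χ).toSubmodule) χ ∘ₗ
    (DirectSum.decomposeLinearEquiv fun χ : Weight ℂ H L ↦ (rootSpace H χ).toSubmodule).toLinearMap

theorem comp_mem (χ : Weight ℂ H L) (x : L) : comp χ x ∈ rootSpace H χ :=
  Subtype.property _

theorem comp_of_mem {χ : Weight ℂ H L} {x : L} (hx : x ∈ rootSpace H χ) : comp χ x = x := by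
  classical
  let := (isInternal_rootSpace (L := L) (H := H)).chooseDecomposition
  exact DirectSum.decompose_of_mem_same
    (fun χ : Weight ℂ H L ↦ (rootSpace H χ).toSubmodule) (i := χ) hx

theorem comp_of_mem_ne {χ ψ : Weight ℂ H L} {x : L} (hx : x ∈ rootSpace H χ) (h : ψ ≠ χ) :
    comp ψ x = 0 := by
  classical
  let := (isInternal_rootSpace (L := L) (H := H)).chooseDecomposition
  exact DirectSum.decompose_of_mem_ne
    (fun χ : Weight ℂ H L ↦ (rootSpace H χ).toSubmodule) (i := χ) hx h.symm

theorem sum_comp (x : L) : ∑ χ : Weight ℂ H L, comp χ x = x := by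
  classical
  let := (isInternal_rootSpace (L := L) (H := H)).chooseDecomposition
  let A := fun χ : Weight ℂ H L ↦ (rootSpace H χ).toSubmodule
  conv_rhs => rw [← DirectSum.sum_support_decompose A x]
  refine (Finset.sum_subset (Finset.subset_univ _) fun χ _ hχ ↦ ?_).symm
  have h : DirectSum.decompose A x χ = 0 := by simpa using hχ
  exact congrArg Subtype.val h

theorem comp_lie (χ : Weight ℂ H L) (z : H) (x : L) : comp χ ⁅(z : L), x⁆ = χ z • comp χ x := by
  conv_lhs => rw [← sum_comp (H := H) x]
  rw [lie_sum, map_sum, Finset.sum_eq_single χ]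
  · have := lie_eq_smul_of_mem_rootSpace (comp_mem χ x) z
    change comp χ ⁅z, comp χ x⁆ = _
    rw [this, map_smul, comp_of_mem (comp_mem χ x)]
  · intro ψ _ hψ
    have := lie_eq_smul_of_mem_rootSpace (comp_mem ψ x) z
    change comp χ ⁅z, comp ψ x⁆ = _
    rw [this, map_smul, comp_of_mem_ne (comp_mem ψ x) hψ.symm, smul_zero]
  · simp

/-- The sum of the root spaces `L_χ` with `χ ∈ S`. -/
def weightSum (S : Set (Weight ℂ H L)) : Submodule ℂ L :=
  ⨅ χ ∈ Sᶜ, LinearMap.ker (comp χ)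

theorem mem_weightSum {S : Set (Weight ℂ H L)} {x : L} :
    x ∈ weightSum S ↔ ∀ χ ∉ S, comp χ x = 0 := by
  simp [weightSum]

theorem rootSpace_le_weightSum {S : Set (Weight ℂ H L)} {χ : Weight ℂ H L} (h : χ ∈ S) :
    (rootSpace H χ).toSubmodule ≤ weightSum S := by
  intro x hx
  rw [mem_weightSum]
  exact fun ψ hψ ↦ comp_of_mem_ne hx fun e ↦ hψ (e ▸ h)

theorem weightSum_le_iff {S : Set (Weight ℂ H L)} {V : Submodule ℂ L} :
    weightSum S ≤ V ↔ ∀ χ ∈ S, (rootSpace H χ).toSubmodule ≤ V := by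
  refine ⟨fun h χ hχ ↦ (rootSpace_le_weightSum hχ).trans h, fun h x hx ↦ ?_⟩
  rw [← sum_comp (H := H) x]
  refine Submodule.sum_mem _ fun χ _ ↦ ?_
  by_cases hχ : χ ∈ S
  · exact h χ hχ (comp_mem χ x)
  · rw [mem_weightSum.1 hx χ hχ]
    exact V.zero_mem

theorem weightSum_mono {S T : Set (Weight ℂ H L)} (h : S ⊆ T) : weightSum S ≤ weightSum T :=
  weightSum_le_iff.2 fun _ hχ ↦ rootSpace_le_weightSum (h hχ)

theorem rootSpace_le_weightSum_iff {S : Set (Weight ℂ H L)} {χ : Weight ℂ H L} :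
    (rootSpace H χ).toSubmodule ≤ weightSum S ↔ χ ∈ S := by
  refine ⟨fun h ↦ ?_, rootSpace_le_weightSum⟩
  by_contra hχ
  obtain ⟨x, hx, hx0⟩ := χ.exists_ne_zero
  have := mem_weightSum.1 (h hx) χ hχ
  rw [comp_of_mem hx] at this
  exact hx0 this

theorem mem_weightSum_of_mem_rootSpace {S : Set (Weight ℂ H L)} {χ : Weight ℂ H L} {x : L}
    (hx : x ∈ rootSpace H χ) (hx0 : x ≠ 0) : x ∈ weightSum S ↔ χ ∈ S := by
  refine ⟨fun h ↦ ?_, fun h ↦ rootSpace_le_weightSum h hx⟩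
  by_contra hχ
  have := mem_weightSum.1 h χ hχ
  rw [comp_of_mem hx] at this
  exact hx0 this

theorem weightSum_le_weightSum_iff {S T : Set (Weight ℂ H L)} :
    weightSum S ≤ weightSum T ↔ S ⊆ T :=
  ⟨fun h _ hχ ↦ rootSpace_le_weightSum_iff.1 ((rootSpace_le_weightSum hχ).trans h), weightSum_mono⟩

theorem iSup_weightSum {ι : Sort*} (S : ι → Set (Weight ℂ H L)) :
    ⨆ i, weightSum (S i) = weightSum (⋃ i, S i) := by
  apply le_antisymm
  · exact iSup_le fun i ↦ weightSum_mono (Set.subset_iUnion S i)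
  · rw [weightSum_le_iff]
    intro χ hχ
    obtain ⟨i, hi⟩ := Set.mem_iUnion.1 hχ
    exact (rootSpace_le_weightSum hi).trans (le_iSup (fun i ↦ weightSum (S i)) i)

theorem weightSum_sup (S T : Set (Weight ℂ H L)) :
    weightSum S ⊔ weightSum T = weightSum (S ∪ T) := by
  apply le_antisymm
  · exact sup_le (weightSum_mono Set.subset_union_left) (weightSum_mono Set.subset_union_right)
  · rw [weightSum_le_iff]
    rintro χ (hχ | hχ)
    · exact (rootSpace_le_weightSum hχ).trans le_sup_left
    · exact (rootSpace_le_weightSum hχ).trans le_sup_right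

theorem weightSum_inf (S T : Set (Weight ℂ H L)) :
    weightSum S ⊓ weightSum T = weightSum (S ∩ T) := by
  ext x
  simp only [Submodule.mem_inf, mem_weightSum, Set.mem_inter_iff]
  constructor
  · rintro ⟨h1, h2⟩ χ hχ
    by_cases h : χ ∈ S
    · exact h2 χ fun h' ↦ hχ ⟨h, h'⟩
    · exact h1 χ h
  · exact fun h ↦ ⟨fun χ hχ ↦ h χ fun h' ↦ hχ h'.1, fun χ hχ ↦ h χ fun h' ↦ hχ h'.2⟩

theorem weightSum_empty : weightSum (∅ : Set (Weight ℂ H L)) = ⊥ := by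
  rw [eq_bot_iff, weightSum_le_iff]
  simp

theorem weightSum_univ : weightSum (Set.univ : Set (Weight ℂ H L)) = ⊤ := by
  rw [eq_top_iff]
  intro x _
  simp [mem_weightSum]

theorem lie_mem_weightSum {S T U : Set (Weight ℂ H L)}
    (h : ∀ χ ∈ S, ∀ ψ ∈ T, ∀ ω : Weight ℂ H L, (ω : H → ℂ) = χ + ψ → ω ∈ U) {x y : L}
    (hx : x ∈ weightSum S) (hy : y ∈ weightSum T) : ⁅x, y⁆ ∈ weightSum U := by
  rw [← sum_comp (H := H) x, ← sum_comp (H := H) y, sum_lie]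
  refine Submodule.sum_mem _ fun χ _ ↦ ?_
  rw [lie_sum]
  refine Submodule.sum_mem _ fun ψ _ ↦ ?_
  by_cases hχ : χ ∈ S
  · by_cases hψ : ψ ∈ T
    · have hm := lie_mem_genWeightSpace_of_mem_genWeightSpace (comp_mem χ x) (comp_mem ψ y)
      by_cases hb : rootSpace H (χ + ψ : H → ℂ) = ⊥
      · replace hm : _ ∈ rootSpace H (χ + ψ : H → ℂ) := hm
        rw [hb] at hm
        rw [(LieSubmodule.mem_bot _).1 hm]
        exact Submodule.zero_mem _
      · exact rootSpace_le_weightSum (h χ hχ ψ hψ ⟨_, hb⟩ rfl) hm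
    · rw [mem_weightSum.1 hy ψ hψ, lie_zero]
      exact Submodule.zero_mem _
  · rw [mem_weightSum.1 hx χ hχ, zero_lie]
    exact Submodule.zero_mem _

/-- A subspace that is stable under the Cartan subalgebra contains the components of its
elements. -/
theorem comp_mem_of_stable {V : Submodule ℂ L} (hV : ∀ z : H, ∀ x ∈ V, ⁅(z : L), x⁆ ∈ V) {x : L}
    (hx : x ∈ V) (χ : Weight ℂ H L) : comp χ x ∈ V := by
  classical
  -- The components other than `χ` are removed one at a time by applying `ad z - φ(z)`, with `z`
  -- separating `χ` from `φ`, and rescaling to restore the `χ`-component.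
  suffices ∀ s : Finset (Weight ℂ H L), χ ∉ s → ∃ y ∈ V, comp χ y = comp χ x ∧
      ∀ ψ ∈ s, comp ψ y = 0 by
    obtain ⟨y, hy, h1, h2⟩ := this (Finset.univ.erase χ) (by simp)
    rw [← h1]
    have : y = comp χ y := by
      conv_lhs => rw [← sum_comp (H := H) y]
      rw [Finset.sum_eq_single χ]
      · intro ψ _ hψ
        exact h2 ψ (by simp [hψ])
      · simp
    rwa [← this]
  intro s
  induction s using Finset.induction_on with
  | empty => exact fun _ ↦ ⟨x, hx, rfl, by simp⟩
  | insert φ s hφ ih =>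
    intro hχ
    simp only [Finset.mem_insert, not_or] at hχ
    obtain ⟨y, hy, h1, h2⟩ := ih hχ.2
    obtain ⟨z, hz⟩ : ∃ z : H, χ z ≠ φ z := by
      by_contra! hc
      exact hχ.1 (Weight.ext hc)
    have hz' : χ z - φ z ≠ 0 := sub_ne_zero.2 hz
    refine ⟨(χ z - φ z)⁻¹ • (⁅(z : L), y⁆ - φ z • y),
      V.smul_mem _ (V.sub_mem (hV z y hy) (V.smul_mem _ hy)), ?_, ?_⟩
    · rw [map_smul, map_sub, comp_lie, map_smul, ← sub_smul, smul_smul, inv_mul_cancel₀ hz',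
        one_smul, h1]
    · intro ψ hψ
      rw [map_smul, map_sub, comp_lie, map_smul, ← sub_smul]
      rcases Finset.mem_insert.1 hψ with rfl | hψ
      · rw [sub_self, zero_smul, smul_zero]
      · rw [h2 ψ hψ, smul_zero, smul_zero]

theorem gradedPiece_eq_weightSum (z : H) (k : ℤ) :
    gradedPiece (z : L) k = weightSum {χ : Weight ℂ H L | χ z = k} := by
  ext x
  rw [gradedPiece, End.mem_eigenspace_iff, ad_apply, mem_weightSum]
  constructor
  · intro h χ hχ
    have := congrArg (comp χ) h
    rw [comp_lie, map_smul, ← sub_eq_zero, ← sub_smul, smul_eq_zero] at this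
    exact this.resolve_left (sub_ne_zero.2 hχ)
  · intro h
    rw [← sum_comp (H := H) x, lie_sum, Finset.smul_sum]
    refine Finset.sum_congr rfl fun χ _ ↦ ?_
    by_cases hχ : χ z = k
    · rw [← hχ]
      exact lie_eq_smul_of_mem_rootSpace (comp_mem χ x) z
    · rw [h χ hχ, lie_zero, smul_zero]

theorem nonnegPart_eq_weightSum (z : H) {v : Weight ℂ H L → ℤ} (hv : ∀ χ : Weight ℂ H L, χ z = v χ) :
    nonnegPart (z : L) = weightSum {χ : Weight ℂ H L | 0 ≤ v χ} := by
  simp only [nonnegPart, gradedPiece_eq_weightSum, iSup_weightSum]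
  congr 1
  ext χ
  simp only [Set.mem_iUnion, Set.mem_ofPred_eq, hv]
  norm_cast
  exact ⟨fun ⟨k, hk⟩ ↦ by omega, fun h ↦ ⟨(v χ).toNat, by omega⟩⟩

theorem bigradedPiece_eq_weightSum (z z' : H) {v v' : Weight ℂ H L → ℤ}
    (hv : ∀ χ : Weight ℂ H L, χ z = v χ) (hv' : ∀ χ : Weight ℂ H L, χ z' = v' χ) (k l : ℤ) :
    bigradedPiece (z : L) (z' : L) k l = weightSum {χ : Weight ℂ H L | v χ = k ∧ v' χ = l} := by
  simp only [bigradedPiece, gradedPiece_eq_weightSum, weightSum_inf]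
  congr 1
  ext χ
  simp only [Set.mem_inter_iff, Set.mem_ofPred_eq, hv, hv']
  norm_cast

theorem bigradedGE_eq_weightSum (z z' : H) {v v' : Weight ℂ H L → ℤ}
    (hv : ∀ χ : Weight ℂ H L, χ z = v χ) (hv' : ∀ χ : Weight ℂ H L, χ z' = v' χ) (k m : ℤ) :
    bigradedGE (z : L) (z' : L) k m = weightSum {χ : Weight ℂ H L | v χ = k ∧ m ≤ v' χ} := by
  simp only [bigradedGE, bigradedPiece_eq_weightSum z z' hv hv', iSup_weightSum]
  congr 1
  ext χ
  simp only [Set.mem_iUnion, Set.mem_ofPred_eq, exists_prop]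
  exact ⟨fun ⟨l, h1, h2, h3⟩ ↦ ⟨h2, by omega⟩, fun ⟨h1, h2⟩ ↦ ⟨_, h2, h1, rfl⟩⟩

end WeightSum

/-! ### Markings as conditions on weights; existence and uniqueness. -/

section WeightValues

open LieModule

variable {L : Type*} [LieRing L] [LieAlgebra ℂ L] [FiniteDimensional ℂ L] [IsKilling ℂ L]
  {H : LieSubalgebra ℂ L} [H.IsCartanSubalgebra] (b : (rootSystem H).Base)

/-- A nonzero weight as a root. -/
abbrev toRoot {χ : Weight ℂ H L} (h : χ.IsNonZero) : H.root := ⟨χ, by simpa using h⟩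

open scoped Classical in
/-- The coefficient of a simple root in a weight. -/
def wcoeff (j : b.support) (χ : Weight ℂ H L) : ℤ :=
  if h : χ.IsNonZero then coeff b j (toRoot h) else 0

theorem wcoeff_coe (j : b.support) (α : H.root) : wcoeff b j α.1 = coeff b j α :=
  dif_pos (H.isNonZero_coe_root α)

theorem wcoeff_of_isZero (j : b.support) {χ : Weight ℂ H L} (h : χ.IsZero) : wcoeff b j χ = 0 :=
  dif_neg (not_not.2 h)

theorem apply_dualElement (j : b.support) (χ : Weight ℂ H L) :
    χ (dualElement b j) = wcoeff b j χ := by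
  by_cases h : χ.IsZero
  · rw [wcoeff_of_isZero b j h, h.eq]
    simp
  · rw [wcoeff, dif_pos h, coe_coeff]

/-- `Z_J` as an element of the Cartan subalgebra. -/
def markingDual (J : Finset b.support) : H := ∑ j ∈ J, dualElement b j

theorem coe_markingDual (J : Finset b.support) : (markingDual b J : L) = markingElement b J := by
  simp [markingDual, markingElement, gradingElement]

set_option linter.unusedSectionVars false in
theorem weight_sum_apply (χ : Weight ℂ H L) {ι : Type*} (s : Finset ι) (f : ι → H) :
    χ (∑ j ∈ s, f j) = ∑ j ∈ s, χ (f j) := by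
  exact map_sum (Weight.toLinear ℂ H L χ) f s

/-- The sum of the coefficients in `J` of a weight. -/
def wsum (J : Finset b.support) (χ : Weight ℂ H L) : ℤ := ∑ j ∈ J, wcoeff b j χ

theorem apply_markingDual (J : Finset b.support) (χ : Weight ℂ H L) :
    χ (markingDual b J) = wsum b J χ := by
  rw [markingDual, weight_sum_apply, wsum]
  push_cast
  exact Finset.sum_congr rfl fun j _ ↦ apply_dualElement b j χ

/-- `Z_J - a Z_i` as an element of the Cartan subalgebra. -/
def levelDual (i : b.support) (J : Finset b.support) (a : ℕ) : H :=
  markingDual b J - (a : ℂ) • dualElement b i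

theorem coe_levelDual (i : b.support) (J : Finset b.support) (a : ℕ) :
    (levelDual b i J a : L) = markingElement b J - (a : ℂ) • gradingElement b i := by
  rw [levelDual, ← coe_markingDual]
  rfl

/-- The value of `Z_J - a Z_i` on a weight. -/
def wlevel (i : b.support) (J : Finset b.support) (a : ℕ) (χ : Weight ℂ H L) : ℤ :=
  wsum b J χ - a * wcoeff b i χ

theorem wlevel_coe (i : b.support) (J : Finset b.support) (a : ℕ) (α : H.root) :
    wlevel b i J a α.1 = level i J a α := by
  simp only [wlevel, wsum, level, wcoeff_coe]

theorem apply_levelDual (i : b.support) (J : Finset b.support) (a : ℕ) (χ : Weight ℂ H L) :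
    χ (levelDual b i J a) = wlevel b i J a χ := by
  have : χ (levelDual b i J a) = χ (markingDual b J) - (a : ℂ) * χ (dualElement b i) := by
    have h1 := map_sub (Weight.toLinear ℂ H L χ) (markingDual b J) ((a : ℂ) • dualElement b i)
    rw [map_smul] at h1
    exact h1
  rw [this, apply_markingDual, apply_dualElement, wlevel]
  push_cast
  rfl

set_option linter.unusedSectionVars false in
/-- An integer valued function on the weights that is induced by an element of the Cartan
subalgebra is additive. -/
theorem value_add {z : H} {v : Weight ℂ H L → ℤ} (hv : ∀ χ : Weight ℂ H L, χ z = v χ)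
    {χ ψ ω : Weight ℂ H L} (h : (ω : H → ℂ) = χ + ψ) : v ω = v χ + v ψ := by
  have := congrFun h z
  rw [Pi.add_apply, hv, hv, hv] at this
  exact_mod_cast this

theorem wcoeff_add (j : b.support) {χ ψ ω : Weight ℂ H L} (h : (ω : H → ℂ) = χ + ψ) :
    wcoeff b j ω = wcoeff b j χ + wcoeff b j ψ :=
  value_add (apply_dualElement b j) h

theorem wlevel_add (i : b.support) (J : Finset b.support) (a : ℕ) {χ ψ ω : Weight ℂ H L}
    (h : (ω : H → ℂ) = χ + ψ) : wlevel b i J a ω = wlevel b i J a χ + wlevel b i J a ψ :=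
  value_add (apply_levelDual b i J a) h

/-- The weights of `𝔫_w`. -/
def inversionWeights (w : (rootSystem H).weylGroup) : Set (Weight ℂ H L) :=
  {χ | ∃ α ∈ inversionSet b w, (negRoot α).1 = χ}

theorem negRootPiece_eq (α : H.root) :
    negRootPiece α = (rootSpace H (negRoot α).1).toSubmodule := by
  rw [negRootPiece]
  congr 2
  funext x
  exact (negRoot_apply α x).symm

theorem inversionSubspace_eq_weightSum (w : (rootSystem H).weylGroup) :
    inversionSubspace b w = weightSum (inversionWeights b w) := by
  apply le_antisymm
  · refine iSup₂_le fun α hα ↦ ?_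
    rw [negRootPiece_eq]
    exact rootSpace_le_weightSum ⟨α, hα, rfl⟩
  · rw [weightSum_le_iff]
    rintro _ ⟨α, hα, rfl⟩
    rw [← negRootPiece_eq]
    exact le_iSup₂_of_le α hα le_rfl

theorem nonnegPart_gradingElement (i : b.support) :
    nonnegPart (gradingElement b i) = weightSum {χ : Weight ℂ H L | 0 ≤ wcoeff b i χ} :=
  nonnegPart_eq_weightSum (dualElement b i) (apply_dualElement b i)

theorem bigradedGE_marking (i : b.support) (J : Finset b.support) (k m : ℤ) :
    bigradedGE (gradingElement b i) (markingElement b J) k m =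
      weightSum {χ : Weight ℂ H L | wcoeff b i χ = k ∧ m ≤ wsum b J χ} := by
  rw [← coe_markingDual]
  exact bigradedGE_eq_weightSum (dualElement b i) _ (apply_dualElement b i)
    (apply_markingDual b J) k m

theorem bigradedPiece_marking (i : b.support) (J : Finset b.support) (k l : ℤ) :
    bigradedPiece (gradingElement b i) (markingElement b J) k l =
      weightSum {χ : Weight ℂ H L | wcoeff b i χ = k ∧ wsum b J χ = l} := by
  rw [← coe_markingDual]
  exact bigradedPiece_eq_weightSum (dualElement b i) _ (apply_dualElement b i)
    (apply_markingDual b J) k l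

theorem gradedPiece_gradingElement (i : b.support) (k : ℤ) :
    gradedPiece (gradingElement b i) k = weightSum {χ : Weight ℂ H L | wcoeff b i χ = k} := by
  have := gradedPiece_eq_weightSum (dualElement b i) k
  refine this.trans ?_
  congr 1
  ext χ
  simp only [Set.mem_ofPred_eq, apply_dualElement]
  norm_cast

theorem nonnegPart_level (i : b.support) (J : Finset b.support) (a : ℕ) :
    nonnegPart (markingElement b J - (a : ℂ) • gradingElement b i) =
      weightSum {χ : Weight ℂ H L | 0 ≤ wlevel b i J a χ} := by
  rw [← coe_levelDual]
  exact nonnegPart_eq_weightSum _ (apply_levelDual b i J a)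

variable {b}

theorem wcoeff_cases {i : b.support} (hi : IsCominuscule b i) (χ : Weight ℂ H L) :
    wcoeff b i χ ≤ 1 ∧ -1 ≤ wcoeff b i χ := by
  by_cases h : χ.IsZero
  · rw [wcoeff_of_isZero b i h]; omega
  · rw [wcoeff, dif_pos h]; exact hi.coeff_le _

theorem mem_inversionWeights_iff {i : b.support} (hi : IsCominuscule b i)
    {w : (rootSystem H).weylGroup} (hw : w ∈ hasseDiagram b i) {J : Finset b.support} {a : ℕ}
    (hJ : IsRootMarking i w J a) {χ : Weight ℂ H L} :
    χ ∈ inversionWeights b w ↔ wcoeff b i χ = -1 ∧ 0 ≤ wlevel b i J a χ := by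
  constructor
  · rintro ⟨α, hα, rfl⟩
    have h1 := coeff_of_mem_inversionSet hi hw hα
    rw [wcoeff_coe, wlevel_coe, coeff_negRoot, level_negRoot, h1]
    have := (hJ.mem_inversionSet_iff α h1).1 hα
    omega
  · rintro ⟨h1, h2⟩
    have h0 : χ.IsNonZero := by
      intro h
      rw [wcoeff_of_isZero b i h] at h1
      omega
    have hr : χ = (toRoot h0).1 := rfl
    rw [hr, wcoeff_coe] at h1
    rw [hr, wlevel_coe] at h2
    refine ⟨negRoot (toRoot h0), ?_, by rw [negRoot_negRoot]⟩
    rw [hJ.mem_inversionSet_iff _ (by rw [coeff_negRoot]; omega), level_negRoot]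
    omega

theorem coe_negRoot_mem_inversionWeights {w : (rootSystem H).weylGroup} {α : H.root} :
    (negRoot α).1 ∈ inversionWeights b w ↔ α ∈ inversionSet b w := by
  constructor
  · rintro ⟨β, hβ, h⟩
    have : negRoot β = negRoot α := Subtype.ext h
    have := congrArg negRoot this
    rw [negRoot_negRoot, negRoot_negRoot] at this
    exact this ▸ hβ
  · exact fun h ↦ ⟨α, h, rfl⟩

theorem wsum_nonpos {i : b.support} {χ : Weight ℂ H L} (h : wcoeff b i χ = -1)
    (J : Finset b.support) : wsum b J χ ≤ 0 := by
  have h0 : χ.IsNonZero := by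
    intro h'
    rw [wcoeff_of_isZero b i h'] at h
    omega
  have hr : χ = (toRoot h0).1 := rfl
  rw [hr, wcoeff_coe] at h
  have hp : ¬ b.IsPos (toRoot h0) := by
    intro hp
    have := coeff_nonneg b hp i
    omega
  refine Finset.sum_nonpos fun j _ ↦ ?_
  rw [hr, wcoeff_coe]
  exact coeff_nonpos b hp j

theorem iSup_bigradedPiece_neg_one (i : b.support) (J : Finset b.support) (a : ℕ) :
    (⨆ l : ℕ, ⨆ _ : l ≤ a, bigradedPiece (gradingElement b i) (markingElement b J) (-1) (-(l : ℤ)))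
      = weightSum {χ : Weight ℂ H L | wcoeff b i χ = -1 ∧ 0 ≤ wlevel b i J a χ} := by
  simp only [bigradedPiece_marking, iSup_weightSum]
  congr 1
  ext χ
  simp only [Set.mem_iUnion, Set.mem_ofPred_eq, exists_prop]
  constructor
  · rintro ⟨l, hl, h1, h2⟩
    refine ⟨h1, ?_⟩
    rw [wlevel, h1, h2]
    omega
  · rintro ⟨h1, h2⟩
    have h3 := wsum_nonpos h1 J
    rw [wlevel, h1] at h2
    exact ⟨(-wsum b J χ).toNat, by omega, h1, by omega⟩

theorem isSum_coe {α β γ : H.root} (h : IsSum α β γ) :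
    (γ.1 : H → ℂ) = α.1 + β.1 := by
  funext x
  exact LinearMap.congr_fun h x

theorem lie_mem_rootSpace_of_isSum {α β γ : H.root} (h : IsSum α β γ) {x y : L}
    (hx : x ∈ rootSpace H α.1) (hy : y ∈ rootSpace H β.1) : ⁅x, y⁆ ∈ rootSpace H γ.1 := by
  have := lie_mem_genWeightSpace_of_mem_genWeightSpace hx hy
  rw [← isSum_coe h] at this
  exact this

/-- The transporter `{A | [A, 𝔪] ⊆ 𝔪'}` is stable under the Cartan subalgebra if `𝔪`, `𝔪'` are. -/
theorem comp_lie_mem {S T : Set (Weight ℂ H L)} {A : L}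
    (hA : ∀ X ∈ weightSum S, ⁅A, X⁆ ∈ weightSum T) (χ : Weight ℂ H L) :
    ∀ X ∈ weightSum S, ⁅comp χ A, X⁆ ∈ weightSum T := by
  have hst (S : Set (Weight ℂ H L)) (z : H) {x : L} (hx : x ∈ weightSum S) :
      ⁅(z : L), x⁆ ∈ weightSum S := by
    rw [mem_weightSum] at hx ⊢
    intro χ hχ
    rw [comp_lie, hx χ hχ, smul_zero]
  let V : Submodule ℂ L :=
    { carrier := {A | ∀ X ∈ weightSum S, ⁅A, X⁆ ∈ weightSum T}
      add_mem' := fun ha hb X hX ↦ by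
        rw [add_lie]; exact Submodule.add_mem _ (ha X hX) (hb X hX)
      zero_mem' := fun X _ ↦ by rw [zero_lie]; exact Submodule.zero_mem _
      smul_mem' := fun c x hx X hX ↦ by rw [smul_lie]; exact Submodule.smul_mem _ _ (hx X hX) }
  have hV : ∀ z : H, ∀ x ∈ V, ⁅(z : L), x⁆ ∈ V := by
    intro z x hx X hX
    rw [lie_lie]
    exact Submodule.sub_mem _ (hst T z (hx X hX)) (hx _ (hst S z hX))
  exact comp_mem_of_stable hV (x := A) hA χ

/-- If a transporter condition fails at the level of roots, the component vanishes. -/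
theorem comp_eq_zero_of_isSum {S T : Set (Weight ℂ H L)} {A : L}
    (hA : ∀ X ∈ weightSum S, ⁅A, X⁆ ∈ weightSum T) {α β γ : H.root} (h : IsSum α β γ)
    (hβ : β.1 ∈ S) (hγ : γ.1 ∉ T) : comp α.1 A = 0 := by
  by_contra h0
  obtain ⟨y, hy, hy0⟩ := β.1.exists_ne_zero
  have h1 := comp_lie_mem hA α.1 y (rootSpace_le_weightSum hβ hy)
  have hm := lie_mem_rootSpace_of_isSum h (comp_mem α.1 A) hy
  rw [mem_weightSum_of_mem_rootSpace hm (lie_ne_zero_of_isSum h (comp_mem α.1 A) hy h0 hy0)] at h1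
  exact hγ h1

/-- With `γ = γ' + η` as in `IsRootMarking`, a nonzero `η`-component maps `𝔤_{-γ} ⊆ 𝔫_w` onto
`𝔤_{-γ'}`, which is not in `𝔫_w`. -/
theorem IsRootMarking.comp_eq_zero {i : b.support} {w : (rootSystem H).weylGroup}
    {J : Finset b.support} {a : ℕ} (hJ : IsRootMarking i w J a) {A : L}
    (h : ∀ X ∈ weightSum (inversionWeights b w), ⁅A, X⁆ ∈ weightSum (inversionWeights b w))
    {η : H.root} (h0 : coeff b i η = 0) (hl : level i J a η < 0) : comp η.1 A = 0 := by
  obtain ⟨γ, hγ, γ', hγ', hs⟩ := hJ.exists_of_level_neg _ h0 hl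
  have hs' : IsSum η (negRoot γ) (negRoot γ') := by
    rw [IsSum, root_negRoot, root_negRoot, hs]
    abel
  have hγ1 := (coe_negRoot_mem_inversionWeights (w := w)).2 hγ
  have hγ2 := mt (coe_negRoot_mem_inversionWeights (w := w)).1 hγ'
  exact comp_eq_zero_of_isSum h hs' hγ1 hγ2

/-- In degree `0` the level is the sum of the coefficients in `J`. Nonnegative level preserves `𝔫_w`
by additivity, and components of negative level are excluded by `IsRootMarking.comp_eq_zero`. -/
theorem IsRootMarking.stabilizer_iff {i : b.support} (hi : IsCominuscule b i)
    {w : (rootSystem H).weylGroup} (hw : w ∈ hasseDiagram b i) {J : Finset b.support} {a : ℕ}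
    (hJ : IsRootMarking i w J a) {A : L} (hA : A ∈ weightSum {χ : Weight ℂ H L | wcoeff b i χ = 0}) :
    (∀ X ∈ weightSum (inversionWeights b w), ⁅A, X⁆ ∈ weightSum (inversionWeights b w)) ↔
      A ∈ weightSum {χ : Weight ℂ H L | wcoeff b i χ = 0 ∧ 0 ≤ wsum b J χ} := by
  constructor
  · intro h
    rw [mem_weightSum] at hA ⊢
    intro χ hχ
    by_cases h0 : wcoeff b i χ = 0
    · have hneg : wsum b J χ < 0 := by
        by_contra hc
        exact hχ ⟨h0, by omega⟩
      have hnz : χ.IsNonZero := by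
        intro hz
        simp [wsum, wcoeff_of_isZero b _ hz] at hneg
      have hl : wlevel b i J a χ < 0 := by
        rw [wlevel, h0]
        omega
      obtain ⟨η, rfl⟩ : ∃ η : H.root, η.1 = χ := ⟨toRoot hnz, rfl⟩
      rw [wcoeff_coe] at h0
      rw [wlevel_coe] at hl
      exact hJ.comp_eq_zero h h0 hl
    · exact hA χ h0
  · intro h X hX
    refine lie_mem_weightSum (fun χ hχ ψ hψ ω hω ↦ ?_) h hX
    rw [mem_inversionWeights_iff hi hw hJ] at hψ ⊢
    obtain ⟨h1, h2⟩ := hχ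
    rw [wcoeff_add b i hω, wlevel_add b i J a hω, h1, wlevel, h1]
    omega

theorem IsRootMarking.isMarking {i : b.support} (hi : IsCominuscule b i)
    {w : (rootSystem H).weylGroup} (hw : w ∈ hasseDiagram b i) {J : Finset b.support} {a : ℕ}
    (hJ : IsRootMarking i w J a) : IsMarking b i w J a where
  notMem := hJ.notMem
  inversionSubspace_eq := by
    rw [iSup_bigradedPiece_neg_one, inversionSubspace_eq_weightSum]
    congr 1
    ext χ
    exact mem_inversionWeights_iff hi hw hJ
  stabilizer := by
    intro A hA
    rw [gradedPiece_gradingElement] at hA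
    rw [bigradedGE_marking, inversionSubspace_eq_weightSum]
    exact hJ.stabilizer_iff hi hw hA

open scoped Classical in
theorem wsum_coe_simple (J : Finset b.support) (j : b.support) :
    wsum b J (negRoot (j : H.root)).1 = if j ∈ J then -1 else 0 := by
  simp only [wsum, wcoeff_coe, coeff_negRoot, coeff_simple, Finset.sum_neg_distrib,
    Finset.sum_ite_eq]
  split_ifs <;> simp

/-- For `j ≠ i` the root space of `-α_j` lies in `𝔤_{0, ≥ 0}` exactly when `j ∉ J`, so the
stabilizer of `𝔫_w` determines `J`. -/
theorem IsMarking.eq_left {i : b.support} {w : (rootSystem H).weylGroup} {J J' : Finset b.support}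
    {a a' : ℕ} (h : IsMarking b i w J a) (h' : IsMarking b i w J' a') : J = J' := by
  classical
  ext j
  by_cases hj : j = i
  · subst hj
    exact iff_of_false h.notMem h'.notMem
  obtain ⟨x, hx, hx0⟩ := (negRoot (j : H.root)).1.exists_ne_zero
  have h0 : wcoeff b i (negRoot (j : H.root)).1 = 0 := by
    rw [wcoeff_coe, coeff_negRoot, coeff_simple, if_neg hj, neg_zero]
  have hx1 : x ∈ gradedPiece (gradingElement b i) 0 := by
    rw [gradedPiece_gradingElement]
    exact (mem_weightSum_of_mem_rootSpace hx hx0).2 h0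
  have key := (h.stabilizer x hx1).symm.trans (h'.stabilizer x hx1)
  simp only [bigradedGE_marking, mem_weightSum_of_mem_rootSpace hx hx0, Set.mem_ofPred_eq, h0,
    wsum_coe_simple, true_and] at key
  split_ifs at key <;> simp_all

theorem IsMarking.mem_inversionSet_iff {i : b.support} {w : (rootSystem H).weylGroup}
    {J : Finset b.support} {a : ℕ} (h : IsMarking b i w J a) {γ : H.root} (hγ : coeff b i γ = 1) :
    γ ∈ inversionSet b w ↔ ∑ j ∈ J, coeff b j γ ≤ a := by
  have h1 := h.inversionSubspace_eq
  rw [iSup_bigradedPiece_neg_one, inversionSubspace_eq_weightSum] at h1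
  have h2 : inversionWeights b w = _ :=
    le_antisymm (weightSum_le_weightSum_iff.1 h1.le) (weightSum_le_weightSum_iff.1 h1.ge)
  rw [← coe_negRoot_mem_inversionWeights, h2]
  simp only [Set.mem_ofPred_eq, wcoeff_coe, wlevel_coe, level_negRoot]
  rw [coeff_negRoot, level, hγ]
  omega

theorem existsUnique_isMarking {i : b.support} (hi : IsCominuscule b i)
    {w : (rootSystem H).weylGroup} (hw : w ∈ hasseDiagram b i) (hw1 : w ≠ 1)
    (hl : ¬ IsLongest b i w) :
    (∃! d : Finset b.support × ℕ, IsMarking b i w d.1 d.2) ∧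
      ∀ J a, IsMarking b i w J a → IsRootMarking i w J a := by
  classical
  obtain ⟨J, a, hJ⟩ := exists_isRootMarking hi hw hw1
  have hM := hJ.isMarking hi hw
  -- If `J` were empty, every root of degree `1` would have level `-a ≤ 0` and hence be an
  -- inversion, contrary to `w` not being longest.
  have hne : J.Nonempty := by
    obtain ⟨α, h1, h2⟩ := exists_notMem_inversionSet hi hw hl
    rw [hJ.mem_inversionSet_iff α h1] at h2
    by_contra hc
    rw [Finset.not_nonempty_iff_eq_empty] at hc
    rw [level, hc, h1] at h2
    simp at h2
  obtain ⟨j, hj⟩ := hne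
  have hji : j ≠ i := fun e ↦ hJ.notMem (e ▸ hj)
  have hc0 : coeff b i (negRoot (j : H.root)) = 0 := by
    rw [coeff_negRoot, coeff_simple, if_neg hji, neg_zero]
  have hs1 : ∑ k ∈ J, coeff b k (negRoot (j : H.root)) = -1 := by
    have := wsum_coe_simple J j
    rw [if_pos hj] at this
    simpa only [wsum, wcoeff_coe] using this
  -- Here `γ = γ' - α_j` with `γ` an inversion and `γ'` not. Their `J`-sums differ by `1`, so the
  -- threshold `a` can only be the `J`-sum of `γ`.
  obtain ⟨γ, hγ, γ', hγ', hs⟩ := hJ.exists_of_level_neg (negRoot (j : H.root)) hc0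
    (by rw [level, hs1, hc0]; omega)
  have h1 := coeff_of_mem_inversionSet hi hw hγ
  have h1' : coeff b i γ' = 1 := by
    rw [coeff_isAdditive b i _ _ _ hs, hc0] at h1
    omega
  have hsum := sum_coeff_isAdditive J _ _ _ hs
  simp only [hs1] at hsum
  have huniq : ∀ J' a', IsMarking b i w J' a' → J' = J ∧ a' = a := by
    intro J' a' h
    obtain rfl := h.eq_left hM
    have k1 := (h.mem_inversionSet_iff h1).1 hγ
    have k2 := fun e ↦ hγ' ((h.mem_inversionSet_iff h1').2 e)
    have k3 := (hM.mem_inversionSet_iff h1).1 hγ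
    have k4 := fun e ↦ hγ' ((hM.mem_inversionSet_iff h1').2 e)
    rw [hsum] at k1 k3
    refine ⟨rfl, ?_⟩
    by_contra hne
    rcases Nat.lt_or_gt_of_ne hne with h5 | h5
    · exact k4 (by omega)
    · exact k2 (by omega)
  refine ⟨⟨(J, a), hM, fun d hd ↦ ?_⟩, fun J' a' h ↦ ?_⟩
  · obtain ⟨e1, e2⟩ := huniq _ _ hd
    exact Prod.ext e1 e2
  · obtain ⟨rfl, rfl⟩ := huniq _ _ h
    exact hJ

end WeightValues

/-! ### The subalgebra `𝔤_w`: Borel subalgebras, parabolicity and maximality. -/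

section GradedSubalgebra

open LieModule

variable {L : Type*} [LieRing L] [LieAlgebra ℂ L] [FiniteDimensional ℂ L] [IsKilling ℂ L]
  {H : LieSubalgebra ℂ L} [H.IsCartanSubalgebra] {b : (rootSystem H).Base}

/-- The nonnegative part of the grading by an element of the Cartan subalgebra, as a subalgebra. -/
def nonnegSubalgebra (z : H) (v : Weight ℂ H L → ℤ) (hv : ∀ χ : Weight ℂ H L, χ z = v χ) :
    LieSubalgebra ℂ L :=
  { weightSum {χ : Weight ℂ H L | 0 ≤ v χ} with
    lie_mem' := fun {x y} hx hy ↦ by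
      refine lie_mem_weightSum (fun χ hχ ψ hψ ω hω ↦ ?_) hx hy
      rw [Set.mem_ofPred_eq] at hχ hψ ⊢
      rw [value_add hv hω]
      omega }

theorem mem_nonnegSubalgebra {z : H} {v : Weight ℂ H L → ℤ} {hv : ∀ χ : Weight ℂ H L, χ z = v χ}
    {x : L} : x ∈ nonnegSubalgebra z v hv ↔ x ∈ weightSum {χ : Weight ℂ H L | 0 ≤ v χ} :=
  Iff.rfl

theorem iSupIndep_weightSum {ι : Type*} (S : ι → Set (Weight ℂ H L))
    (hS : ∀ i j, i ≠ j → Disjoint (S i) (S j)) : iSupIndep fun i ↦ weightSum (S i) := by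
  intro i
  simp only [iSup_weightSum]
  rw [disjoint_iff, weightSum_inf, ← weightSum_empty (H := H)]
  congr 1
  rw [← Set.disjoint_iff_inter_eq_empty]
  simp only [Set.disjoint_iUnion_right]
  exact fun j hj ↦ hS i j hj.symm

theorem isInternal_gradedPiece {z : H} {v : Weight ℂ H L → ℤ}
    (hv : ∀ χ : Weight ℂ H L, χ z = v χ) :
    DirectSum.IsInternal fun s : ℤ ↦ gradedPiece (z : L) s := by
  have h (s : ℤ) : gradedPiece (z : L) s = weightSum {χ : Weight ℂ H L | v χ = s} := by
    rw [gradedPiece_eq_weightSum]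
    congr 1
    ext χ
    simp only [Set.mem_ofPred_eq, hv]
    norm_cast
  rw [DirectSum.isInternal_submodule_iff_iSupIndep_and_iSup_eq_top]
  simp only [h]
  refine ⟨iSupIndep_weightSum _ fun i j hij ↦ ?_, ?_⟩
  · rw [Set.disjoint_left]
    rintro χ rfl h2
    exact hij h2
  · rw [iSup_weightSum, ← weightSum_univ (H := H)]
    congr 1
    ext χ
    simp

omit [IsKilling ℂ L] in
theorem mem_of_rootSpace_zero {χ : Weight ℂ H L} (hχ : χ.IsZero) {x : L}
    (hx : x ∈ rootSpace H χ) : x ∈ H := by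
  rw [hχ.eq] at hx
  have := zeroRootSubalgebra_eq_of_is_cartan ℂ L H
  rw [← this]
  exact hx

section Borel

variable {z : H} {v : Weight ℂ H L → ℤ} (hv : ∀ χ : Weight ℂ H L, χ z = v χ)
  (hreg : ∀ χ : Weight ℂ H L, χ.IsNonZero → v χ ≠ 0)

include hv in
set_option linter.unusedSectionVars false in
theorem value_of_isZero {χ : Weight ℂ H L} (h : χ.IsZero) : v χ = 0 := by
  have := hv χ
  rw [h.eq, Pi.zero_apply] at this
  exact_mod_cast this.symm

-- Regularity makes the degree `0` part equal to `H`, which acts by zero on the zero weight space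
-- and preserves each root space. Hence no bracket has a component in degree `0`.
include hv hreg in
theorem lie_mem_weightSum_pos {x y : L} (hx : x ∈ weightSum {χ : Weight ℂ H L | 0 ≤ v χ})
    (hy : y ∈ weightSum {χ : Weight ℂ H L | 0 ≤ v χ}) :
    ⁅x, y⁆ ∈ weightSum {χ : Weight ℂ H L | 1 ≤ v χ} := by
  have hsplit : {χ : Weight ℂ H L | 0 ≤ v χ} = {χ | v χ = 0} ∪ {χ | 1 ≤ v χ} := by
    ext χ
    simp only [Set.mem_ofPred_eq, Set.mem_union]
    omega
  have hx' := hx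
  rw [hsplit, ← weightSum_sup] at hx'
  obtain ⟨x₀, hx₀, x₁, hx₁, rfl⟩ := Submodule.mem_sup.1 hx'
  rw [add_lie]
  refine Submodule.add_mem _ ?_ ?_
  · have hH : x₀ ∈ H := by
      rw [← sum_comp (H := H) x₀]
      refine sum_mem fun χ _ ↦ ?_
      by_cases hχ : χ.IsZero
      · exact mem_of_rootSpace_zero hχ (comp_mem χ x₀)
      · rw [mem_weightSum.1 hx₀ χ (hreg χ hχ)]
        exact zero_mem H
    rw [mem_weightSum] at hy ⊢
    intro χ hχ
    rw [comp_lie χ ⟨x₀, hH⟩]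
    by_cases h0 : χ.IsZero
    · rw [h0.eq]
      simp
    · have := hreg χ h0
      rw [Set.mem_ofPred_eq] at hχ
      rw [hy χ (by rw [Set.mem_ofPred_eq]; omega), smul_zero]
  · refine lie_mem_weightSum (fun χ hχ ψ hψ ω hω ↦ ?_) hx₁ hy
    rw [Set.mem_ofPred_eq] at hχ hψ ⊢
    rw [value_add hv hω]
    omega

include hreg in
theorem isSolvable_nonnegSubalgebra : LieAlgebra.IsSolvable (nonnegSubalgebra z v hv) := by
  set 𝔟 := nonnegSubalgebra z v hv
  have key (k : ℕ) : ∀ x ∈ derivedSeries ℂ 𝔟 k, (x : L) ∈ weightSum {χ : Weight ℂ H L | k ≤ v χ} := by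
    induction k with
    | zero => exact fun x _ ↦ x.2
    | succ k ih =>
      intro x hx
      rw [derivedSeries_def, derivedSeriesOfIdeal_succ, ← derivedSeries_def,
        ← LieSubmodule.mem_toSubmodule, LieSubmodule.lieIdeal_oper_eq_linear_span'] at hx
      have hle : Submodule.span ℂ {⁅x, n⁆ | (x ∈ derivedSeries ℂ 𝔟 k) (n ∈ derivedSeries ℂ 𝔟 k)} ≤
          (weightSum {χ : Weight ℂ H L | ((k + 1 : ℕ) : ℤ) ≤ v χ}).comap
            𝔟.toSubmodule.subtype := by
        rw [Submodule.span_le]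
        rintro _ ⟨x, hx, y, hy, rfl⟩
        suffices h : ⁅(x : L), (y : L)⁆ ∈
            weightSum {χ : Weight ℂ H L | ((k + 1 : ℕ) : ℤ) ≤ v χ} from h
        -- Degrees `≥ k` bracket into degrees `≥ 2k`, which suffices only for `k ≥ 1`; the first
        -- step is the regularity lemma.
        rcases Nat.eq_zero_or_pos k with rfl | hk
        · simpa using lie_mem_weightSum_pos hv hreg x.2 y.2
        · refine lie_mem_weightSum (fun χ hχ ψ hψ ω hω ↦ ?_) (ih x hx) (ih y hy)
          rw [Set.mem_ofPred_eq] at hχ hψ ⊢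
          rw [value_add hv hω]
          omega
      exact hle hx
  obtain ⟨N, hN⟩ : ∃ N : ℕ, ∀ χ : Weight ℂ H L, v χ < N := by
    refine ⟨∑ χ : Weight ℂ H L, (v χ).toNat + 1, fun χ ↦ ?_⟩
    have := Finset.single_le_sum (f := fun χ : Weight ℂ H L ↦ (v χ).toNat)
      (fun _ _ ↦ Nat.zero_le _) (Finset.mem_univ χ)
    push_cast
    have h2 : v χ ≤ (v χ).toNat := Int.self_le_toNat _
    have h3 : ((v χ).toNat : ℤ) ≤ ∑ χ : Weight ℂ H L, ((v χ).toNat : ℤ) := by exact_mod_cast this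
    omega
  rw [isSolvable_iff ℂ 𝔟]
  refine ⟨N, ?_⟩
  rw [LieSubmodule.eq_bot_iff]
  intro x hx
  have h1 := key N x hx
  have : {χ : Weight ℂ H L | (N : ℤ) ≤ v χ} = ∅ := by
    ext χ
    have := hN χ
    simp only [Set.mem_ofPred_eq, Set.mem_empty_iff_false, iff_false]
    omega
  rw [this, weightSum_empty] at h1
  exact Subtype.ext ((Submodule.mem_bot ℂ).1 h1)

set_option linter.unusedSectionVars false in
theorem not_isSolvable_of_isSl2Triple {𝔰 : LieSubalgebra ℂ L} {h e f : L}
    (t : IsSl2Triple h e f) (hh : h ∈ 𝔰) (he : e ∈ 𝔰) (hf : f ∈ 𝔰) :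
    ¬ LieAlgebra.IsSolvable 𝔰 := by
  intro hs
  have key (k : ℕ) : (⟨h, hh⟩ : 𝔰) ∈ derivedSeries ℂ 𝔰 k ∧ (⟨e, he⟩ : 𝔰) ∈ derivedSeries ℂ 𝔰 k ∧
      (⟨f, hf⟩ : 𝔰) ∈ derivedSeries ℂ 𝔰 k := by
    induction k with
    | zero => simp [derivedSeries_def]
    | succ k ih =>
      obtain ⟨h1, h2, h3⟩ := ih
      rw [derivedSeries_def, derivedSeriesOfIdeal_succ, ← derivedSeries_def]
      refine ⟨?_, ?_, ?_⟩
      · have : (⟨h, hh⟩ : 𝔰) = ⁅(⟨e, he⟩ : 𝔰), (⟨f, hf⟩ : 𝔰)⁆ := Subtype.ext t.lie_e_f.symm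
        rw [this]
        exact LieSubmodule.lie_mem_lie h2 h3
      · have : (⟨e, he⟩ : 𝔰) = (2⁻¹ : ℂ) • ⁅(⟨h, hh⟩ : 𝔰), (⟨e, he⟩ : 𝔰)⁆ := by
          apply Subtype.ext
          change e = (2⁻¹ : ℂ) • ⁅h, e⁆
          rw [t.lie_h_e_smul ℂ, smul_smul]
          norm_num
        rw [this]
        exact SMulMemClass.smul_mem _ (LieSubmodule.lie_mem_lie h1 h2)
      · have : (⟨f, hf⟩ : 𝔰) = (-2⁻¹ : ℂ) • ⁅(⟨h, hh⟩ : 𝔰), (⟨f, hf⟩ : 𝔰)⁆ := by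
          apply Subtype.ext
          change f = (-2⁻¹ : ℂ) • ⁅h, f⁆
          rw [t.lie_lie_smul_f ℂ, smul_neg, smul_smul]
          norm_num
        rw [this]
        exact SMulMemClass.smul_mem _ (LieSubmodule.lie_mem_lie h1 h3)
  obtain ⟨k, hk⟩ := (isSolvable_iff ℂ 𝔰).1 hs
  have := (key k).2.1
  rw [hk, LieSubmodule.mem_bot] at this
  exact t.e_ne_zero (congrArg Subtype.val this)

-- A larger solvable subalgebra contains `H`, hence with each element its root components. A
-- component of negative degree would complete an `𝔰𝔩₂`-triple with the opposite root vector and the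
-- coroot, contradicting solvability.
include hreg in
theorem isBorelSubalgebra_nonnegSubalgebra : IsBorelSubalgebra (nonnegSubalgebra z v hv) := by
  refine ⟨isSolvable_nonnegSubalgebra hv hreg, fun 𝔰 hs hle x hx ↦ ?_⟩
  rw [mem_nonnegSubalgebra, mem_weightSum]
  intro χ hχ
  rw [Set.mem_ofPred_eq] at hχ
  by_contra h0
  have hH : ∀ y : H, (y : L) ∈ 𝔰 := by
    intro y
    apply hle
    rw [mem_nonnegSubalgebra, mem_weightSum]
    intro ψ hψ
    by_cases h0 : ψ.IsZero
    · exact absurd (by rw [Set.mem_ofPred_eq, value_of_isZero hv h0]) hψ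
    · have h1 : (y : L) ∈ rootSpace H (0 : H → ℂ) := by
        have := zeroRootSubalgebra_eq_of_is_cartan ℂ L H
        exact this.ge y.2
      by_cases hb : rootSpace H (0 : H → ℂ) = ⊥
      · rw [hb] at h1
        rw [(LieSubmodule.mem_bot _).1 h1, map_zero]
      · exact comp_of_mem_ne (χ := ⟨0, hb⟩) h1 fun e ↦ h0 (congrArg DFunLike.coe e)
  have hnz : χ.IsNonZero := fun h ↦ hχ (value_of_isZero hv h).ge
  have hmem : comp χ x ∈ 𝔰 :=
    comp_mem_of_stable (V := 𝔰.toSubmodule) (fun y u hu ↦ 𝔰.lie_mem (hH y) hu) hx χ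
  obtain ⟨h, e, f, t, he, hf⟩ := exists_isSl2Triple_of_weight_isNonZero hnz
  have heq := t.h_eq_coroot hnz he hf
  obtain ⟨c, hc⟩ : ∃ c : ℂ, c • comp χ x = e := by
    simpa [Subtype.ext_iff] using (finrank_eq_one_iff_of_nonzero' ⟨_, comp_mem χ x⟩
      (by simpa using h0)).mp (finrank_rootSpace_eq_one _ hnz) ⟨e, he⟩
  refine not_isSolvable_of_isSl2Triple t (heq ▸ hH _) (hc ▸ 𝔰.smul_mem c hmem) (hle ?_) hs
  have hneg : v (-χ) = -v χ := by
    have h1 := hv (-χ)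
    rw [Weight.coe_neg, Pi.neg_apply, hv χ] at h1
    exact_mod_cast h1.symm
  exact rootSpace_le_weightSum (χ := -χ) (by rw [Set.mem_ofPred_eq]; omega) hf

end Borel

/-- The element of the Cartan subalgebra on which a root `α` takes the value `ht (w⁻¹ α)`. -/
def regularElement (b : (rootSystem H).Base) (w : (rootSystem H).weylGroup) : H :=
  (evalEquiv ℂ H).symm ((∑ j, b.toWeightBasis.coord j : Dual ℂ (Dual ℂ H)) ∘ₗ
    (rootSystem H).weylGroupRootRep w⁻¹)

theorem apply_regularElement (w : (rootSystem H).weylGroup) (α : H.root) :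
    α.1 (regularElement b w) = b.height (act w⁻¹ α) := by
  have h := apply_evalEquiv_symm_apply ℂ H ((rootSystem H).root α)
    ((∑ j, b.toWeightBasis.coord j : Dual ℂ (Dual ℂ H)) ∘ₗ (rootSystem H).weylGroupRootRep w⁻¹)
  refine Eq.trans h ?_
  have h1 : (rootSystem H).weylGroupRootRep w⁻¹ ((rootSystem H).root α) =
      (rootSystem H).root (act w⁻¹ α) := RootPairing.weylGroup_apply_root _ w⁻¹ α
  have h2 : b.height (act w⁻¹ α) = ∑ j : b.support, coeff b j (act w⁻¹ α) :=
    (Finset.sum_coe_sort b.support _).symm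
  rw [LinearMap.comp_apply, h1, LinearMap.sum_apply, h2]
  push_cast
  refine Finset.sum_congr rfl fun j _ ↦ ?_
  rw [coe_coeff]
  exact (apply_evalEquiv_symm_apply ℂ H ((rootSystem H).root (act w⁻¹ α))
    (b.toWeightBasis.coord j)).symm

-- The Borel subalgebra contained in it is the `w`-translate of the standard one: the nonnegative
-- part for the element on which `α` takes the value `ht(w⁻¹α)`. That element is regular because
-- heights of roots are nonzero.
open scoped Classical in
theorem isParabolicSubalgebra_of_forall_isPos {z : H} {v : Weight ℂ H L → ℤ}
    (hv : ∀ χ : Weight ℂ H L, χ z = v χ) (w : (rootSystem H).weylGroup)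
    (h : ∀ α : H.root, b.IsPos (act w⁻¹ α) → 0 ≤ v α.1) :
    IsParabolicSubalgebra (nonnegSubalgebra z v hv) := by
  let u : Weight ℂ H L → ℤ := fun χ ↦ if h : χ.IsNonZero then b.height (act w⁻¹ (toRoot h)) else 0
  have hu : ∀ χ : Weight ℂ H L, χ (regularElement b w) = u χ := by
    intro χ
    by_cases hχ : χ.IsZero
    · have : u χ = 0 := dif_neg (not_not.2 hχ)
      rw [this, hχ.eq]
      simp
    · have : u χ = b.height (act w⁻¹ (toRoot hχ)) := dif_pos hχ
      rw [this]
      exact apply_regularElement w (toRoot hχ)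
  refine ⟨_, isBorelSubalgebra_nonnegSubalgebra hu fun χ hχ ↦ ?_, ?_⟩
  · have : u χ = b.height (act w⁻¹ (toRoot hχ)) := dif_pos hχ
    rw [this]
    exact b.height_ne_zero _
  · refine weightSum_mono fun χ hχ ↦ ?_
    rw [Set.mem_ofPred_eq] at hχ ⊢
    by_cases h0 : χ.IsZero
    · rw [value_of_isZero hv h0]
    · have : u χ = b.height (act w⁻¹ (toRoot h0)) := dif_pos h0
      rw [this] at hχ
      exact h (toRoot h0) ((b.isPos_iff').2 hχ)

/-- The subalgebra `𝔤_w`. -/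
def schubertSubalgebra (i : b.support) (J : Finset b.support) (a : ℕ) : LieSubalgebra ℂ L :=
  nonnegSubalgebra (levelDual b i J a) (wlevel b i J a) (apply_levelDual b i J a)

theorem schubertSubalgebra_toSubmodule (i : b.support) (J : Finset b.support) (a : ℕ) :
    (schubertSubalgebra i J a).toSubmodule = weightSum {χ : Weight ℂ H L | 0 ≤ wlevel b i J a χ} :=
  rfl

section Marking

variable {i : b.support} (hi : IsCominuscule b i) {w : (rootSystem H).weylGroup}
  (hw : w ∈ hasseDiagram b i) {J : Finset b.support} {a : ℕ} (hJ : IsRootMarking i w J a)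

include hi hw hJ

theorem inversionWeights_eq :
    inversionWeights b w = {χ : Weight ℂ H L | wcoeff b i χ = -1 ∧ 0 ≤ wlevel b i J a χ} := by
  ext χ
  exact mem_inversionWeights_iff hi hw hJ

theorem schubertSubalgebra_eq_sup :
    (schubertSubalgebra i J a).toSubmodule = inversionSubspace b w ⊔
      bigradedGE (gradingElement b i) (markingElement b J) 0 0 ⊔
      bigradedGE (gradingElement b i) (markingElement b J) 1 a := by
  rw [schubertSubalgebra_toSubmodule, inversionSubspace_eq_weightSum, bigradedGE_marking,
    bigradedGE_marking, weightSum_sup, weightSum_sup, inversionWeights_eq hi hw hJ]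
  congr 1
  ext χ
  have h := wcoeff_cases hi χ
  simp only [Set.mem_ofPred_eq, Set.mem_union, wlevel]
  obtain h0 | h0 | h0 : wcoeff b i χ = -1 ∨ wcoeff b i χ = 0 ∨ wcoeff b i χ = 1 := by omega
  all_goals rw [h0]; omega

theorem iSupIndep_schubertSubalgebra :
    iSupIndep ![inversionSubspace b w,
      bigradedGE (gradingElement b i) (markingElement b J) 0 0,
      bigradedGE (gradingElement b i) (markingElement b J) 1 a] := by
  let S : Fin 3 → Set (Weight ℂ H L) := ![inversionWeights b w,
    {χ : Weight ℂ H L | wcoeff b i χ = 0 ∧ 0 ≤ wsum b J χ},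
    {χ : Weight ℂ H L | wcoeff b i χ = 1 ∧ a ≤ wsum b J χ}]
  have hS : ∀ k, ∀ χ ∈ S k, wcoeff b i χ = (k : ℤ) - 1 := by
    intro k χ hχ
    fin_cases k
    · exact ((mem_inversionWeights_iff hi hw hJ).1 hχ).1
    · exact hχ.1
    · exact hχ.1
  have := iSupIndep_weightSum S fun k l hkl ↦ by
    rw [Set.disjoint_left]
    intro χ h1 h2
    have h3 := hS k χ h1
    have h4 := hS l χ h2
    omega
  convert! this using 1
  funext k
  fin_cases k
  · exact inversionSubspace_eq_weightSum b w
  · exact bigradedGE_marking b i J 0 0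
  · exact bigradedGE_marking b i J 1 a

-- Writing `β = γ + δ` as in `IsRootMarking`, a nonzero `β`-component brackets `𝔤_{-γ} ⊆ 𝔫_w` onto
-- `𝔤_δ`, whose level is that of `β` minus that of `γ` and so negative.
omit hi hw in
theorem comp_eq_zero_of_lie_mem {A : L}
    (hA : ∀ X ∈ weightSum (inversionWeights b w),
      ⁅A, X⁆ ∈ weightSum {χ : Weight ℂ H L | 0 ≤ wlevel b i J a χ})
    {χ : Weight ℂ H L} (h1 : wcoeff b i χ = 1) (hl : wlevel b i J a χ < 0) : comp χ A = 0 := by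
  have hnz : χ.IsNonZero := by
    intro hz
    rw [wcoeff_of_isZero b i hz] at h1
    omega
  obtain ⟨β, rfl⟩ : ∃ β : H.root, β.1 = χ := ⟨toRoot hnz, rfl⟩
  rw [wcoeff_coe] at h1
  rw [wlevel_coe] at hl
  obtain ⟨γ, δ, hγ, hγ', hlt, hs⟩ := hJ.exists_of_level_neg' β h1 hl
  have hs' : IsSum β (negRoot γ) δ := by
    rw [IsSum, root_negRoot, hs]
    abel
  have hγ1 : (negRoot γ).1 ∈ inversionWeights b w := by
    rw [coe_negRoot_mem_inversionWeights, hJ.mem_inversionSet_iff γ hγ]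
    exact hγ'
  have hδ : δ.1 ∉ {χ : Weight ℂ H L | 0 ≤ wlevel b i J a χ} := by
    rw [Set.mem_ofPred_eq, wlevel_coe]
    have := level_isAdditive i J a _ _ _ hs
    omega
  exact comp_eq_zero_of_isSum hA hs' hγ1 hδ

/-- Modulo `𝔫_w` an element of `𝔰` is `B₀ + B₁` with `B₀`, `B₁` of degrees `0`, `1`. Bracketing with
`𝔫_w` isolates the parts: `B₀` must stabilize `𝔫_w`, then so must each `[B₁, X]` with `X ∈ 𝔫_w`. So
these brackets have nonnegative level, and therefore so does `B₁`. -/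
theorem schubertSubalgebra_isGreatest :
    IsGreatest {𝔰 : LieSubalgebra ℂ L | inversionSubspace b w ≤ 𝔰.toSubmodule ∧
      𝔰.toSubmodule ⊔ nonnegPart (gradingElement b i) =
        inversionSubspace b w ⊔ nonnegPart (gradingElement b i)} (schubertSubalgebra i J a) := by
  have hinv := inversionWeights_eq hi hw hJ
  refine ⟨⟨?_, ?_⟩, ?_⟩
  · rw [inversionSubspace_eq_weightSum, schubertSubalgebra_toSubmodule, hinv]
    exact weightSum_mono fun χ hχ ↦ hχ.2
  · rw [inversionSubspace_eq_weightSum, schubertSubalgebra_toSubmodule, hinv,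
      nonnegPart_gradingElement, weightSum_sup, weightSum_sup]
    congr 1
    ext χ
    have h := wcoeff_cases hi χ
    simp only [Set.mem_ofPred_eq, Set.mem_union]
    omega
  · rintro 𝔰 ⟨h1, h2⟩ A hA
    rw [inversionSubspace_eq_weightSum] at h1 h2
    rw [nonnegPart_gradingElement] at h2
    set N := weightSum (inversionWeights b w) with hN
    have hNle : N ≤ weightSum {χ : Weight ℂ H L | 0 ≤ wlevel b i J a χ} := by
      rw [hN, hinv]
      exact weightSum_mono fun χ hχ ↦ hχ.2
    have hsub : 𝔰.toSubmodule ≤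
        weightSum (inversionWeights b w ∪ {χ : Weight ℂ H L | 0 ≤ wcoeff b i χ}) := by
      rw [← weightSum_sup, ← h2]
      exact le_sup_left
    have hneg {x : L} (hx : x ∈ 𝔰) (hx' : x ∈ weightSum {χ : Weight ℂ H L | wcoeff b i χ = -1}) :
        x ∈ N := by
      have : x ∈ weightSum _ ⊓ weightSum _ := ⟨hsub hx, hx'⟩
      rw [weightSum_inf] at this
      refine weightSum_mono ?_ this
      rintro χ ⟨h | h, h'⟩
      · exact h
      · rw [Set.mem_ofPred_eq] at h h'
        omega
    have hlie {k l m : ℤ} (hm : k + l = m) {x y : L} (hx : x ∈ weightSum {χ : Weight ℂ H L | wcoeff b i χ = k})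
        (hy : y ∈ weightSum {χ : Weight ℂ H L | wcoeff b i χ = l}) :
        ⁅x, y⁆ ∈ weightSum {χ : Weight ℂ H L | wcoeff b i χ = m} := by
      refine lie_mem_weightSum (fun χ hχ ψ hψ ω hω ↦ ?_) hx hy
      rw [Set.mem_ofPred_eq] at hχ hψ ⊢
      rw [wcoeff_add b i hω, hχ, hψ, hm]
    have hNdeg : N ≤ weightSum {χ : Weight ℂ H L | wcoeff b i χ = -1} := by
      rw [hN, hinv]
      exact weightSum_mono fun χ hχ ↦ hχ.1
    have hsplit : {χ : Weight ℂ H L | 0 ≤ wcoeff b i χ} =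
        {χ | wcoeff b i χ = 0} ∪ {χ | wcoeff b i χ = 1} := by
      ext χ
      have h := wcoeff_cases hi χ
      simp only [Set.mem_ofPred_eq, Set.mem_union]
      omega
    have hA' := hsub hA
    rw [← weightSum_sup, hsplit, ← weightSum_sup] at hA'
    obtain ⟨A', hAn, B, hB, rfl⟩ := Submodule.mem_sup.1 hA'
    obtain ⟨B₀, hB₀, B₁, hB₁, rfl⟩ := Submodule.mem_sup.1 hB
    have hBs : B₀ + B₁ ∈ 𝔰 := by
      have := sub_mem hA (show A' ∈ 𝔰 from h1 hAn)
      rwa [add_sub_cancel_left] at this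
    have hdeg0 {C : L} (hC : C ∈ weightSum {χ : Weight ℂ H L | wcoeff b i χ = 0})
        (hst : ∀ X ∈ N, ⁅C, X⁆ ∈ N) : C ∈ weightSum {χ : Weight ℂ H L | 0 ≤ wlevel b i J a χ} := by
      have := (hJ.stabilizer_iff hi hw hC).1 hst
      refine weightSum_mono ?_ this
      rintro χ ⟨h3, h4⟩
      rw [Set.mem_ofPred_eq, wlevel, h3]
      omega
    -- `[B₀, X]` is the part of degree `-1` of `[B₀ + B₁, X] ∈ 𝔰`, and in degree `-1` elements of
    -- `𝔰` have only components in `𝔫_w`.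
    have hC (X : L) (hX : X ∈ N) : ⁅B₀, X⁆ ∈ N := by
      have e1 : ⁅B₀ + B₁, X⁆ ∈ 𝔰 := 𝔰.lie_mem hBs (h1 hX)
      have e2 := hlie (show 1 + -1 = (0 : ℤ) by norm_num) hB₁ (hNdeg hX)
      have e3 := hlie (zero_add (-1 : ℤ)) hB₀ (hNdeg hX)
      have e4 : ⁅B₀, X⁆ ∈ weightSum
          (inversionWeights b w ∪ {χ : Weight ℂ H L | 0 ≤ wcoeff b i χ}) := by
        have : ⁅B₀, X⁆ = ⁅B₀ + B₁, X⁆ - ⁅B₁, X⁆ := by rw [add_lie]; abel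
        rw [this]
        refine sub_mem (hsub e1) (weightSum_mono ?_ e2)
        intro χ hχ
        rw [Set.mem_ofPred_eq] at hχ
        right
        rw [Set.mem_ofPred_eq]
        omega
      have : ⁅B₀, X⁆ ∈ weightSum _ ⊓ weightSum _ := ⟨e4, e3⟩
      rw [weightSum_inf] at this
      refine weightSum_mono ?_ this
      rintro χ ⟨h | h, h'⟩
      · exact h
      · rw [Set.mem_ofPred_eq] at h h'
        omega
    have hB₀' := hdeg0 hB₀ hC
    have hB₁s (X : L) (hX : X ∈ N) :
        ⁅B₁, X⁆ ∈ weightSum {χ : Weight ℂ H L | 0 ≤ wlevel b i J a χ} := by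
      have e1 : ⁅B₁, X⁆ ∈ 𝔰 := by
        have : ⁅B₁, X⁆ = ⁅B₀ + B₁, X⁆ - ⁅B₀, X⁆ := by rw [add_lie]; abel
        rw [this]
        exact sub_mem (𝔰.lie_mem hBs (h1 hX)) (show _ ∈ 𝔰 from h1 (hC X hX))
      have e2 : ⁅B₁, X⁆ ∈ weightSum {χ : Weight ℂ H L | wcoeff b i χ = 0} := hlie (show 1 + -1 = (0 : ℤ) by norm_num) hB₁ (hNdeg hX)
      refine hdeg0 e2 fun X' hX' ↦ hneg (𝔰.lie_mem e1 (h1 hX')) ?_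
      exact hlie (zero_add (-1 : ℤ)) e2 (hNdeg hX')
    have hB₁' : B₁ ∈ weightSum {χ : Weight ℂ H L | 0 ≤ wlevel b i J a χ} := by
      rw [mem_weightSum]
      intro χ hχ
      by_cases h3 : wcoeff b i χ = 1
      · exact comp_eq_zero_of_lie_mem hJ hB₁s h3
          (by rw [Set.mem_ofPred_eq] at hχ; omega)
      · exact mem_weightSum.1 hB₁ χ h3
    exact Submodule.add_mem _ (hNle hAn) (Submodule.add_mem _ hB₀' hB₁')

omit hi hw in
theorem schubertSubalgebra_isParabolic : IsParabolicSubalgebra (schubertSubalgebra i J a) :=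
  isParabolicSubalgebra_of_forall_isPos (b := b) _ w fun α hα ↦ by
    rw [wlevel_coe]
    exact hJ.level_nonneg α hα

end Marking

end GradedSubalgebra

/-! ### Conjugation by a matrix exponential as the exponential of `ad`. -/

section ExpConj

open NormedSpace
open scoped Matrix.Norms.Operator Nat

variable {n : Type*} [Fintype n] [DecidableEq n]

theorem exp_mul_exp_neg (X : Matrix n n ℂ) : exp X * exp (-X) = 1 := by
  rw [← Matrix.exp_add_of_commute X (-X) (Commute.refl X).neg_right, add_neg_cancel, exp_zero]

theorem exp_neg_mul_exp (X : Matrix n n ℂ) : exp (-X) * exp X = 1 := by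
  rw [← Matrix.exp_add_of_commute (-X) X (Commute.refl X).neg_left, neg_add_cancel, exp_zero]

theorem hasDerivAt_exp_smul (X : Matrix n n ℂ) (t : ℂ) :
    HasDerivAt (fun s : ℂ ↦ exp (s • X)) (X * exp (t • X)) t :=
  hasDerivAt_exp_smul_const' X t

theorem hasDerivAt_exp_neg_smul (X : Matrix n n ℂ) (t : ℂ) :
    HasDerivAt (fun s : ℂ ↦ exp (-(s • X))) (-(exp (-(t • X)) * X)) t := by
  have := hasDerivAt_exp_smul_const (-X) t
  simp only [smul_neg, mul_neg] at this
  exact this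

theorem hasDerivAt_exp_conj (X Y : Matrix n n ℂ) (t : ℂ) :
    HasDerivAt (fun s : ℂ ↦ exp (s • X) * Y * exp (-(s • X)))
      (exp (t • X) * ⁅X, Y⁆ * exp (-(t • X))) t := by
  have h := (((hasDerivAt_exp_smul_const X t).mul_const Y)).mul (hasDerivAt_exp_neg_smul X t)
  have hc : Commute X (exp (-(t • X))) := by
    apply Commute.exp_right
    exact ((Commute.refl X).smul_right t).neg_right
  convert! h using 1
  rw [LieRing.of_associative_ring_bracket, ← hc.eq]
  noncomm_ring

theorem iteratedDeriv_exp_conj (X Y : Matrix n n ℂ) (k : ℕ) :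
    iteratedDeriv k (fun s : ℂ ↦ exp (s • X) * Y * exp (-(s • X))) =
      fun s : ℂ ↦ exp (s • X) * (fun Z ↦ ⁅X, Z⁆)^[k] Y * exp (-(s • X)) := by
  induction k with
  | zero => simp
  | succ k ih =>
    rw [iteratedDeriv_succ, ih, Function.iterate_succ_apply']
    funext t
    exact (hasDerivAt_exp_conj X _ t).deriv

/-- `Ad (exp X) = exp (ad X)`. -/
theorem hasSum_exp_conj (X Y : Matrix n n ℂ) :
    HasSum (fun k : ℕ ↦ (k ! : ℂ)⁻¹ • (fun Z ↦ ⁅X, Z⁆)^[k] Y) (exp X * Y * exp (-X)) := by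
  -- The series is the Taylor expansion at `0`, evaluated at `1`, of the entire function `s ↦
  -- exp(sX) Y exp(-sX)`.
  have h := Complex.hasSum_taylorSeries_of_entire
    (fun t ↦ (hasDerivAt_exp_conj X Y t).differentiableAt) 0 1
  simp only [iteratedDeriv_exp_conj, sub_zero, one_pow, one_smul, zero_smul, neg_zero, exp_zero,
    one_mul, mul_one] at h
  exact h

variable {V : Submodule ℂ (Matrix n n ℂ)} {X : Matrix n n ℂ} (hV : ∀ Y ∈ V, ⁅X, Y⁆ ∈ V)

omit [DecidableEq n] in
theorem isClosed_submodule (V : Submodule ℂ (Matrix n n ℂ)) :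
    IsClosed (V : Set (Matrix n n ℂ)) :=
  V.closed_of_finiteDimensional

include hV

/-- From order `m` on every term of the series lies in `V`, and `V` is closed. Only `m = 0, 1, 2`
are needed. -/
theorem exp_conj_sub_sum_mem {Y : Matrix n n ℂ} (m : ℕ) (hY : (fun Z ↦ ⁅X, Z⁆)^[m] Y ∈ V) :
    exp X * Y * exp (-X) - ∑ k ∈ Finset.range m, (k ! : ℂ)⁻¹ • (fun Z ↦ ⁅X, Z⁆)^[k] Y ∈ V := by
  have h := (hasSum_nat_add_iff' m).2 (hasSum_exp_conj X Y)
  refine (isClosed_submodule V).mem_of_tendsto h.tendsto_sum_nat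
    (Filter.Eventually.of_forall fun N ↦ V.sum_mem fun k hk ↦ V.smul_mem _ ?_)
  clear hk
  induction k with
  | zero => simpa using hY
  | succ k ih =>
    rw [show k + 1 + m = (k + m) + 1 by omega, Function.iterate_succ_apply']
    exact hV _ ih

theorem exp_conj_mem {Y : Matrix n n ℂ} (hY : Y ∈ V) : exp X * Y * exp (-X) ∈ V := by
  simpa using exp_conj_sub_sum_mem hV 0 hY

theorem exp_conj_sub_mem {Y : Matrix n n ℂ} (hY : ⁅X, Y⁆ ∈ V) : exp X * Y * exp (-X) - Y ∈ V := by
  simpa using exp_conj_sub_sum_mem hV 1 hY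

theorem exp_conj_sub_sub_mem {Y : Matrix n n ℂ} (hY : ⁅X, ⁅X, Y⁆⁆ ∈ V) :
    exp X * Y * exp (-X) - (Y + ⁅X, Y⁆) ∈ V := by
  simpa [Finset.sum_range_succ] using exp_conj_sub_sum_mem hV 2 hY

end ExpConj

/-! ### The adjoint action of the group on its Lie algebra. -/

section Adjoint

open NormedSpace

variable {n : Type*} [Fintype n] [DecidableEq n] {𝔤 : LieSubalgebra ℂ (Matrix n n ℂ)}

@[simp] theorem toMatrix_one : toMatrix (1 : connectedGroup 𝔤) = 1 := rfl

@[simp] theorem toMatrix_mul (u v : connectedGroup 𝔤) :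
    toMatrix (u * v) = toMatrix u * toMatrix v := rfl

@[simp] theorem toMatrix_mul_inv (u : connectedGroup 𝔤) : toMatrix u * toMatrix u⁻¹ = 1 := by
  rw [← toMatrix_mul, mul_inv_cancel, toMatrix_one]

@[simp] theorem toMatrix_inv_mul (u : connectedGroup 𝔤) : toMatrix u⁻¹ * toMatrix u = 1 := by
  rw [← toMatrix_mul, inv_mul_cancel, toMatrix_one]

theorem toMatrix_injective : Function.Injective (toMatrix : connectedGroup 𝔤 → Matrix n n ℂ) :=
  fun _ _ h ↦ Subtype.ext (Units.ext h)

/-- The exponential `𝔤 → G`. -/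
def expG (X : 𝔤) : connectedGroup 𝔤 :=
  ⟨⟨exp (X : Matrix n n ℂ), exp (-(X : Matrix n n ℂ)), exp_mul_exp_neg _, exp_neg_mul_exp _⟩,
    Subgroup.subset_closure ⟨X, X.2, rfl⟩⟩

@[simp] theorem toMatrix_expG (X : 𝔤) : toMatrix (expG X) = exp (X : Matrix n n ℂ) := rfl

@[simp] theorem toMatrix_expG_inv (X : 𝔤) : toMatrix (expG X)⁻¹ = exp (-(X : Matrix n n ℂ)) := rfl

theorem inv_expG (X : 𝔤) : (expG X)⁻¹ = expG (-X) := toMatrix_injective rfl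

@[simp] theorem expG_zero : expG (0 : 𝔤) = 1 :=
  toMatrix_injective (by simp)

theorem expG_add {X Y : 𝔤} (h : ⁅X, Y⁆ = 0) : expG (X + Y) = expG X * expG Y := by
  apply toMatrix_injective
  refine Matrix.exp_add_of_commute _ _ ?_
  have := congrArg (Subtype.val) h
  rw [LieSubalgebra.coe_bracket, LieRing.of_associative_ring_bracket] at this
  exact sub_eq_zero.1 this

theorem expSet_eq (S : Set 𝔤) : expSet S = expG '' S := by
  ext u
  constructor
  · rintro ⟨X, hX, h⟩
    exact ⟨X, hX, toMatrix_injective h.symm⟩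
  · rintro ⟨X, hX, rfl⟩
    exact ⟨X, hX, rfl⟩

theorem connectedGroup_induction {p : connectedGroup 𝔤 → Prop} (h1 : p 1)
    (hmul : ∀ X u, p u → p (expG X * u)) (u : connectedGroup 𝔤) : p u := by
  obtain ⟨g, hg⟩ := u
  induction hg using Subgroup.closure_induction_left with
  | one => exact h1
  | mul_left x hx y hy ih =>
    obtain ⟨X, hX, h⟩ := hx
    convert! hmul ⟨X, hX⟩ _ ih using 1
    exact toMatrix_injective (congrArg (· * (y : Matrix n n ℂ)) h)
  | inv_mul_cancel x hx y hy ih =>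
    obtain ⟨X, hX, h⟩ := hx
    convert! hmul (-⟨X, hX⟩) _ ih using 1
    have hx' : x = ((expG ⟨X, hX⟩ : connectedGroup 𝔤) : GL n ℂ) := Units.ext h
    subst hx'
    exact toMatrix_injective rfl

theorem conj_mem (u : connectedGroup 𝔤) (X : 𝔤) :
    toMatrix u * (X : Matrix n n ℂ) * toMatrix u⁻¹ ∈ 𝔤 := by
  revert X
  refine connectedGroup_induction
    (p := fun u ↦ ∀ X : 𝔤, toMatrix u * (X : Matrix n n ℂ) * toMatrix u⁻¹ ∈ 𝔤) ?_ ?_ u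
  · intro X
    simp
  · intro Y u ih X
    have := exp_conj_mem (V := 𝔤.toSubmodule) (X := (Y : Matrix n n ℂ))
      (fun Z hZ ↦ 𝔤.lie_mem Y.2 hZ) (ih X)
    simpa [mul_inv_rev, mul_assoc] using this

/-- The adjoint representation. -/
def Ad (u : connectedGroup 𝔤) : 𝔤 ≃ₗ⁅ℂ⁆ 𝔤 where
  toFun X := ⟨toMatrix u * (X : Matrix n n ℂ) * toMatrix u⁻¹, conj_mem u X⟩
  map_add' X Y := by
    apply Subtype.ext
    simp [mul_add, add_mul]
  map_smul' c X := by
    apply Subtype.ext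
    simp
  map_lie' {X Y} := by
    apply Subtype.ext
    have h := toMatrix_inv_mul u
    simp only [LieSubalgebra.coe_bracket, LieRing.of_associative_ring_bracket]
    have e (A B : Matrix n n ℂ) : toMatrix u * A * toMatrix u⁻¹ * (toMatrix u * B * toMatrix u⁻¹) =
        toMatrix u * (A * B) * toMatrix u⁻¹ := by
      calc _ = toMatrix u * A * (toMatrix u⁻¹ * toMatrix u) * B * toMatrix u⁻¹ := by noncomm_ring
        _ = _ := by rw [h]; noncomm_ring
    rw [e, e, mul_sub, sub_mul]
  invFun X := ⟨toMatrix u⁻¹ * (X : Matrix n n ℂ) * toMatrix u, by simpa using conj_mem u⁻¹ X⟩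
  left_inv X := by
    apply Subtype.ext
    have h := toMatrix_inv_mul u
    calc _ = (toMatrix u⁻¹ * toMatrix u) * (X : Matrix n n ℂ) * (toMatrix u⁻¹ * toMatrix u) := by
          simp only [mul_assoc]
      _ = _ := by rw [h]; simp
  right_inv X := by
    apply Subtype.ext
    have h := toMatrix_mul_inv u
    calc _ = (toMatrix u * toMatrix u⁻¹) * (X : Matrix n n ℂ) * (toMatrix u * toMatrix u⁻¹) := by
          simp only [mul_assoc]
      _ = _ := by rw [h]; simp

theorem coe_Ad (u : connectedGroup 𝔤) (X : 𝔤) :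
    (Ad u X : Matrix n n ℂ) = toMatrix u * (X : Matrix n n ℂ) * toMatrix u⁻¹ := rfl

@[simp] theorem Ad_one (X : 𝔤) : Ad 1 X = X := by
  apply Subtype.ext
  simp [coe_Ad]

theorem Ad_mul (u v : connectedGroup 𝔤) (X : 𝔤) : Ad (u * v) X = Ad u (Ad v X) := by
  apply Subtype.ext
  simp [coe_Ad, mul_assoc]

@[simp] theorem Ad_Ad_inv (u : connectedGroup 𝔤) (X : 𝔤) : Ad u (Ad u⁻¹ X) = X := by
  rw [← Ad_mul, mul_inv_cancel, Ad_one]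

@[simp] theorem Ad_inv_Ad (u : connectedGroup 𝔤) (X : 𝔤) : Ad u⁻¹ (Ad u X) = X := by
  rw [← Ad_mul, inv_mul_cancel, Ad_one]

theorem expG_Ad (u : connectedGroup 𝔤) (X : 𝔤) : expG (Ad u X) = u * expG X * u⁻¹ := by
  apply toMatrix_injective
  exact Matrix.exp_units_conj (u : GL n ℂ) (X : Matrix n n ℂ)

theorem mem_adNormalizer {𝔮 : Submodule ℂ 𝔤} {u : connectedGroup 𝔤} :
    u ∈ adNormalizer 𝔮 ↔ ∀ X : 𝔤, X ∈ 𝔮 ↔ Ad u X ∈ 𝔮 := by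
  have hmem (X : 𝔤) : (X : Matrix n n ℂ) ∈ 𝔮.map 𝔤.toSubmodule.subtype ↔ X ∈ 𝔮 := by
    constructor
    · rintro ⟨Y, hY, h⟩
      rwa [← Subtype.ext h]
    · exact fun h ↦ ⟨X, h, rfl⟩
  constructor
  · intro h X
    rw [← hmem, ← hmem]
    exact h X
  · intro h X
    constructor
    · rintro ⟨Y, hY, rfl⟩
      exact (hmem (Ad u Y)).2 ((h Y).1 hY)
    · rintro ⟨Y, hY, hYX⟩
      have : X = (Ad u⁻¹ Y : 𝔤) := by
        have e : (Y : Matrix n n ℂ) = toMatrix u * X * toMatrix u⁻¹ := hYX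
        rw [coe_Ad, e, inv_inv]
        calc X = (toMatrix u⁻¹ * toMatrix u) * X * (toMatrix u⁻¹ * toMatrix u) := by simp
          _ = _ := by simp only [mul_assoc]
      rw [this]
      refine (hmem _).2 ((h _).2 ?_)
      rwa [Ad_Ad_inv]

variable {V : Submodule ℂ 𝔤} {X : 𝔤} (hV : ∀ Y ∈ V, ⁅X, Y⁆ ∈ V)

theorem lie_mem_map_subtype {V : Submodule ℂ 𝔤} {X : 𝔤} (hV : ∀ Y ∈ V, ⁅X, Y⁆ ∈ V) :
    ∀ Y ∈ V.map 𝔤.toSubmodule.subtype, ⁅(X : Matrix n n ℂ), Y⁆ ∈ V.map 𝔤.toSubmodule.subtype := by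
  rintro _ ⟨Y, hY, rfl⟩
  exact ⟨⁅X, Y⁆, hV Y hY, rfl⟩

include hV

theorem Ad_expG_mem {Y : 𝔤} (hY : Y ∈ V) : Ad (expG X) Y ∈ V := by
  obtain ⟨Z, hZ, h⟩ := exp_conj_mem (lie_mem_map_subtype hV) ⟨Y, hY, rfl⟩
  exact (Subtype.ext h : Z = Ad (expG X) Y) ▸ hZ

theorem Ad_expG_sub_mem {Y : 𝔤} (hY : ⁅X, Y⁆ ∈ V) : Ad (expG X) Y - Y ∈ V := by
  obtain ⟨Z, hZ, h⟩ := exp_conj_sub_mem (Y := (Y : Matrix n n ℂ)) (lie_mem_map_subtype hV)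
    ⟨⁅X, Y⁆, hY, rfl⟩
  exact (Subtype.ext h : Z = Ad (expG X) Y - Y) ▸ hZ

theorem Ad_expG_sub_sub_mem {Y : 𝔤} (hY : ⁅X, ⁅X, Y⁆⁆ ∈ V) :
    Ad (expG X) Y - (Y + ⁅X, Y⁆) ∈ V := by
  obtain ⟨Z, hZ, h⟩ := exp_conj_sub_sub_mem (Y := (Y : Matrix n n ℂ)) (lie_mem_map_subtype hV)
    ⟨⁅X, ⁅X, Y⁆⁆, hY, rfl⟩
  exact (Subtype.ext h : Z = Ad (expG X) Y - (Y + ⁅X, Y⁆)) ▸ hZ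

omit hV in
theorem Ad_expG_of_lie_eq_zero {Y : 𝔤} (h : ⁅X, Y⁆ = 0) : Ad (expG X) Y = Y := by
  have := Ad_expG_sub_mem (V := (⊥ : Submodule ℂ 𝔤)) (X := X) (Y := Y)
    (fun Z hZ ↦ by rw [(Submodule.mem_bot ℂ).1 hZ, lie_zero]; exact zero_mem _)
    (by rw [h]; exact zero_mem _)
  exact sub_eq_zero.1 ((Submodule.mem_bot ℂ).1 this)

omit hV in
theorem expG_mem_adNormalizer {𝔮 : LieSubalgebra ℂ 𝔤} {Y : 𝔤} (hY : Y ∈ 𝔮) :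
    expG Y ∈ adNormalizer 𝔮.toSubmodule := by
  rw [mem_adNormalizer]
  intro X
  refine ⟨fun h ↦ Ad_expG_mem (fun Z hZ ↦ 𝔮.lie_mem hY hZ) h, fun h ↦ ?_⟩
  have := Ad_expG_mem (X := -Y) (fun Z hZ ↦ 𝔮.lie_mem (neg_mem hY) hZ) h
  rwa [← inv_expG, Ad_inv_Ad] at this

end Adjoint

/-! ### Polynomial functions of the matrix entries and their derivatives along left translation. -/

section PolynomialFunctions

open NormedSpace MvPolynomial
open scoped Matrix.Norms.Operator Nat

variable {n : Type*} [Fintype n] [DecidableEq n]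

/-- The value of a polynomial in the matrix entries at a matrix. -/
abbrev evalAt (g : Matrix n n ℂ) : MvPolynomial (n × n) ℂ →+* ℂ :=
  eval fun e ↦ g e.1 e.2

/-- The derivative along the left action: `(D_A f)(g) = d/dt f(exp(tA) g)` at `t = 0`. -/
def lieDeriv (A : Matrix n n ℂ) : Derivation ℂ (MvPolynomial (n × n) ℂ) (MvPolynomial (n × n) ℂ) :=
  mkDerivation ℂ fun e ↦ ∑ k, C (A e.1 k) * X (k, e.2)

omit [DecidableEq n] in
theorem lieDeriv_X (A : Matrix n n ℂ) (e : n × n) :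
    lieDeriv A (X e) = ∑ k, C (A e.1 k) * X (k, e.2) :=
  mkDerivation_X ℂ _ e

omit [DecidableEq n] in
theorem lieDeriv_add (A B : Matrix n n ℂ) : lieDeriv (A + B) = lieDeriv A + lieDeriv B := by
  refine MvPolynomial.derivation_ext fun e ↦ ?_
  rw [Derivation.add_apply, lieDeriv_X, lieDeriv_X, lieDeriv_X, ← Finset.sum_add_distrib]
  simp [add_mul]

omit [DecidableEq n] in
theorem lieDeriv_smul (c : ℂ) (A : Matrix n n ℂ) : lieDeriv (c • A) = c • lieDeriv A := by
  refine MvPolynomial.derivation_ext fun e ↦ ?_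
  rw [Derivation.smul_apply, lieDeriv_X, lieDeriv_X, Finset.smul_sum]
  simp [MvPolynomial.smul_eq_C_mul, mul_assoc]

omit [DecidableEq n] in
theorem lieDeriv_lieDeriv_X (A B : Matrix n n ℂ) (e : n × n) :
    lieDeriv A (lieDeriv B (X e)) = ∑ k, C ((B * A) e.1 k) * X (k, e.2) := by
  rw [lieDeriv_X, map_sum]
  simp only [Derivation.leibniz, lieDeriv_X, smul_eq_mul, ← MvPolynomial.algebraMap_eq,
    Derivation.map_algebraMap, mul_zero, add_zero, Matrix.mul_apply, map_sum, map_mul,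
    Finset.sum_mul, Finset.mul_sum]
  rw [Finset.sum_comm]
  simp only [mul_assoc]

/-- Left translations generate right-invariant vector fields, so `lieDeriv` reverses brackets.
Derivations need only be compared on the coordinates. -/
theorem lieDeriv_lie (A B : Matrix n n ℂ) (f : MvPolynomial (n × n) ℂ) :
    lieDeriv ⁅A, B⁆ f = lieDeriv B (lieDeriv A f) - lieDeriv A (lieDeriv B f) := by
  have : lieDeriv ⁅A, B⁆ = ⁅lieDeriv B, lieDeriv A⁆ := by
    refine MvPolynomial.derivation_ext fun e ↦ ?_
    rw [Derivation.commutator_apply, lieDeriv_lieDeriv_X, lieDeriv_lieDeriv_X, lieDeriv_X,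
      ← Finset.sum_sub_distrib]
    simp [LieRing.of_associative_ring_bracket, sub_mul]
  rw [this, Derivation.commutator_apply]

theorem hasDerivAt_entry (A g : Matrix n n ℂ) (i j : n) (t : ℂ) :
    HasDerivAt (fun s : ℂ ↦ (exp (s • A) * g) i j) ((A * (exp (t • A) * g)) i j) t := by
  have h := (hasDerivAt_exp_smul A t).mul_const g
  have := (LinearMap.toContinuousLinearMap (Matrix.entryLinearMap ℂ ℂ i j)).hasFDerivAt.comp_hasDerivAt
    t h
  rw [← mul_assoc]
  exact this

theorem hasDerivAt_evalAt (A g : Matrix n n ℂ) (f : MvPolynomial (n × n) ℂ) (t : ℂ) :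
    HasDerivAt (fun s : ℂ ↦ evalAt (exp (s • A) * g) f)
      (evalAt (exp (t • A) * g) (lieDeriv A f)) t := by
  induction f using MvPolynomial.induction_on with
  | C c =>
    rw [← MvPolynomial.algebraMap_eq, Derivation.map_algebraMap, map_zero]
    simpa using hasDerivAt_const t c
  | add p q hp hq =>
    simp only [map_add]
    exact hp.add hq
  | mul_X p e hp =>
    have hX : HasDerivAt (fun s : ℂ ↦ evalAt (exp (s • A) * g) (X e))
        (evalAt (exp (t • A) * g) (lieDeriv A (X e))) t := by
      simp only [lieDeriv_X, map_sum, map_mul, eval_C, eval_X]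
      exact hasDerivAt_entry A g e.1 e.2 t
    have := hp.mul hX
    simp only [map_mul, Derivation.leibniz, map_add, smul_eq_mul]
    convert! this using 1
    ring

theorem iteratedDeriv_evalAt (A g : Matrix n n ℂ) (f : MvPolynomial (n × n) ℂ) (k : ℕ) :
    iteratedDeriv k (fun s : ℂ ↦ evalAt (exp (s • A) * g) f) =
      fun s : ℂ ↦ evalAt (exp (s • A) * g) ((lieDeriv A)^[k] f) := by
  induction k with
  | zero => simp
  | succ k ih =>
    rw [iteratedDeriv_succ, ih, Function.iterate_succ_apply']
    funext t
    exact (hasDerivAt_evalAt A g _ t).deriv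

/-- The function `t ↦ f(exp(tA) g)` is entire and all its Taylor coefficients at `0` vanish. -/
theorem evalAt_exp_mul_eq_zero {A g : Matrix n n ℂ} {f : MvPolynomial (n × n) ℂ}
    (h : ∀ k : ℕ, evalAt g ((lieDeriv A)^[k] f) = 0) : evalAt (exp A * g) f = 0 := by
  have := Complex.taylorSeries_eq_of_entire' 0 1
    (fun t ↦ (hasDerivAt_evalAt A g f t).differentiableAt)
  simp only [one_smul] at this
  rw [← this]
  simp only [iteratedDeriv_evalAt, zero_smul, exp_zero, one_mul, h]
  simp

/-- A polynomial function that vanishes along a one-parameter orbit has derivative zero there. -/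
theorem evalAt_lieDeriv_eq_zero {A g : Matrix n n ℂ} {f : MvPolynomial (n × n) ℂ}
    (h : ∀ t : ℝ, evalAt (exp ((t : ℂ) • A) * g) f = 0) : evalAt g (lieDeriv A f) = 0 := by
  have h1 := hasDerivAt_evalAt A g f ((0 : ℝ) : ℂ)
  have h2 := h1.comp_ofReal
  have h3 : (fun t : ℝ ↦ evalAt (exp ((t : ℂ) • A) * g) f) = fun _ ↦ 0 := funext h
  rw [h3] at h2
  have := h2.unique (hasDerivAt_const (0 : ℝ) (0 : ℂ))
  simpa using this

/-- Right translation of polynomial functions. -/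
def rightTranslate (p : Matrix n n ℂ) : MvPolynomial (n × n) ℂ →ₐ[ℂ] MvPolynomial (n × n) ℂ :=
  aeval fun e ↦ ∑ k, X (e.1, k) * C (p k e.2)

omit [DecidableEq n] in
theorem evalAt_rightTranslate (p g : Matrix n n ℂ) (f : MvPolynomial (n × n) ℂ) :
    evalAt g (rightTranslate p f) = evalAt (g * p) f := by
  induction f using MvPolynomial.induction_on with
  | C c => simp [rightTranslate]
  | add p q hp hq => simp only [map_add, hp, hq]
  | mul_X p e hp =>
    rw [map_mul, map_mul, hp, map_mul]
    congr 1
    simp [rightTranslate, Matrix.mul_apply]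

end PolynomialFunctions

/-! ### Zariski closures and their infinitesimal symmetries. -/

section ZariskiHull

open NormedSpace MvPolynomial

variable {n : Type*} [Fintype n] [DecidableEq n] {𝔤 : LieSubalgebra ℂ (Matrix n n ℂ)}

/-- The polynomials that vanish on a subset of `G`. -/
def vanishing (S : Set (connectedGroup 𝔤)) : Submodule ℂ (MvPolynomial (n × n) ℂ) where
  carrier := {f | ∀ u ∈ S, evalAt (toMatrix u) f = 0}
  add_mem' hf hg u hu := by rw [map_add, hf u hu, hg u hu, add_zero]
  zero_mem' u _ := map_zero _
  smul_mem' c f hf u hu := by rw [smul_eval, hf u hu, mul_zero]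

theorem mem_vanishing {S : Set (connectedGroup 𝔤)} {f : MvPolynomial (n × n) ℂ} :
    f ∈ vanishing S ↔ ∀ u ∈ S, evalAt (toMatrix u) f = 0 := Iff.rfl

/-- The Zariski closure in `G` of a subset of `G`. -/
def zariskiHull (S : Set (connectedGroup 𝔤)) : Set (connectedGroup 𝔤) :=
  {u | ∀ f ∈ vanishing S, evalAt (toMatrix u) f = 0}

theorem subset_zariskiHull (S : Set (connectedGroup 𝔤)) : S ⊆ zariskiHull S :=
  fun u hu _ hf ↦ hf u hu

theorem mul_mem_zariskiHull {S : Set (connectedGroup 𝔤)} {p : connectedGroup 𝔤}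
    (hp : ∀ u ∈ S, u * p ∈ S) {u : connectedGroup 𝔤} (hu : u ∈ zariskiHull S) :
    u * p ∈ zariskiHull S := by
  intro f hf
  rw [toMatrix_mul, ← evalAt_rightTranslate]
  refine hu _ fun v hv ↦ ?_
  rw [evalAt_rightTranslate, ← toMatrix_mul]
  exact hf _ (hp v hv)

variable {P : Subgroup (connectedGroup 𝔤)} {T : Set (connectedGroup 𝔤)}

theorem mul_mem_saturation {u p : connectedGroup 𝔤} (hu : u ∈ T * (P : Set (connectedGroup 𝔤)))
    (hp : p ∈ P) : u * p ∈ T * (P : Set (connectedGroup 𝔤)) := by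
  obtain ⟨x, hx, q, hq, rfl⟩ := hu
  exact ⟨x, hx, q * p, P.mul_mem hq hp, (mul_assoc x q p).symm⟩

/-- The hull of the right `P`-stable set `T P` is again right `P`-stable, hence the full preimage of
a closed subset of `G/P`. This allows all further work to take place in `G`. -/
theorem coe_mem_zariskiClosure_iff (u : connectedGroup 𝔤) :
    (u : connectedGroup 𝔤 ⧸ P) ∈
        zariskiClosure ((fun u : connectedGroup 𝔤 ↦ (u : connectedGroup 𝔤 ⧸ P)) '' T) ↔
      u ∈ zariskiHull (T * (P : Set (connectedGroup 𝔤))) := by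
  constructor
  · intro h
    let C : Set (connectedGroup 𝔤 ⧸ P) :=
      (fun u : connectedGroup 𝔤 ↦ (u : connectedGroup 𝔤 ⧸ P)) ''
        zariskiHull (T * (P : Set (connectedGroup 𝔤)))
    have hC (v : connectedGroup 𝔤) :
        (v : connectedGroup 𝔤 ⧸ P) ∈ C ↔ v ∈ zariskiHull (T * (P : Set (connectedGroup 𝔤))) := by
      constructor
      · rintro ⟨x, hx, hxv⟩
        have := QuotientGroup.eq.1 hxv
        have h2 := mul_mem_zariskiHull (p := x⁻¹ * v) (fun y hy ↦ mul_mem_saturation hy this) hx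
        rwa [mul_inv_cancel_left] at h2
      · exact fun hv ↦ ⟨v, hv, rfl⟩
    refine (hC u).1 (h C
      ⟨⟨(vanishing (T * (P : Set (connectedGroup 𝔤))) : Set (MvPolynomial (n × n) ℂ)), hC⟩, ?_⟩)
    rintro _ ⟨x, hx, rfl⟩
    exact (hC x).2 (subset_zariskiHull _ ⟨x, hx, 1, P.one_mem, mul_one x⟩)
  · rintro h C ⟨⟨F, hF⟩, hT⟩
    rw [hF]
    intro f hf
    refine h f fun v hv ↦ ?_
    obtain ⟨x, hx, p, hp, rfl⟩ := hv
    refine (hF _).1 ?_ f hf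
    have : ((x * p : connectedGroup 𝔤) : connectedGroup 𝔤 ⧸ P) = x :=
      (QuotientGroup.eq.2 (by simpa using hp)).symm
    rw [this]
    exact hT ⟨x, hx, rfl⟩

theorem mem_stabilizer_zariskiClosure {g : connectedGroup 𝔤} :
    g ∈ MulAction.stabilizer (connectedGroup 𝔤)
        (zariskiClosure ((fun u : connectedGroup 𝔤 ↦ (u : connectedGroup 𝔤 ⧸ P)) '' T)) ↔
      ∀ u, u ∈ zariskiHull (T * (P : Set (connectedGroup 𝔤))) ↔
        g * u ∈ zariskiHull (T * (P : Set (connectedGroup 𝔤))) := by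
  simp only [← coe_mem_zariskiClosure_iff]
  rw [MulAction.mem_stabilizer_set]
  constructor
  · intro h u
    exact (h (u : connectedGroup 𝔤 ⧸ P)).symm
  · intro h x
    obtain ⟨u, rfl⟩ := QuotientGroup.mk_surjective x
    exact (h u).symm

/-- The infinitesimal symmetries of a subset of `G`. -/
def infinitesimalStabilizer (S : Set (connectedGroup 𝔤)) : LieSubalgebra ℂ 𝔤 where
  carrier := {A | ∀ f ∈ vanishing S, lieDeriv (A : Matrix n n ℂ) f ∈ vanishing S}
  add_mem' {A B} hA hB f hf := by
    rw [show ((A + B : 𝔤) : Matrix n n ℂ) = A + B from rfl, lieDeriv_add]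
    exact add_mem (hA f hf) (hB f hf)
  zero_mem' f _ := by
    have : lieDeriv (0 : Matrix n n ℂ) = 0 := by simpa using lieDeriv_smul 0 (0 : Matrix n n ℂ)
    rw [show ((0 : 𝔤) : Matrix n n ℂ) = 0 from rfl, this]
    exact zero_mem _
  smul_mem' c A hA f hf := by
    rw [show ((c • A : 𝔤) : Matrix n n ℂ) = c • (A : Matrix n n ℂ) from rfl, lieDeriv_smul]
    exact Submodule.smul_mem _ c (hA f hf)
  lie_mem' {A B} hA hB f hf := by
    rw [LieSubalgebra.coe_bracket, lieDeriv_lie]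
    exact sub_mem (hB _ (hA f hf)) (hA _ (hB f hf))

theorem expG_mul_mem_zariskiHull {S : Set (connectedGroup 𝔤)} {A : 𝔤}
    (hA : A ∈ infinitesimalStabilizer S) {u : connectedGroup 𝔤} (hu : u ∈ zariskiHull S) :
    expG A * u ∈ zariskiHull S := by
  intro f hf
  refine evalAt_exp_mul_eq_zero fun k ↦ hu _ ?_
  induction k with
  | zero => exact hf
  | succ k ih =>
    rw [Function.iterate_succ_apply']
    exact hA _ ih

theorem expG_mem_stabilizer {A : 𝔤}
    (hA : A ∈ infinitesimalStabilizer (T * (P : Set (connectedGroup 𝔤)))) :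
    expG A ∈ MulAction.stabilizer (connectedGroup 𝔤)
      (zariskiClosure ((fun u : connectedGroup 𝔤 ↦ (u : connectedGroup 𝔤 ⧸ P)) '' T)) := by
  rw [mem_stabilizer_zariskiClosure]
  refine fun u ↦ ⟨expG_mul_mem_zariskiHull hA, fun h ↦ ?_⟩
  have := expG_mul_mem_zariskiHull (neg_mem hA) h
  rwa [← inv_expG, inv_mul_cancel_left] at this

/-- Differentiating `f(exp(tA) u) = 0` at `t = 0` gives one inclusion. For the other, all iterated
derivatives of `f` along `A` vanish on the set, so the Taylor series integrates the condition. -/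
theorem lieAlgebraOf_stabilizer :
    lieAlgebraOf (MulAction.stabilizer (connectedGroup 𝔤)
      (zariskiClosure ((fun u : connectedGroup 𝔤 ↦ (u : connectedGroup 𝔤 ⧸ P)) '' T))) =
      infinitesimalStabilizer (T * (P : Set (connectedGroup 𝔤))) := by
  ext A
  constructor
  · intro h f hf u hu
    refine evalAt_lieDeriv_eq_zero fun t ↦ ?_
    obtain ⟨v, hv, hvA⟩ := h t
    rw [← hvA, ← toMatrix_mul]
    exact (mem_stabilizer_zariskiClosure.1 hv u).1 (subset_zariskiHull _ hu) f hf
  · intro h t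
    exact ⟨expG ((t : ℂ) • A), expG_mem_stabilizer
      ((infinitesimalStabilizer (T * (P : Set (connectedGroup 𝔤)))).smul_mem (t : ℂ) h), rfl⟩

/-- A group normalizes its Lie algebra, because `g exp(tX) g⁻¹ = exp(t Ad_g X)`. -/
theorem stabilizer_le_adNormalizer {𝔰 : LieSubalgebra ℂ 𝔤} {Q : Subgroup (connectedGroup 𝔤)}
    (h : lieAlgebraOf Q = (𝔰 : Set 𝔤)) : Q ≤ adNormalizer 𝔰.toSubmodule := by
  have key {g : connectedGroup 𝔤} (hg : g ∈ Q) {X : 𝔤} (hX : X ∈ 𝔰) : Ad g X ∈ 𝔰 := by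
    rw [← SetLike.mem_coe, ← h] at hX ⊢
    intro t
    obtain ⟨u, hu, huX⟩ := hX t
    have hu' : u = expG ((t : ℂ) • X) := toMatrix_injective huX
    refine ⟨g * u * g⁻¹, Q.mul_mem (Q.mul_mem hg hu) (Q.inv_mem hg), ?_⟩
    rw [hu', ← expG_Ad, map_smul]
    rfl
  intro g hg
  rw [mem_adNormalizer]
  refine fun X ↦ ⟨key hg, fun hX ↦ ?_⟩
  have := key (Q.inv_mem hg) hX
  rwa [Ad_inv_Ad] at this

end ZariskiHull

/-! ### Orthogonality of root spaces under the Killing form. -/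

section KillingPairing

open LieModule

variable {L : Type*} [LieRing L] [LieAlgebra ℂ L] [FiniteDimensional ℂ L] [IsKilling ℂ L]
  {H : LieSubalgebra ℂ L} [H.IsCartanSubalgebra]

theorem killingForm_comp (χ : Weight ℂ H L) (x y : L) :
    killingForm ℂ L (comp χ x) y = killingForm ℂ L x (comp (-χ) y) := by
  have key (ψ φ : Weight ℂ H L) (h : φ ≠ -ψ) :
      killingForm ℂ L (comp ψ x) (comp φ y) = 0 := by
    refine killingForm_apply_eq_zero_of_mem_rootSpace_of_add_ne_zero ℂ L H (comp_mem ψ x)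
      (comp_mem φ y) fun e ↦ h ?_
    apply DFunLike.coe_injective
    rw [Weight.coe_neg]
    exact (neg_eq_of_add_eq_zero_right e).symm
  conv_lhs => rw [← sum_comp (H := H) y]
  conv_rhs => rw [← sum_comp (H := H) x]
  rw [map_sum, map_sum, LinearMap.sum_apply, Finset.sum_eq_single (-χ), Finset.sum_eq_single χ]
  · exact fun ψ _ hψ ↦ key ψ _ fun e ↦ hψ (neg_injective e).symm
  · simp
  · exact fun φ _ hφ ↦ key χ φ hφ
  · simp

omit [FiniteDimensional ℂ L] in
theorem eq_zero_of_killingForm {x : L} (h : ∀ y, killingForm ℂ L x y = 0) : x = 0 :=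
  (IsKilling.killingForm_nondegenerate ℂ L).1 x h

omit [FiniteDimensional ℂ L] [IsKilling ℂ L] in
theorem killingForm_lie (x y z : L) : killingForm ℂ L ⁅x, y⁆ z = killingForm ℂ L x ⁅y, z⁆ :=
  traceForm_apply_lie_apply ℂ L L x y z

omit [FiniteDimensional ℂ L] [IsKilling ℂ L] in
theorem killingForm_comm (x y : L) : killingForm ℂ L x y = killingForm ℂ L y x :=
  LieModule.traceForm_comm ℂ L L x y

theorem value_neg {z : H} {v : Weight ℂ H L → ℤ} (hv : ∀ χ : Weight ℂ H L, χ z = v χ)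
    (χ : Weight ℂ H L) : v (-χ) = -v χ := by
  have h1 := hv (-χ)
  rw [Weight.coe_neg, Pi.neg_apply, hv χ] at h1
  exact_mod_cast h1.symm

/-- The Killing form is nondegenerate and pairs `𝔤_χ` only with `𝔤_{-χ}`. -/
theorem mem_weightSum_iff_killingForm {S T : Set (Weight ℂ H L)} (h : ∀ χ, -χ ∈ S ↔ χ ∉ T) {x : L} :
    x ∈ weightSum T ↔ ∀ y ∈ weightSum S, killingForm ℂ L x y = 0 := by
  constructor
  · intro hx y hy
    rw [← sum_comp (H := H) x, map_sum, LinearMap.sum_apply]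
    refine Finset.sum_eq_zero fun χ _ ↦ ?_
    by_cases hχ : χ ∈ T
    · rw [killingForm_comp, mem_weightSum.1 hy _ fun h' ↦ (h χ).1 h' hχ, map_zero]
    · rw [mem_weightSum.1 hx χ hχ, map_zero, LinearMap.zero_apply]
  · intro hx
    rw [mem_weightSum]
    intro χ hχ
    refine eq_zero_of_killingForm fun y ↦ ?_
    rw [killingForm_comp]
    exact hx _ (rootSpace_le_weightSum ((h χ).2 hχ) (comp_mem _ _))

end KillingPairing

/-! ### Matrix coefficients of `Ad` as polynomials. -/

section ConjugationPolynomials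

open NormedSpace MvPolynomial
open scoped Matrix.Norms.Operator

variable {n : Type*} [Fintype n] [DecidableEq n] {𝔤 : LieSubalgebra ℂ (Matrix n n ℂ)}

theorem evalAt_det (g : Matrix n n ℂ) : evalAt g (Matrix.mvPolynomialX n n ℂ).det = g.det := by
  rw [RingHom.map_det, Matrix.mvPolynomialX_mapMatrix_eval]

theorem adjugate_toMatrix (u : connectedGroup 𝔤) :
    (toMatrix u).adjugate = (toMatrix u).det • toMatrix u⁻¹ := by
  calc (toMatrix u).adjugate = (toMatrix u).adjugate * (toMatrix u * toMatrix u⁻¹) := by simp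
    _ = _ := by rw [← mul_assoc, Matrix.adjugate_mul, Matrix.smul_mul, one_mul]

/-- The functions `g ↦ det g · ℓ(Ad_g y)` are polynomials in the matrix entries. -/
theorem exists_conjPolynomial (l : Dual ℂ 𝔤) (y : 𝔤) : ∃ Q : MvPolynomial (n × n) ℂ,
    (∀ u : connectedGroup 𝔤, evalAt (toMatrix u) Q = (toMatrix u).det * l (Ad u y)) ∧
    (l y = 0 → ∀ A : 𝔤, evalAt 1 (lieDeriv (A : Matrix n n ℂ) Q) = l ⁅A, y⁆) := by
  obtain ⟨m, hm⟩ := LinearMap.exists_extend (p := 𝔤.toSubmodule) l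
  have hm' (x : 𝔤) : m x = l x := LinearMap.congr_fun hm x
  -- The adjugate stands in for the inverse matrix, which accounts for the factor `det g`.
  let N : Matrix n n (MvPolynomial (n × n) ℂ) :=
    Matrix.mvPolynomialX n n ℂ * (y : Matrix n n ℂ).map C * (Matrix.mvPolynomialX n n ℂ).adjugate
  let Q : MvPolynomial (n × n) ℂ := ∑ p, ∑ q, C (m (Matrix.single p q 1)) * N p q
  have hQ (u : connectedGroup 𝔤) : evalAt (toMatrix u) Q = (toMatrix u).det * l (Ad u y) := by
    have h1 : (evalAt (toMatrix u)).mapMatrix N =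
        toMatrix u * (y : Matrix n n ℂ) * (toMatrix u).adjugate := by
      rw [map_mul, map_mul, RingHom.map_adjugate, Matrix.mvPolynomialX_mapMatrix_eval]
      congr 2
      ext p q
      simp
    have h2 (p q : n) : evalAt (toMatrix u) (N p q) =
        (toMatrix u * (y : Matrix n n ℂ) * (toMatrix u).adjugate) p q := by
      rw [← h1]
      rfl
    simp only [Q, map_sum, map_mul, h2, eval_C]
    rw [← hm', coe_Ad, ← smul_eq_mul (toMatrix u).det, ← map_smul]
    rw [adjugate_toMatrix, Matrix.mul_smul]
    conv_rhs => rw [Matrix.matrix_eq_sum_single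
      ((toMatrix u).det • (toMatrix u * (y : Matrix n n ℂ) * toMatrix u⁻¹))]
    rw [map_sum]
    refine Finset.sum_congr rfl fun p _ ↦ ?_
    rw [map_sum]
    refine Finset.sum_congr rfl fun q _ ↦ ?_
    set c := ((toMatrix u).det • (toMatrix u * (y : Matrix n n ℂ) * toMatrix u⁻¹)) p q
    have : Matrix.single p q c = c • Matrix.single p q (1 : ℂ) := by
      rw [Matrix.smul_single, smul_eq_mul, mul_one]
    rw [this, map_smul, smul_eq_mul, mul_comm]
  refine ⟨Q, hQ, fun hy A ↦ ?_⟩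
  have h1 := hasDerivAt_evalAt (A : Matrix n n ℂ) 1 Q 0
  have h2 := hasDerivAt_evalAt (A : Matrix n n ℂ) 1 (Matrix.mvPolynomialX n n ℂ).det 0
  have h3 := (LinearMap.toContinuousLinearMap m).hasFDerivAt.comp_hasDerivAt (0 : ℂ)
    (hasDerivAt_exp_conj (A : Matrix n n ℂ) y 0)
  have h4 := h2.mul h3
  have h5 : (fun s : ℂ ↦ evalAt (exp (s • (A : Matrix n n ℂ)) * 1) Q) =
      (fun s : ℂ ↦ evalAt (exp (s • (A : Matrix n n ℂ)) * 1) (Matrix.mvPolynomialX n n ℂ).det) *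
        ((LinearMap.toContinuousLinearMap m) ∘ fun s : ℂ ↦ exp (s • (A : Matrix n n ℂ)) *
          (y : Matrix n n ℂ) * exp (-(s • (A : Matrix n n ℂ)))) := by
    funext s
    have := hQ (expG (s • A))
    rw [← hm'] at this
    rw [Pi.mul_apply, evalAt_det, mul_one]
    exact this
  rw [h5] at h1
  have h6 := h1.unique h4
  simp only [zero_smul, exp_zero, mul_one, one_mul, neg_zero, Function.comp_apply] at h6
  rw [h6, evalAt_det, Matrix.det_one, one_mul]
  -- Because `l y = 0`, the derivative of the determinant does not contribute at the identity.
  have e1 : (LinearMap.toContinuousLinearMap m) (y : Matrix n n ℂ) = 0 := (hm' y).trans hy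
  rw [e1, mul_zero, zero_add]
  exact hm' ⁅A, y⁆

theorem evalAt_lieDeriv_eq_zero_of_mem {S : Set (connectedGroup 𝔤)} {f : MvPolynomial (n × n) ℂ}
    (hf : f ∈ vanishing S) {A : 𝔤} {u : connectedGroup 𝔤}
    (h : ∀ t : ℝ, expG ((t : ℂ) • A) * u ∈ S) :
    evalAt (toMatrix u) (lieDeriv (A : Matrix n n ℂ) f) = 0 := by
  refine evalAt_lieDeriv_eq_zero fun t ↦ ?_
  have := mem_vanishing.1 hf _ (h t)
  rw [toMatrix_mul, toMatrix_expG] at this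
  exact this

end ConjugationPolynomials

/-! ### Tangency of `𝔤_w` to `N_w P`. -/

section Tangent

open LieModule NormedSpace MvPolynomial

variable {n : Type*} [Fintype n] [DecidableEq n] {𝔤 : LieSubalgebra ℂ (Matrix n n ℂ)}
  [IsKilling ℂ 𝔤] {H : LieSubalgebra ℂ 𝔤} [H.IsCartanSubalgebra] {b : (rootSystem H).Base}
  {i : b.support} (hi : IsCominuscule b i)

include hi

theorem mem_gradeOne_iff {x : 𝔤} : x ∈ weightSum {χ : Weight ℂ H 𝔤 | wcoeff b i χ = 1} ↔
    ∀ y ∈ weightSum {χ : Weight ℂ H 𝔤 | 0 ≤ wcoeff b i χ}, killingForm ℂ 𝔤 x y = 0 := by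
  refine mem_weightSum_iff_killingForm fun χ ↦ ?_
  have := wcoeff_cases hi χ
  simp only [Set.mem_ofPred_eq, value_neg (apply_dualElement b i) χ]
  omega

/-- `𝔤_1` is the Killing orthogonal of `𝔭`, and the Killing form is invariant under `Ad`. -/
theorem Ad_mem_gradeOne {p : connectedGroup 𝔤} (hp : p ∈ maximalParabolic b i) {x : 𝔤}
    (hx : x ∈ weightSum {χ : Weight ℂ H 𝔤 | wcoeff b i χ = 1}) :
    Ad p x ∈ weightSum {χ : Weight ℂ H 𝔤 | wcoeff b i χ = 1} := by
  rw [mem_gradeOne_iff hi] at hx ⊢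
  intro y hy
  rw [maximalParabolic, nonnegPart_gradingElement, mem_adNormalizer] at hp
  have := hx (Ad p⁻¹ y) ((hp _).2 (by rwa [Ad_Ad_inv]))
  rwa [← LieAlgebra.killingForm_of_equiv_apply (Ad p), Ad_Ad_inv] at this

omit hi in
theorem lie_gradingElement_gradeOne {x : 𝔤}
    (hx : x ∈ weightSum {χ : Weight ℂ H 𝔤 | wcoeff b i χ = 1}) : ⁅gradingElement b i, x⁆ = x := by
  rw [← gradedPiece_gradingElement, gradedPiece, End.mem_eigenspace_iff] at hx
  simpa using hx

variable {w : (rootSystem H).weylGroup} (hw : w ∈ hasseDiagram b i) {J : Finset b.support} {a : ℕ}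
  (hJ : IsRootMarking i w J a)

include hw hJ

theorem inversionSubspace_le_degree_neg :
    inversionSubspace b w ≤ weightSum {χ : Weight ℂ H 𝔤 | wcoeff b i χ = -1} := by
  rw [inversionSubspace_eq_weightSum]
  exact weightSum_mono fun χ hχ ↦ ((mem_inversionWeights_iff hi hw hJ).1 hχ).1

theorem lie_eq_zero_of_mem_inversionSubspace {X Y : 𝔤} (hX : X ∈ inversionSubspace b w)
    (hY : Y ∈ inversionSubspace b w) : ⁅X, Y⁆ = 0 := by
  have := lie_mem_weightSum (U := (∅ : Set (Weight ℂ H 𝔤))) (fun χ hχ ψ hψ ω hω ↦ ?_)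
    (inversionSubspace_le_degree_neg hi hw hJ hX) (inversionSubspace_le_degree_neg hi hw hJ hY)
  · rwa [weightSum_empty, Submodule.mem_bot] at this
  · have h := wcoeff_add b i hω
    have h2 := wcoeff_cases hi ω
    rw [Set.mem_ofPred_eq] at hχ hψ
    omega

theorem lie_gradingElement_inversionSubspace {X : 𝔤} (hX : X ∈ inversionSubspace b w) :
    ⁅X, gradingElement b i⁆ = X := by
  have hx := inversionSubspace_le_degree_neg hi hw hJ hX
  rw [← gradedPiece_gradingElement, gradedPiece, End.mem_eigenspace_iff] at hx
  rw [← lie_skew, ← ad_apply (R := ℂ), hx]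
  simp

omit hi hw hJ in
theorem expG_mem_maximalParabolic {Y : 𝔤} (hY : Y ∈ nonnegPart (gradingElement b i)) :
    expG Y ∈ maximalParabolic b i := by
  have hP : nonnegPart (gradingElement b i) = (nonnegSubalgebra (dualElement b i) (wcoeff b i)
      (apply_dualElement b i)).toSubmodule := nonnegPart_gradingElement b i
  rw [hP] at hY
  rw [maximalParabolic, hP]
  exact expG_mem_adNormalizer hY

/-- At `exp(X) p`, conjugation of `A ∈ 𝔤_w` by `exp(-X)` stays in `𝔤_w ⊆ 𝔫_w + 𝔭`. Since `𝔫_w` is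
abelian, this gives `A = X' + Ad(exp X) Y`: the first term moves the point along `N_w`, the second
along the fiber `exp(X) P`. -/
theorem schubertSubalgebra_le_infinitesimalStabilizer :
    schubertSubalgebra i J a ≤ infinitesimalStabilizer
      (expSet (inversionSubspace b w : Set 𝔤) * (maximalParabolic b i : Set (connectedGroup 𝔤))) := by
  rintro A hA f hf _ ⟨x, hx, p, hp, rfl⟩
  rw [expSet_eq] at hx
  obtain ⟨X, hX, rfl⟩ := hx
  have hN : inversionSubspace b w ≤ (schubertSubalgebra i J a).toSubmodule :=
    (schubertSubalgebra_isGreatest hi hw hJ).1.1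
  have hB : Ad (expG X)⁻¹ A ∈ schubertSubalgebra i J a := by
    rw [inv_expG]
    exact Ad_expG_mem (V := (schubertSubalgebra i J a).toSubmodule)
      (fun Z hZ ↦ LieSubalgebra.lie_mem _ (neg_mem (hN hX)) hZ) hA
  have hB' : Ad (expG X)⁻¹ A ∈ inversionSubspace b w ⊔ nonnegPart (gradingElement b i) := by
    rw [← (schubertSubalgebra_isGreatest hi hw hJ).1.2]
    exact Submodule.mem_sup_left hB
  obtain ⟨X', hX', Y, hY, hXY⟩ := Submodule.mem_sup.1 hB'
  have hA' : A = X' + Ad (expG X) Y := by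
    rw [← Ad_Ad_inv (expG X) A, ← hXY, map_add,
      Ad_expG_of_lie_eq_zero (lie_eq_zero_of_mem_inversionSubspace hi hw hJ hX hX')]
  rw [hA', show ((X' + Ad (expG X) Y : 𝔤) : Matrix n n ℂ) = X' + (Ad (expG X) Y : 𝔤) from rfl,
    lieDeriv_add, Derivation.add_apply, map_add]
  have e1 : evalAt (toMatrix (expG X * p)) (lieDeriv (X' : Matrix n n ℂ) f) = 0 := by
    refine evalAt_lieDeriv_eq_zero_of_mem hf fun t ↦ ?_
    have hX'' := (inversionSubspace b w).smul_mem (t : ℂ) hX'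
    rw [← mul_assoc, ← expG_add (lie_eq_zero_of_mem_inversionSubspace hi hw hJ hX'' hX), expSet_eq]
    exact Set.mul_mem_mul (Set.mem_image_of_mem _ ((inversionSubspace b w).add_mem hX'' hX)) hp
  have e2 : evalAt (toMatrix (expG X * p)) (lieDeriv ((Ad (expG X) Y : 𝔤) : Matrix n n ℂ) f) = 0 := by
    refine evalAt_lieDeriv_eq_zero_of_mem hf fun t ↦ ?_
    have e : expG ((t : ℂ) • Ad (expG X) Y) * (expG X * p) = expG X * (expG ((t : ℂ) • Y) * p) := by
      rw [← map_smul, expG_Ad]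
      group
    rw [e, expSet_eq]
    exact Set.mul_mem_mul (Set.mem_image_of_mem _ hX) ((maximalParabolic b i).mul_mem
      (expG_mem_maximalParabolic (Submodule.smul_mem _ (t : ℂ) hY)) hp)
  rw [e1, e2, add_zero]

/-- Moving `exp X` to the other side, `Ad(exp(-X)) Z_i` differs from `Z_i` by an element of `𝔫_w`,
and both are orthogonal to `y`. -/
theorem killingForm_Ad_expG_gradingElement {X y : 𝔤} (hX : X ∈ inversionSubspace b w)
    (hy : y ∈ weightSum {χ : Weight ℂ H 𝔤 | wcoeff b i χ = 1})
    (hyN : ∀ X ∈ inversionSubspace b w, killingForm ℂ 𝔤 X y = 0) :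
    killingForm ℂ 𝔤 (gradingElement b i) (Ad (expG X) y) = 0 := by
  have hX' := neg_mem hX
  rw [← LieAlgebra.killingForm_of_equiv_apply (Ad (expG X)⁻¹), Ad_inv_Ad, inv_expG]
  have h := Ad_expG_sub_mem (V := inversionSubspace b w) (X := -X) (Y := gradingElement b i)
    (fun Z hZ ↦ by
      rw [lie_eq_zero_of_mem_inversionSubspace hi hw hJ hX' hZ]
      exact zero_mem _)
    (by rwa [lie_gradingElement_inversionSubspace hi hw hJ hX'])
  have h1 := hyN _ h
  have h2 : killingForm ℂ 𝔤 (gradingElement b i) y = 0 := by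
    conv_lhs => rw [← lie_gradingElement_gradeOne hy]
    rw [← killingForm_lie, lie_self, map_zero, LinearMap.zero_apply]
  rwa [map_sub, LinearMap.sub_apply, h2, sub_zero] at h1

end Tangent

/-! ### Equations of `N_w P` and the Lie algebra of the stabilizer. -/

section StabilizerLieAlgebra

open LieModule NormedSpace MvPolynomial

variable {n : Type*} [Fintype n] [DecidableEq n] {𝔤 : LieSubalgebra ℂ (Matrix n n ℂ)}
  [IsKilling ℂ 𝔤] {H : LieSubalgebra ℂ 𝔤} [H.IsCartanSubalgebra] {b : (rootSystem H).Base}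
  {i : b.support} (hi : IsCominuscule b i)
  {w : (rootSystem H).weylGroup} (hw : w ∈ hasseDiagram b i) {J : Finset b.support} {a : ℕ}
  (hJ : IsRootMarking i w J a)

theorem isCompl_weightSum {L : Type*} [LieRing L] [LieAlgebra ℂ L] [FiniteDimensional ℂ L]
    [IsKilling ℂ L] {H : LieSubalgebra ℂ L} [H.IsCartanSubalgebra] (S : Set (Weight ℂ H L)) :
    IsCompl (weightSum S) (weightSum Sᶜ) := by
  constructor
  · rw [disjoint_iff, weightSum_inf, Set.inter_compl_self, weightSum_empty]
  · rw [codisjoint_iff, weightSum_sup, Set.union_compl_self, weightSum_univ]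

omit [Fintype n] [DecidableEq n] in
/-- The value of `ζ · adj M` at a point, for matrices of polynomials. -/
theorem evalAt_dotProduct_adjugate {ι : Type*} [Fintype ι] [DecidableEq ι]
    (z : ι → MvPolynomial (n × n) ℂ) (M : Matrix ι ι (MvPolynomial (n × n) ℂ)) (c : ι → ℂ)
    (g : Matrix n n ℂ) :
    evalAt g (∑ j, z j * ∑ k, M.adjugate j k * C (c k)) =
      (fun j ↦ evalAt g (z j)) ⬝ᵥ ((M.map (evalAt g)).adjugate.mulVec c) := by
  have h : (M.map (evalAt g)).adjugate = M.adjugate.map (evalAt g) :=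
    (RingHom.map_adjugate (evalAt g) M).symm
  rw [h]
  simp [dotProduct, Matrix.mulVec]

include hi hw hJ

/-- On `g = exp(X) p` the function `κ(Z_i, Ad(exp X) y)` vanishes, and formally its derivative at
`1` along `A` is `κ(Z_i, [A, y]) = -κ(A, y)`. To express it as a polynomial in `g`, one undoes the
action of `p` on `𝔤_1`: the matrix of that action is read off from the `𝔤_1`-coordinates of `Ad_g`,
and an adjugate replaces its inverse. The polynomial is `Qz · adj M · c`, with `c` the coordinates
of `y`. -/
theorem killingForm_eq_zero_of_mem_infinitesimalStabilizer {A : 𝔤}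
    (hA : A ∈ infinitesimalStabilizer
      (expSet (inversionSubspace b w : Set 𝔤) * (maximalParabolic b i : Set (connectedGroup 𝔤))))
    {y : 𝔤} (hy : y ∈ weightSum {χ : Weight ℂ H 𝔤 | wcoeff b i χ = 1})
    (hyN : ∀ X ∈ inversionSubspace b w, killingForm ℂ 𝔤 X y = 0) : killingForm ℂ 𝔤 A y = 0 := by
  set V := weightSum {χ : Weight ℂ H 𝔤 | wcoeff b i χ = 1} with hVdef
  set V' := weightSum {χ : Weight ℂ H 𝔤 | wcoeff b i χ = 1}ᶜ with hV'def
  have hc : IsCompl V V' := isCompl_weightSum _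
  let v := Module.finBasis ℂ V
  let l (k : Fin (finrank ℂ V)) : Dual ℂ 𝔤 := v.coord k ∘ₗ V.projectionOnto V' hc
  let ζ : Dual ℂ 𝔤 := killingForm ℂ 𝔤 (gradingElement b i)
  have hlV (k) (x : V) : l k x = v.repr x k := by
    simp [l, Submodule.projectionOnto_apply_left]
  have hlV' (k) {x : 𝔤} (hx : x ∈ V') : l k x = 0 := by
    simp [l, (Submodule.projectionOnto_apply_eq_zero_iff hc).2 hx]
  have hζV {x : 𝔤} (hx : x ∈ V) : ζ x = 0 := by
    change killingForm ℂ 𝔤 (gradingElement b i) x = 0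
    conv_lhs => rw [← lie_gradingElement_gradeOne hx]
    rw [← killingForm_lie, lie_self, map_zero, LinearMap.zero_apply]
  choose Qm hQm _ using fun k j ↦ exists_conjPolynomial (l k) (v j : 𝔤)
  choose Qz hQz hQz' using fun j ↦ exists_conjPolynomial ζ (v j : 𝔤)
  let c : Fin (finrank ℂ V) → ℂ := fun k ↦ v.repr ⟨y, hy⟩ k
  have hyc : y = ∑ k, c k • (v k : 𝔤) := by
    have := congrArg Subtype.val (v.sum_repr ⟨y, hy⟩)
    rw [Submodule.coe_sum] at this
    exact this.symm
  let M : Matrix (Fin (finrank ℂ V)) (Fin (finrank ℂ V)) (MvPolynomial (n × n) ℂ) := Matrix.of Qm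
  have hf : ∑ j, Qz j * ∑ k, M.adjugate j k * C (c k) ∈ vanishing
      (expSet (inversionSubspace b w : Set 𝔤) *
        (maximalParabolic b i : Set (connectedGroup 𝔤))) := by
    rintro _ ⟨x, hx, p, hp, rfl⟩
    rw [expSet_eq] at hx
    obtain ⟨X, hX, rfl⟩ := hx
    have hp' (j) : Ad p (v j) ∈ V := Ad_mem_gradeOne hi hp (v j).2
    -- `X` has degree `-1`, so `exp X` changes an element of `𝔤_1` only by components of degree
    -- other than `1`. Hence `M` sees only `p`.
    have hlX (k) (x : V) : l k (Ad (expG X) x) = l k x := by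
      have hX1 := inversionSubspace_le_degree_neg hi hw hJ hX
      have : Ad (expG X) (x : 𝔤) - x ∈ V' := by
        refine Ad_expG_sub_mem (fun Z hZ ↦ ?_) ?_
        · refine lie_mem_weightSum (fun χ hχ ψ hψ ω hω ↦ ?_) hX1 hZ
          have h1 := wcoeff_cases hi ψ
          have h2 := wcoeff_add b i hω
          rw [Set.mem_compl_iff, Set.mem_ofPred_eq] at hψ ⊢
          rw [Set.mem_ofPred_eq] at hχ
          omega
        · refine lie_mem_weightSum (fun χ hχ ψ hψ ω hω ↦ ?_) hX1 x.2
          have h2 := wcoeff_add b i hω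
          rw [Set.mem_compl_iff, Set.mem_ofPred_eq]
          rw [Set.mem_ofPred_eq] at hχ hψ
          omega
      have h3 := hlV' k this
      rwa [map_sub, sub_eq_zero] at h3
    let m : Matrix (Fin (finrank ℂ V)) (Fin (finrank ℂ V)) ℂ := Matrix.of fun k j ↦ l k (Ad p (v j))
    set d := (toMatrix (expG X * p)).det with hd
    have hM : M.map (evalAt (toMatrix (expG X * p))) = d • m := by
      ext k j
      rw [Matrix.map_apply, Matrix.smul_apply, smul_eq_mul]
      change evalAt _ (Qm k j) = d * l k (Ad p (v j))
      rw [hQm, Ad_mul]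
      congr 1
      exact hlX k ⟨_, hp' j⟩
    have hexp (j) : Ad p (v j) = ∑ k, m k j • (v k : 𝔤) := by
      have := congrArg Subtype.val (v.sum_repr ⟨_, hp' j⟩)
      rw [← show ((⟨Ad p (v j), hp' j⟩ : V) : 𝔤) = Ad p (v j) from rfl, ← this]
      simp only [Submodule.coe_sum, Submodule.coe_smul]
      refine Finset.sum_congr rfl fun k _ ↦ ?_
      rw [← hlV k ⟨Ad p (v j), hp' j⟩]
      rfl
    let r : Fin (finrank ℂ V) → ℂ := fun k ↦ ζ (Ad (expG X) (v k))
    have hz : (fun j ↦ evalAt (toMatrix (expG X * p)) (Qz j)) = Matrix.vecMul r (d • m) := by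
      funext j
      rw [hQz, Ad_mul, hexp, map_sum, map_sum, Finset.mul_sum]
      refine Finset.sum_congr rfl fun k _ ↦ ?_
      rw [map_smul, map_smul]
      change d * (m k j * r k) = r k * (d * m k j)
      ring
    have hr : r ⬝ᵥ c = 0 := by
      have h := killingForm_Ad_expG_gradingElement hi hw hJ hX hy hyN
      change ζ (Ad (expG X) y) = 0 at h
      rw [← h, hyc, map_sum, map_sum]
      refine Finset.sum_congr rfl fun k _ ↦ ?_
      rw [map_smul, map_smul, smul_eq_mul, mul_comm]
    -- The value is `r · (d m) adj(d m) c = det(d m) (r · c)`, and `r · c = κ(Z_i, Ad(exp X) y) =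
    -- 0`.
    rw [evalAt_dotProduct_adjugate, hM, hz, ← Matrix.dotProduct_mulVec, Matrix.mulVec_mulVec,
      Matrix.mul_adjugate, Matrix.smul_mulVec, Matrix.one_mulVec, dotProduct_smul, hr, smul_zero]
  have h1 : evalAt 1 (lieDeriv (A : Matrix n n ℂ)
      (∑ j, Qz j * ∑ k, M.adjugate j k * C (c k))) = 0 := by
    refine hA _ hf 1 ?_
    refine ⟨1, ?_, 1, Subgroup.one_mem _, mul_one 1⟩
    rw [expSet_eq]
    exact ⟨0, zero_mem (inversionSubspace b w), expG_zero⟩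
  have hM1 : M.map (evalAt 1) = 1 := by
    ext k j
    have h2 := hQm k j 1
    rw [toMatrix_one, Matrix.det_one, one_mul, Ad_one, hlV, v.repr_self] at h2
    rw [Matrix.map_apply]
    change evalAt 1 (Qm k j) = _
    rw [h2, Matrix.one_apply, Finsupp.single_apply]
    simp only [eq_comm]
  have hR (j) : evalAt 1 (∑ k, M.adjugate j k * C (c k)) = c j := by
    have h : (M.map (evalAt 1)).adjugate = M.adjugate.map (evalAt 1) :=
      (RingHom.map_adjugate (evalAt 1) M).symm
    rw [hM1, Matrix.adjugate_one] at h
    have h' (k) : evalAt 1 (M.adjugate j k) = (1 : Matrix _ _ ℂ) j k := by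
      rw [h]
      rfl
    simp only [map_sum, map_mul, h', eval_C, Matrix.one_apply, ite_mul, one_mul, zero_mul,
      Finset.sum_ite_eq, Finset.mem_univ, if_true]
  have hz1 (j) : evalAt 1 (Qz j) = 0 := by
    have h2 := hQz j 1
    rwa [toMatrix_one, Ad_one, hζV (v j).2, mul_zero] at h2
  -- At `1` the row `Qz` vanishes and `adj M` is the identity, so only the derivative of `Qz`
  -- survives in the product rule.
  have h2 : evalAt 1 (lieDeriv (A : Matrix n n ℂ)
      (∑ j, Qz j * ∑ k, M.adjugate j k * C (c k))) = ζ ⁅A, y⁆ := by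
    rw [map_sum, map_sum, hyc, lie_sum, map_sum]
    refine Finset.sum_congr rfl fun j _ ↦ ?_
    rw [Derivation.leibniz, map_add, smul_eq_mul, smul_eq_mul, map_mul, map_mul, hz1, zero_mul,
      zero_add, hR, hQz' j (hζV (v j).2), lie_smul, map_smul, smul_eq_mul]
  rw [h1] at h2
  have h3 : ζ ⁅A, y⁆ = -killingForm ℂ 𝔤 A y := by
    change killingForm ℂ 𝔤 (gradingElement b i) ⁅A, y⁆ = _
    rw [← lie_skew, map_neg, ← killingForm_lie, lie_gradingElement_gradeOne hy, killingForm_comm]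
  rw [h3] at h2
  exact neg_eq_zero.1 h2.symm

/-- A root component of `A` outside `𝔫_w + 𝔭` is tested by `κ` against the opposite root space,
which lies in `𝔤_1` and is orthogonal to `𝔫_w`; so it vanishes. The infinitesimal stabilizer thus
competes in the maximality of `𝔤_w`. -/
theorem infinitesimalStabilizer_eq :
    infinitesimalStabilizer (expSet (inversionSubspace b w : Set 𝔤) *
      (maximalParabolic b i : Set (connectedGroup 𝔤))) = schubertSubalgebra i J a := by
  have hle := schubertSubalgebra_le_infinitesimalStabilizer hi hw hJ
  have hgr := schubertSubalgebra_isGreatest hi hw hJ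
  refine le_antisymm (hgr.2 ⟨hgr.1.1.trans hle, le_antisymm ?_ ?_⟩) hle
  · refine sup_le (fun A hA ↦ ?_) le_sup_right
    rw [inversionSubspace_eq_weightSum, nonnegPart_gradingElement, weightSum_sup, mem_weightSum]
    intro χ hχ
    rw [Set.mem_union, not_or, Set.mem_ofPred_eq] at hχ
    have hcase := wcoeff_cases hi χ
    refine eq_zero_of_killingForm fun x ↦ ?_
    rw [killingForm_comp]
    refine killingForm_eq_zero_of_mem_infinitesimalStabilizer hi hw hJ hA
      (rootSpace_le_weightSum ?_ (comp_mem _ _)) fun X hX ↦ ?_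
    · rw [Set.mem_ofPred_eq, value_neg (apply_dualElement b i) χ]
      omega
    · rw [← killingForm_comp]
      rw [inversionSubspace_eq_weightSum] at hX
      rw [mem_weightSum.1 hX χ hχ.1, map_zero, LinearMap.zero_apply]
  · exact sup_le_sup_right (hgr.1.1.trans hle) _

theorem lieAlgebraOf_stabilizer_schubertVariety :
    lieAlgebraOf (MulAction.stabilizer (connectedGroup 𝔤) (schubertVariety b i w)) =
      (schubertSubalgebra i J a : Set 𝔤) := by
  rw [schubertVariety, lieAlgebraOf_stabilizer, infinitesimalStabilizer_eq hi hw hJ]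

theorem stabilizer_schubertVariety_le_adNormalizer :
    MulAction.stabilizer (connectedGroup 𝔤) (schubertVariety b i w) ≤
      adNormalizer (schubertSubalgebra i J a).toSubmodule :=
  stabilizer_le_adNormalizer (lieAlgebraOf_stabilizer_schubertVariety hi hw hJ)

theorem closure_expSet_le_stabilizer_schubertVariety :
    Subgroup.closure (expSet (schubertSubalgebra i J a : Set 𝔤)) ≤
      MulAction.stabilizer (connectedGroup 𝔤) (schubertVariety b i w) := by
  rw [Subgroup.closure_le, expSet_eq]
  rintro _ ⟨A, hA, rfl⟩
  refine expG_mem_stabilizer ?_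
  rwa [infinitesimalStabilizer_eq hi hw hJ]

end StabilizerLieAlgebra

/-! ### Canonical coordinates of the second kind, through an ordinary differential equation. -/

section LocalFactorization

open NormedSpace Filter Topology Metric
open scoped NNReal

set_option linter.unusedSectionVars false

/-- The Picard–Lindelöf solution together with the fact that it stays in the ball, where the vector
field is controlled. -/
theorem exists_integralCurve_mem_closedBall {E : Type*} [NormedAddCommGroup E] [NormedSpace ℝ E]
    [CompleteSpace E] {f : ℝ → E → E} {tmin tmax : ℝ} {t₀ : Set.Icc tmin tmax} {x₀ x : E}
    {a r L K : ℝ≥0} (hf : IsPicardLindelof f t₀ x₀ a r L K) (hx : x ∈ closedBall x₀ r) :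
    ∃ α : ℝ → E, α t₀ = x ∧ (∀ t, α t ∈ closedBall x₀ a) ∧
      ∀ t ∈ Set.Icc tmin tmax, HasDerivWithinAt α (f t (α t)) (Set.Icc tmin tmax) t := by
  obtain ⟨α, hα⟩ := ODE.FunSpace.exists_isFixedPt_next hf hx
  refine ⟨α.compProj, by rw [ODE.FunSpace.compProj_val, ← hα, ODE.FunSpace.next_apply₀],
    fun t ↦ α.compProj_mem_closedBall hf.mul_max_le, fun t ht ↦ ?_⟩
  apply ODE.hasDerivWithinAt_picard_Icc t₀.2 hf.continuousOn_uncurry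
    α.continuous_compProj.continuousOn (fun _ ht' ↦ α.compProj_mem_closedBall hf.mul_max_le)
    x ht |>.congr_of_mem _ ht
  intro t' ht'
  nth_rw 1 [← hα]
  rw [ODE.FunSpace.compProj_of_mem ht', ODE.FunSpace.next_apply]

variable {A : Type*} [NormedRing A] [NormedAlgebra ℂ A] [NormedAlgebra ℚ A] [CompleteSpace A]
  {ι : Type*} (e : ι → A)

/-- The ordered product of the `exp (x_j e_j)`. -/
def wordExp (l : List ι) (x : ι → ℂ) : A :=
  (l.map fun j ↦ exp (x j • e j)).prod

theorem wordExp_cons (j : ι) (l : List ι) (x : ι → ℂ) :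
    wordExp e (j :: l) x = exp (x j • e j) * wordExp e l x := by
  simp [wordExp]

/-- The logarithmic derivative of `wordExp`. -/
def wordDeriv [Fintype ι] : List ι → (ι → ℂ) → (ι → ℂ) →L[ℂ] A
  | [], _ => 0
  | j :: l, x => (ContinuousLinearMap.proj j).smulRight (e j) +
      (ContinuousLinearMap.mulLeftRight ℂ A (exp (x j • e j)) (exp (-(x j • e j)))).comp
        (wordDeriv l x)

variable [Fintype ι]

theorem wordDeriv_cons_apply (j : ι) (l : List ι) (x c : ι → ℂ) :
    wordDeriv e (j :: l) x c = c j • e j +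
      exp (x j • e j) * wordDeriv e l x c * exp (-(x j • e j)) := rfl

theorem contDiff_wordDeriv (l : List ι) : ContDiff ℂ 1 (wordDeriv e l) := by
  have hexp : ContDiff ℂ 1 (exp : A → A) := AnalyticOnNhd.contDiff fun x _ ↦ exp_analytic x
  induction l with
  | nil => exact contDiff_const
  | cons j l ih =>
    have h1 : ContDiff ℂ 1 fun x : ι → ℂ ↦ x j • e j :=
      (contDiff_apply ℂ ℂ j).smul contDiff_const
    have h2 : ContDiff ℂ 1 fun x : ι → ℂ ↦ ContinuousLinearMap.mulLeftRight ℂ A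
        (exp (x j • e j)) (exp (-(x j • e j))) :=
      ((ContinuousLinearMap.contDiff _).comp (hexp.comp h1)).clm_apply (hexp.comp h1.neg)
    exact contDiff_const.add (h2.clm_comp ih)

theorem wordDeriv_mem {V : Submodule ℂ A} (he : ∀ j, e j ∈ V)
    (hV : ∀ j (s : ℂ), ∀ v ∈ V, exp (s • e j) * v * exp (-(s • e j)) ∈ V) (l : List ι)
    (x c : ι → ℂ) : wordDeriv e l x c ∈ V := by
  induction l with
  | nil => exact zero_mem V
  | cons j l ih =>
    rw [wordDeriv_cons_apply]
    exact add_mem (V.smul_mem _ (he j)) (hV j _ _ ih)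

theorem wordDeriv_zero (l : List ι) (c : ι → ℂ) :
    wordDeriv e l 0 c = (l.map fun j ↦ c j • e j).sum := by
  induction l with
  | nil => rfl
  | cons j l ih =>
    rw [wordDeriv_cons_apply, ih]
    simp

theorem exp_neg_mul_exp_self (x : A) : exp (-x) * exp x = 1 := by
  rw [← exp_add_of_commute (Commute.refl x).neg_left, neg_add_cancel, exp_zero]

theorem exp_mul_exp_neg_self (x : A) : exp x * exp (-x) = 1 := by
  rw [← exp_add_of_commute (Commute.refl x).neg_right, add_neg_cancel, exp_zero]

theorem hasDerivWithinAt_wordExp (l : List ι) {x : ℝ → ι → ℂ} {x' : ι → ℂ} {s : Set ℝ} {t : ℝ}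
    (hx : HasDerivWithinAt x x' s t) :
    HasDerivWithinAt (fun t ↦ wordExp e l (x t))
      (wordDeriv e l (x t) x' * wordExp e l (x t)) s t := by
  induction l with
  | nil =>
    have : wordDeriv e [] (x t) x' = 0 := rfl
    rw [this, zero_mul]
    exact hasDerivWithinAt_const t s (1 : A)
  | cons j l ih =>
    have h1 : HasDerivWithinAt (fun t ↦ x t j) (x' j) s t := hasDerivWithinAt_pi.1 hx j
    have h2 := (hasDerivAt_exp_smul_const' (e j) (x t j)).scomp_hasDerivWithinAt t h1
    have h3 := h2.mul ih
    simp only [wordExp_cons, wordDeriv_cons_apply]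
    convert! h3 using 1
    have h4 := exp_neg_mul_exp_self (x t j • e j)
    simp only [add_mul, mul_assoc, smul_mul_assoc, Function.comp_apply]
    rw [← mul_assoc (exp (-(x t j • e j))), h4, one_mul]

/-- Products of exponentials along a basis of a Lie algebra absorb small exponentials. -/
theorem eventually_exp_mul_wordExp {V : Submodule ℂ A} (he : ∀ j, e j ∈ V)
    (hV : ∀ j (s : ℂ), ∀ v ∈ V, exp (s • e j) * v * exp (-(s • e j)) ∈ V) (l : List ι)
    (p : A →L[ℂ] (ι → ℂ)) (hp : ∀ v ∈ V, p v = 0 → v = 0)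
    (hpl : ∀ c : ι → ℂ, p (l.map fun j ↦ c j • e j).sum = c) {B : A} (hB : B ∈ V)
    {U : Set (ι → ℂ)} (hU : U ∈ 𝓝 0) :
    ∀ᶠ q : ℂ × (ι → ℂ) in 𝓝 0, ∃ x' ∈ U, exp (q.1 • B) * wordExp e l q.2 = wordExp e l x' := by
  let m : (ι → ℂ) → (ι → ℂ) →L[ℂ] (ι → ℂ) := fun x ↦ p.comp (wordDeriv e l x)
  have hm : ContDiff ℂ 1 m := contDiff_const.clm_comp (contDiff_wordDeriv e l)
  have hm0 : m 0 = 1 := by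
    ext1 c
    change p (wordDeriv e l 0 c) = c
    rw [wordDeriv_zero, hpl]
  -- Near `0`, `v x` is the coordinate velocity for which `wordExp` has logarithmic derivative `B`;
  -- it exists because `m 0` is the identity.
  let v : (ι → ℂ) → (ι → ℂ) := fun x ↦ Ring.inverse (m x) (p B)
  have hv : ContDiffAt ℂ 1 v 0 := by
    have h0 : ContDiffAt ℂ 1 (Ring.inverse : ((ι → ℂ) →L[ℂ] (ι → ℂ)) → _) (m 0) := by
      rw [hm0]
      exact contDiffAt_ringInverse ℂ (1 : ((ι → ℂ) →L[ℂ] (ι → ℂ))ˣ)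
    exact (h0.comp (0 : ι → ℂ) hm.contDiffAt).clm_apply contDiffAt_const
  have hunit : ∀ᶠ x in 𝓝 (0 : ι → ℂ), IsUnit (m x) := by
    have : {y : (ι → ℂ) →L[ℂ] (ι → ℂ) | IsUnit y} ∈ 𝓝 (m 0) := by
      rw [hm0]
      exact Units.isOpen.mem_nhds isUnit_one
    exact hm.continuous.continuousAt this
  obtain ⟨K, t, ht, hK⟩ := hv.exists_lipschitzOnWith
  have hbd : ∀ᶠ x in 𝓝 (0 : ι → ℂ), ‖v x‖ < ‖v 0‖ + 1 :=
    (hv.continuousAt.norm).eventually_lt_const (by linarith)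
  obtain ⟨a, ha, hball⟩ := Metric.nhds_basis_closedBall.mem_iff.1
    (inter_mem (inter_mem hU ht) (inter_mem hunit hbd))
  -- Starting within `a / 2` of the origin and moving at speed at most `a / 2`, the solution remains
  -- in the ball of radius `a` up to time `1`.
  have hq : ∀ᶠ q : ℂ × (ι → ℂ) in 𝓝 0, ‖q.1‖ * (‖v 0‖ + 1) < a / 2 ∧ ‖q.2‖ < a / 2 := by
    refine Filter.Eventually.and ?_ ?_
    · have : ContinuousAt (fun q : ℂ × (ι → ℂ) ↦ ‖q.1‖ * (‖v 0‖ + 1)) 0 := by fun_prop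
      exact this.eventually_lt_const (by simpa using ha)
    · have : ContinuousAt (fun q : ℂ × (ι → ℂ) ↦ ‖q.2‖) 0 := by fun_prop
      exact this.eventually_lt_const (by simpa using ha)
  filter_upwards [hq] with q ⟨hq1, hq2⟩
  let f : ℝ → (ι → ℂ) → (ι → ℂ) := fun _ x ↦ q.1 • v x
  have hPL : IsPicardLindelof f (⟨0, by simp⟩ : Set.Icc (0 : ℝ) 1) 0 ⟨a, ha.le⟩ ⟨a / 2, by positivity⟩
      ⟨a / 2, by positivity⟩ (‖q.1‖₊ * K) := by
    refine ⟨fun _ _ ↦ ?_, fun x _ ↦ continuousOn_const, fun _ _ x hx ↦ ?_, ?_⟩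
    · have h1 : LipschitzOnWith K v (closedBall 0 a) := hK.mono fun x hx ↦ (hball hx).1.2
      refine LipschitzOnWith.of_dist_le_mul fun x hx y hy ↦ ?_
      have := h1.dist_le_mul x hx y hy
      rw [dist_smul₀]
      push_cast
      rw [mul_assoc]
      exact mul_le_mul_of_nonneg_left this (norm_nonneg _)
    · have h1 : ‖v x‖ < ‖v 0‖ + 1 := (hball hx).2.2
      change ‖q.1 • v x‖ ≤ a / 2
      rw [norm_smul]
      exact (mul_le_mul_of_nonneg_left h1.le (norm_nonneg _)).trans hq1.le
    · change a / 2 * max (1 - 0) (0 - 0) ≤ a - a / 2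
      norm_num
      linarith
  obtain ⟨α, hα0, hαmem, hα⟩ := exists_integralCurve_mem_closedBall hPL (x := q.2) (by
    rw [mem_closedBall_zero_iff]
    exact hq2.le)
  change α 0 = q.2 at hα0
  have hsol (x : ι → ℂ) (hx : x ∈ closedBall 0 a) : wordDeriv e l x (v x) = B := by
    have hu : IsUnit (m x) := (hball hx).2.1
    have h1 : p (wordDeriv e l x (v x)) = p B := by
      change (m x) (Ring.inverse (m x) (p B)) = p B
      have := Ring.mul_inverse_cancel (m x) hu
      rw [← mul_apply_eq_comp, this, one_apply_eq_self]
    have h2 := hp _ (sub_mem (wordDeriv_mem e he hV l x (v x)) hB) (by rw [map_sub, h1, sub_self])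
    exact sub_eq_zero.1 h2
  -- Along the solution `wordExp` evolves by left multiplication with `exp(t q.1 B)`, so this
  -- product is constant; comparing times `0` and `1` gives the factorization.
  have hconst : ∀ t ∈ Set.Icc (0 : ℝ) 1,
      HasDerivWithinAt (fun t : ℝ ↦ exp (-((t * q.1 : ℂ) • B)) * wordExp e l (α t)) 0
        (Set.Icc (0 : ℝ) 1) t := by
    intro t ht
    have h1 := hasDerivWithinAt_wordExp e l (hα t ht)
    have h2 : HasDerivWithinAt (fun t : ℝ ↦ (t * q.1 : ℂ)) q.1 (Set.Icc (0 : ℝ) 1) t := by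
      have := ((Complex.ofRealCLM.hasDerivAt (x := t)).mul_const q.1).hasDerivWithinAt
        (s := Set.Icc (0 : ℝ) 1)
      simpa using this
    have h3 : HasDerivAt (fun s : ℂ ↦ exp (-(s • B))) (-(exp (-((t * q.1 : ℂ) • B)) * B))
        (t * q.1 : ℂ) := by
      have := hasDerivAt_exp_smul_const (-B) (t * q.1 : ℂ)
      simp only [smul_neg, mul_neg] at this
      exact this
    have h4 := (h3.scomp_hasDerivWithinAt t h2).mul h1
    convert! h4 using 1
    change 0 = (q.1 • -(exp (-((t * q.1 : ℂ) • B)) * B)) * wordExp e l (α t) +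
      exp (-((t * q.1 : ℂ) • B)) * (wordDeriv e l (α t) (q.1 • v (α t)) * wordExp e l (α t))
    rw [map_smul, hsol _ (hαmem t)]
    simp [mul_assoc]
  have hend := constant_of_has_deriv_right_zero
    (fun t ht ↦ (hconst t ht).continuousWithinAt)
    (fun t ht ↦ (hconst t ⟨ht.1, ht.2.le⟩).mono_of_mem_nhdsWithin
      (Icc_mem_nhdsGE_of_mem ht)) 1 (Set.right_mem_Icc.2 zero_le_one)
  refine ⟨α 1, (hball (hαmem 1)).1.1, ?_⟩
  simp only [Complex.ofReal_one, one_mul, Complex.ofReal_zero, zero_mul, zero_smul, neg_zero,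
    exp_zero, hα0] at hend
  rw [← hend, ← mul_assoc, exp_mul_exp_neg_self, one_mul]

end LocalFactorization

/-! ### The unipotent group `exp 𝔤_{<0}` and the normalizer of `𝔤_{≥0}`. -/

section ParabolicDecomposition

open LieModule NormedSpace Filter Topology

variable {n : Type*} [Fintype n] [DecidableEq n] {𝔤 : LieSubalgebra ℂ (Matrix n n ℂ)}

/-- The subgroup generated by the exponentials of a subspace. -/
def expSubgroup (V : Submodule ℂ 𝔤) : Subgroup (connectedGroup 𝔤) :=
  Subgroup.closure (expSet (V : Set 𝔤))

theorem expG_mem_expSubgroup {V : Submodule ℂ 𝔤} {X : 𝔤} (hX : X ∈ V) : expG X ∈ expSubgroup V :=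
  Subgroup.subset_closure (by rw [expSet_eq]; exact ⟨X, hX, rfl⟩)

theorem expSubgroup_induction {V : Submodule ℂ 𝔤} {p : connectedGroup 𝔤 → Prop} (h1 : p 1)
    (hmul : ∀ X ∈ V, ∀ u, p u → p (expG X * u)) {u : connectedGroup 𝔤} (hu : u ∈ expSubgroup V) :
    p u := by
  rw [expSubgroup, expSet_eq] at hu
  induction hu using Subgroup.closure_induction_left with
  | one => exact h1
  | mul_left x hx y hy ih =>
    obtain ⟨X, hX, rfl⟩ := hx
    exact hmul X hX _ ih
  | inv_mul_cancel x hx y hy ih =>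
    obtain ⟨X, hX, rfl⟩ := hx
    rw [inv_expG]
    exact hmul (-X) (V.neg_mem hX) _ ih

theorem expSubgroup_le_adNormalizer (𝔮 : LieSubalgebra ℂ 𝔤) :
    expSubgroup 𝔮.toSubmodule ≤ adNormalizer 𝔮.toSubmodule := by
  rw [expSubgroup, Subgroup.closure_le, expSet_eq]
  rintro _ ⟨X, hX, rfl⟩
  exact expG_mem_adNormalizer hX

theorem exp_conj_eq_smul {X Y : Matrix n n ℂ} {c : ℂ} (h : ⁅X, Y⁆ = c • Y) :
    exp X * Y * exp (-X) = Complex.exp c • Y := by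
  refine (hasSum_exp_conj X Y).unique ?_
  have h1 : ∀ k : ℕ, (fun Z ↦ ⁅X, Z⁆)^[k] Y = c ^ k • Y := by
    intro k
    induction k with
    | zero => simp
    | succ k ih => rw [Function.iterate_succ_apply', ih, lie_smul, h, smul_smul, pow_succ]
  have h2 := (exp_series_hasSum_exp' (𝕂 := ℂ) c).smul_const Y
  rw [← Complex.exp_eq_exp_ℂ] at h2
  simpa only [h1, smul_smul, smul_eq_mul] using h2

open scoped Matrix.Norms.Operator in
theorem tendsto_exp_of_tendsto_zero {f : ℝ → Matrix n n ℂ} (h : Tendsto f atTop (𝓝 0)) :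
    Tendsto (fun s ↦ exp (f s)) atTop (𝓝 1) := by
  have h6 := ((exp_continuous (𝔸 := Matrix n n ℂ)).tendsto 0).comp h
  rw [exp_zero] at h6
  exact h6

variable [IsKilling ℂ 𝔤] {H : LieSubalgebra ℂ 𝔤} [H.IsCartanSubalgebra]
  {z : H} {v : Weight ℂ H 𝔤 → ℤ} (hv : ∀ χ : Weight ℂ H 𝔤, χ z = v χ)

theorem weightSum_value_mono {L : Type*} [LieRing L] [LieAlgebra ℂ L] [FiniteDimensional ℂ L]
    [IsKilling ℂ L] {H : LieSubalgebra ℂ L} [H.IsCartanSubalgebra] (v : Weight ℂ H L → ℤ)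
    {p q : ℤ → Prop} (h : ∀ k, p k → q k) :
    weightSum {χ : Weight ℂ H L | p (v χ)} ≤ weightSum {χ : Weight ℂ H L | q (v χ)} :=
  weightSum_mono fun χ hχ ↦ h (v χ) hχ

theorem Ad_expG_smul_rootSpace (s : ℝ) {χ : Weight ℂ H 𝔤} {X : 𝔤} (hX : X ∈ rootSpace H χ) :
    Ad (expG ((s : ℂ) • (z : 𝔤))) X = Complex.exp (s * χ z) • X := by
  apply Subtype.ext
  refine exp_conj_eq_smul ?_
  have h := lie_eq_smul_of_mem_rootSpace hX z
  have h' : ⁅(s : ℂ) • (z : 𝔤), X⁆ = ((s : ℂ) * χ z) • X := by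
    rw [smul_lie, mul_smul]
    congr 1
  exact congrArg Subtype.val h'

include hv

theorem mem_weightSum_value_zero : (z : 𝔤) ∈ weightSum {χ : Weight ℂ H 𝔤 | v χ = 0} := by
  rw [mem_weightSum]
  intro χ hχ
  rw [Set.mem_ofPred_eq] at hχ
  have h := comp_lie χ z (z : 𝔤)
  rw [lie_self, map_zero, hv] at h
  exact (smul_eq_zero.1 h.symm).resolve_left (by exact_mod_cast hχ)

theorem lie_mem_weightSum_value {S T U : Set ℤ} (h : ∀ k ∈ S, ∀ l ∈ T, k + l ∈ U) {x y : 𝔤}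
    (hx : x ∈ weightSum {χ : Weight ℂ H 𝔤 | v χ ∈ S})
    (hy : y ∈ weightSum {χ : Weight ℂ H 𝔤 | v χ ∈ T}) :
    ⁅x, y⁆ ∈ weightSum {χ : Weight ℂ H 𝔤 | v χ ∈ U} :=
  lie_mem_weightSum (fun χ hχ ψ hψ ω hω ↦ by
    rw [Set.mem_ofPred_eq] at hχ hψ ⊢
    rw [value_add hv hω]
    exact h _ hχ _ hψ) hx hy

theorem lie_weightSum_value {k : ℤ} {x : 𝔤} (hx : x ∈ weightSum {χ : Weight ℂ H 𝔤 | v χ = k}) :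
    ⁅(z : 𝔤), x⁆ = (k : ℂ) • x := by
  have h : x ∈ gradedPiece (z : 𝔤) k := by
    rw [gradedPiece_eq_weightSum]
    refine weightSum_mono (fun χ hχ ↦ ?_) hx
    rw [Set.mem_ofPred_eq] at hχ ⊢
    rw [hv, hχ]
  exact End.mem_eigenspace_iff.1 h

/-- If `y₁` is the part of `y` of degree `-(k + 1)`, conjugation by `exp(-y₁ / (k + 1))` cancels it
and moves all corrections into lower degrees. The number `m` bounds how many degrees remain. -/
theorem exists_Ad_add_eq (m : ℕ) : ∀ k : ℕ, (∀ χ : Weight ℂ H 𝔤, -(k + m : ℤ) ≤ v χ) →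
    ∀ y ∈ weightSum {χ : Weight ℂ H 𝔤 | v χ ∈ Set.Iic (-(k + 1 : ℤ))},
      ∃ x ∈ expSubgroup (weightSum {χ : Weight ℂ H 𝔤 | v χ < 0}), Ad x ((z : 𝔤) + y) = z := by
  induction m with
  | zero =>
    intro k hk y hy
    refine ⟨1, Subgroup.one_mem _, ?_⟩
    have : {χ : Weight ℂ H 𝔤 | v χ ∈ Set.Iic (-(k + 1 : ℤ))} = ∅ := by
      ext χ
      have := hk χ
      simp only [Set.mem_ofPred_eq, Set.mem_Iic, Set.mem_empty_iff_false, iff_false]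
      omega
    rw [this, weightSum_empty, Submodule.mem_bot] at hy
    rw [hy, add_zero, Ad_one]
  | succ m ih =>
    intro k hk y hy
    have hsplit : {χ : Weight ℂ H 𝔤 | v χ ∈ Set.Iic (-(k + 1 : ℤ))} =
        {χ | v χ = -(k + 1 : ℤ)} ∪ {χ | v χ ∈ Set.Iic (-((k + 1 : ℕ) + 1 : ℤ))} := by
      ext χ
      simp only [Set.mem_ofPred_eq, Set.mem_Iic, Set.mem_union]
      omega
    have hy' := hy
    rw [hsplit, ← weightSum_sup] at hy'
    obtain ⟨y₁, hy₁, y₂, hy₂, rfl⟩ := Submodule.mem_sup.1 hy'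
    set V := weightSum {χ : Weight ℂ H 𝔤 | v χ ∈ Set.Iic (-((k + 1 : ℕ) + 1 : ℤ))} with hVdef
    have hk0 : ((k + 1 : ℕ) : ℂ) ≠ 0 := Nat.cast_ne_zero.2 k.succ_ne_zero
    let X : 𝔤 := -(((k + 1 : ℕ) : ℂ)⁻¹ • y₁)
    have hX : X ∈ weightSum {χ : Weight ℂ H 𝔤 | v χ ∈ Set.Iic (-(k + 1 : ℤ))} := by
      refine neg_mem (Submodule.smul_mem _ _ (weightSum_mono ?_ hy₁))
      intro χ hχ
      rw [Set.mem_ofPred_eq] at hχ ⊢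
      exact hχ.le
    have hXz : ⁅X, (z : 𝔤)⁆ = -y₁ := by
      have h1 := lie_weightSum_value hv hy₁
      rw [← lie_skew, lie_neg, neg_neg, lie_smul, h1, smul_smul]
      rw [← neg_one_smul ℂ y₁]
      congr 1
      push_cast at hk0 ⊢
      field_simp
    have hXy₁ : ⁅X, y₁⁆ = 0 := by simp [X]
    have hV1 : ∀ Y ∈ weightSum {χ : Weight ℂ H 𝔤 | v χ ∈ Set.Iic (-(k + 1 : ℤ))}, ⁅X, Y⁆ ∈ V := by
      intro Y hY
      refine lie_mem_weightSum_value hv (fun p hp q hq ↦ ?_) hX hY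
      rw [Set.mem_Iic] at hp hq ⊢
      push_cast
      omega
    have hVle : V ≤ weightSum {χ : Weight ℂ H 𝔤 | v χ ∈ Set.Iic (-(k + 1 : ℤ))} := by
      rw [hsplit]
      exact weightSum_mono Set.subset_union_right
    have hV : ∀ Y ∈ V, ⁅X, Y⁆ ∈ V := fun Y hY ↦ hV1 Y (hVle hY)
    have hlie : ⁅X, (z : 𝔤) + (y₁ + y₂)⁆ = -y₁ + ⁅X, y₂⁆ := by
      rw [lie_add, lie_add, hXz, hXy₁, zero_add]
    have hmem := Ad_expG_sub_sub_mem (X := X) (Y := (z : 𝔤) + (y₁ + y₂)) hV (by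
      rw [hlie, lie_add, lie_neg, hXy₁, neg_zero, zero_add]
      exact hV _ (hV _ hy₂))
    rw [hlie] at hmem
    set T := Ad (expG X) ((z : 𝔤) + (y₁ + y₂)) with hT
    have hT' : T - z ∈ V := by
      have e : T - z = (T - ((z : 𝔤) + (y₁ + y₂) + (-y₁ + ⁅X, y₂⁆))) + (y₂ + ⁅X, y₂⁆) := by abel
      rw [e]
      exact add_mem hmem (add_mem hy₂ (hV _ hy₂))
    obtain ⟨x, hx, hxT⟩ := ih (k + 1) (fun χ ↦ by have := hk χ; push_cast at this ⊢; omega) _ hT'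
    refine ⟨x * expG X, Subgroup.mul_mem _ hx (expG_mem_expSubgroup (weightSum_mono ?_ hX)), ?_⟩
    · intro χ hχ
      rw [Set.mem_ofPred_eq, Set.mem_Iic] at hχ
      rw [Set.mem_ofPred_eq]
      omega
    · rw [Ad_mul, ← hT, ← hxT]
      congr 1
      abel

theorem Ad_sub_mem_of_mem_expSubgroup {x : connectedGroup 𝔤}
    (hx : x ∈ expSubgroup (weightSum {χ : Weight ℂ H 𝔤 | v χ < 0})) {y : 𝔤}
    (hy : y ∈ weightSum {χ : Weight ℂ H 𝔤 | v χ ≤ 0}) :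
    Ad x y - y ∈ weightSum {χ : Weight ℂ H 𝔤 | v χ < 0} := by
  refine expSubgroup_induction
    (p := fun x ↦ Ad x y - y ∈ weightSum {χ : Weight ℂ H 𝔤 | v χ < 0}) ?_ ?_ hx
  · rw [Ad_one, sub_self]
    exact zero_mem _
  · intro X hX u hu
    have hle := weightSum_value_mono (H := H) v (fun k (hk : k < 0) ↦ hk.le)
    have hlie : ∀ Y ∈ weightSum {χ : Weight ℂ H 𝔤 | v χ ≤ 0},
        ⁅X, Y⁆ ∈ weightSum {χ : Weight ℂ H 𝔤 | v χ < 0} := fun Y hY ↦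
      lie_mem_weightSum_value hv (S := Set.Iio 0) (T := Set.Iic 0) (U := Set.Iio 0)
        (fun k hk l hl ↦ by rw [Set.mem_Iio] at hk ⊢; rw [Set.mem_Iic] at hl; omega) hX hY
    have hmem : Ad u y ∈ weightSum {χ : Weight ℂ H 𝔤 | v χ ≤ 0} := by
      have := add_mem (hle hu) hy
      rwa [sub_add_cancel] at this
    have h := Ad_expG_sub_mem (fun Y hY ↦ hlie Y (hle hY)) (hlie _ hmem)
    rw [Ad_mul]
    have := add_mem h hu
    rwa [sub_add_sub_cancel] at this

theorem Ad_mem_of_mem_expSubgroup {x : connectedGroup 𝔤}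
    (hx : x ∈ expSubgroup (weightSum {χ : Weight ℂ H 𝔤 | v χ < 0})) {y : 𝔤}
    (hy : y ∈ weightSum {χ : Weight ℂ H 𝔤 | v χ < 0}) :
    Ad x y ∈ weightSum {χ : Weight ℂ H 𝔤 | v χ < 0} := by
  have := Ad_sub_mem_of_mem_expSubgroup hv hx (y := y)
    (weightSum_value_mono v (fun k (hk : k < 0) ↦ hk.le) hy)
  simpa using add_mem this hy

theorem tendsto_Ad_expG_smul {X : 𝔤} (hX : X ∈ weightSum {χ : Weight ℂ H 𝔤 | v χ < 0}) :
    Tendsto (fun s : ℝ ↦ ((Ad (expG ((s : ℂ) • (z : 𝔤))) X : 𝔤) : Matrix n n ℂ)) atTop (𝓝 0) := by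
  have h1 (s : ℝ) : ((Ad (expG ((s : ℂ) • (z : 𝔤))) X : 𝔤) : Matrix n n ℂ) =
      ∑ χ : Weight ℂ H 𝔤, Complex.exp (s * v χ) • ((comp χ X : 𝔤) : Matrix n n ℂ) := by
    conv_lhs => rw [← sum_comp (H := H) X, map_sum]
    rw [AddSubmonoidClass.coe_finsetSum]
    refine Finset.sum_congr rfl fun χ _ ↦ ?_
    rw [Ad_expG_smul_rootSpace s (comp_mem χ X), hv]
    rfl
  simp only [h1]
  rw [← Finset.sum_const_zero (s := (Finset.univ : Finset (Weight ℂ H 𝔤)))]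
  refine tendsto_finsetSum _ fun χ _ ↦ ?_
  by_cases hχ : v χ < 0
  · have h2 : Tendsto (fun s : ℝ ↦ Complex.exp (s * v χ)) atTop (𝓝 0) := by
      rw [Complex.tendsto_exp_nhds_zero_iff]
      have : (fun s : ℝ ↦ ((s : ℂ) * (v χ : ℂ)).re) = fun s : ℝ ↦ s * (v χ : ℝ) := by
        funext s
        simp
      rw [this]
      exact tendsto_id.atTop_mul_const_of_neg (by exact_mod_cast hχ)
    simpa using h2.smul_const ((comp χ X : 𝔤) : Matrix n n ℂ)
  · rw [mem_weightSum.1 hX χ hχ]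
    simp

theorem tendsto_conj_of_mem_expSubgroup {x : connectedGroup 𝔤}
    (hx : x ∈ expSubgroup (weightSum {χ : Weight ℂ H 𝔤 | v χ < 0})) :
    Tendsto (fun s : ℝ ↦ toMatrix (expG ((s : ℂ) • (z : 𝔤)) * x *
      (expG ((s : ℂ) • (z : 𝔤)))⁻¹)) atTop (𝓝 1) := by
  refine expSubgroup_induction (p := fun x ↦ Tendsto (fun s : ℝ ↦ toMatrix
    (expG ((s : ℂ) • (z : 𝔤)) * x * (expG ((s : ℂ) • (z : 𝔤)))⁻¹)) atTop (𝓝 1)) ?_ ?_ hx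
  · simp
  · intro X hX u hu
    have h5 := tendsto_exp_of_tendsto_zero (tendsto_Ad_expG_smul hv hX)
    have h7 := h5.mul hu
    rw [mul_one] at h7
    refine h7.congr fun s ↦ ?_
    rw [← toMatrix_expG, ← toMatrix_mul, expG_Ad]
    congr 1
    group

/-- `Ad_x z - z` lies in both `𝔤_{<0}` and `𝔤_{≥0}`, so `x` commutes with every `exp(sz)`. But
conjugation by `exp(sz)` contracts `x` to `1` as `s → ∞`. -/
theorem eq_one_of_mem_expSubgroup_of_mem_adNormalizer {x : connectedGroup 𝔤}
    (hx : x ∈ expSubgroup (weightSum {χ : Weight ℂ H 𝔤 | v χ < 0}))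
    (hN : x ∈ adNormalizer (weightSum {χ : Weight ℂ H 𝔤 | 0 ≤ v χ})) : x = 1 := by
  have hz := mem_weightSum_value_zero hv
  have h1 := Ad_sub_mem_of_mem_expSubgroup hv hx
    (weightSum_value_mono v (q := fun k ↦ k ≤ 0) (fun k (hk : k = 0) ↦ hk.le) hz)
  have hz' : (z : 𝔤) ∈ weightSum {χ : Weight ℂ H 𝔤 | 0 ≤ v χ} :=
    weightSum_value_mono v (q := fun k ↦ 0 ≤ k) (fun k (hk : k = 0) ↦ hk.ge) hz
  have h2 := sub_mem ((mem_adNormalizer.1 hN _).1 hz') hz'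
  have h3 : Ad x (z : 𝔤) - z ∈ weightSum _ ⊓ weightSum _ := ⟨h1, h2⟩
  have hempty : {χ : Weight ℂ H 𝔤 | v χ < 0} ∩ {χ | 0 ≤ v χ} = ∅ := by
    ext χ
    simp only [Set.mem_inter_iff, Set.mem_ofPred_eq, Set.mem_empty_iff_false, iff_false]
    omega
  rw [weightSum_inf, hempty, weightSum_empty, Submodule.mem_bot, sub_eq_zero] at h3
  have hcomm (s : ℝ) : expG ((s : ℂ) • (z : 𝔤)) * x * (expG ((s : ℂ) • (z : 𝔤)))⁻¹ = x := by
    have h4 := expG_Ad x ((s : ℂ) • (z : 𝔤))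
    rw [map_smul, h3] at h4
    rw [mul_inv_eq_iff_eq_mul]
    exact mul_inv_eq_iff_eq_mul.1 h4.symm |>.symm
  have hlim := tendsto_conj_of_mem_expSubgroup hv hx
  simp only [hcomm] at hlim
  exact toMatrix_injective (tendsto_const_nhds_iff.1 hlim)

end ParabolicDecomposition

/-! ### A transversality criterion for the big cell. -/

section BigCell

open LieModule NormedSpace Filter Topology

variable {n : Type*} [Fintype n] [DecidableEq n] {𝔤 : LieSubalgebra ℂ (Matrix n n ℂ)}
  [IsKilling ℂ 𝔤] {H : LieSubalgebra ℂ 𝔤} [H.IsCartanSubalgebra]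
  {z : H} {v : Weight ℂ H 𝔤 → ℤ} (hv : ∀ χ : Weight ℂ H 𝔤, χ z = v χ)

theorem isCompl_nonneg_neg (v : Weight ℂ H 𝔤 → ℤ) :
    IsCompl (weightSum {χ : Weight ℂ H 𝔤 | 0 ≤ v χ}) (weightSum {χ : Weight ℂ H 𝔤 | v χ < 0}) := by
  have : {χ : Weight ℂ H 𝔤 | v χ < 0} = {χ : Weight ℂ H 𝔤 | 0 ≤ v χ}ᶜ := by
    ext χ
    simp
  rw [this]
  exact isCompl_weightSum _

omit [IsKilling ℂ 𝔤] in
theorem exists_abs_le (v : Weight ℂ H 𝔤 → ℤ) : ∃ N : ℕ, ∀ χ, |v χ| ≤ N := by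
  refine ⟨∑ χ : Weight ℂ H 𝔤, (v χ).natAbs, fun χ ↦ ?_⟩
  have := Finset.single_le_sum (f := fun χ : Weight ℂ H 𝔤 ↦ (v χ).natAbs)
    (fun _ _ ↦ Nat.zero_le _) (Finset.mem_univ χ)
  rw [Int.abs_eq_natAbs]
  exact_mod_cast this

include hv

theorem exists_mem_comp_eq {V : Submodule ℂ 𝔤} (hV : ∀ x ∈ V, ⁅(z : 𝔤), x⁆ ∈ V) {x : 𝔤}
    (hx : x ∈ V) (N : ℕ) :
    ∃ y ∈ V, ∀ χ : Weight ℂ H 𝔤, comp χ y = (∏ j ∈ Finset.range N, ((v χ : ℂ) - j)) • comp χ x := by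
  induction N with
  | zero => exact ⟨x, hx, by simp⟩
  | succ N ih =>
    obtain ⟨y, hy, h⟩ := ih
    refine ⟨⁅(z : 𝔤), y⁆ - (N : ℂ) • y, sub_mem (hV y hy) (V.smul_mem _ hy), fun χ ↦ ?_⟩
    rw [map_sub, comp_lie, map_smul, h, hv, ← sub_smul, smul_smul, Finset.prod_range_succ, mul_comm]

/-- The product of the `ad z - j` for `0 ≤ j ≤ N` kills the components of nonnegative degree and
multiplies those of negative degree by nonzero scalars. Its value at `x` lies in `V` and in
`𝔤_{<0}`, hence is zero. -/
theorem le_nonneg_of_stable {V : Submodule ℂ 𝔤} (hV : ∀ x ∈ V, ⁅(z : 𝔤), x⁆ ∈ V)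
    (h : ∀ x ∈ V, x ∈ weightSum {χ : Weight ℂ H 𝔤 | v χ < 0} → x = 0) :
    V ≤ weightSum {χ : Weight ℂ H 𝔤 | 0 ≤ v χ} := by
  intro x hx
  obtain ⟨N, hN⟩ := exists_abs_le v
  obtain ⟨y, hy, hyx⟩ := exists_mem_comp_eq hv hV hx (N + 1)
  have hy0 : y = 0 := by
    refine h y hy (mem_weightSum.2 fun χ hχ ↦ ?_)
    rw [Set.mem_ofPred_eq, not_lt] at hχ
    have h1 := hN χ
    rw [abs_of_nonneg hχ] at h1
    rw [hyx, Finset.prod_eq_zero (i := (v χ).toNat), zero_smul]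
    · rw [Finset.mem_range]
      omega
    · have : ((v χ).toNat : ℤ) = v χ := Int.toNat_of_nonneg hχ
      rw [sub_eq_zero]
      exact_mod_cast this.symm
  rw [mem_weightSum]
  intro χ hχ
  rw [Set.mem_ofPred_eq, not_le] at hχ
  have h1 := hyx χ
  rw [hy0, map_zero] at h1
  refine (smul_eq_zero.1 h1.symm).resolve_left ?_
  rw [← ne_eq, Finset.prod_ne_zero_iff]
  intro j _ hj
  rw [sub_eq_zero] at hj
  have : v χ = j := by exact_mod_cast hj
  omega

/-- An element that moves `𝔤_{≥ 0}` to a complement of `𝔤_{< 0}` lies in the big cell. -/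
theorem exists_mul_mem_adNormalizer {x : connectedGroup 𝔤}
    (hx : ∀ Y ∈ weightSum {χ : Weight ℂ H 𝔤 | 0 ≤ v χ},
      Ad x Y ∈ weightSum {χ : Weight ℂ H 𝔤 | v χ < 0} → Y = 0) :
    ∃ y ∈ expSubgroup (weightSum {χ : Weight ℂ H 𝔤 | v χ < 0}),
      y * x ∈ adNormalizer (weightSum {χ : Weight ℂ H 𝔤 | 0 ≤ v χ}) := by
  set 𝔮 := nonnegSubalgebra z v hv with h𝔮
  set Q := weightSum {χ : Weight ℂ H 𝔤 | 0 ≤ v χ} with hQ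
  set U := weightSum {χ : Weight ℂ H 𝔤 | v χ < 0} with hU
  have hc : IsCompl Q U := isCompl_nonneg_neg v
  have hdisj : Disjoint (Q.map (Ad x).toLinearEquiv.toLinearMap) U := by
    rw [Submodule.disjoint_def]
    rintro _ ⟨Y, hY, rfl⟩ hYU
    rw [hx Y hY hYU, map_zero]
  have htop : Q.map (Ad x).toLinearEquiv.toLinearMap ⊔ U = ⊤ := by
    apply Submodule.eq_top_of_finrank_eq
    have h1 := Submodule.finrank_sup_add_finrank_inf_eq (Q.map (Ad x).toLinearEquiv.toLinearMap) U
    rw [disjoint_iff.1 hdisj, finrank_bot, add_zero, LinearEquiv.finrank_map_eq] at h1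
    rw [h1]
    exact Submodule.finrank_add_eq_of_isCompl hc
  -- Writing `z = Ad_x Y + c` with `c ∈ 𝔤_{<0}`, the element `Ad_x Y = z - c` is conjugate to `z` by
  -- some `y` in the unipotent group.
  have hz : (z : 𝔤) ∈ Q.map (Ad x).toLinearEquiv.toLinearMap ⊔ U := htop ▸ Submodule.mem_top
  obtain ⟨_, ⟨Y, hY, rfl⟩, c, hcU, hsum⟩ := Submodule.mem_sup.1 hz
  obtain ⟨N, hN⟩ := exists_abs_le v
  obtain ⟨y, hyU, hy⟩ := exists_Ad_add_eq hv N 0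
    (fun χ ↦ by have := neg_le_of_abs_le (hN χ); push_cast; omega) (-c)
    (neg_mem (weightSum_mono (fun χ hχ ↦ by
      rw [Set.mem_ofPred_eq] at hχ ⊢
      rw [Set.mem_Iic]
      push_cast
      omega) hcU))
  have hYz : Ad (y * x) Y = z := by
    rw [Ad_mul, ← hy, ← hsum]
    congr 1
    exact (add_neg_cancel_right _ _).symm
  refine ⟨y, hyU, ?_⟩
  -- The image contains `z = Ad_{yx} Y` and is a subalgebra, so it is stable under `ad z`; it still
  -- meets `𝔤_{<0}` trivially.
  have hle : Q.map (Ad (y * x)).toLinearEquiv.toLinearMap ≤ Q := by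
    refine le_nonneg_of_stable hv ?_ ?_
    · rintro _ ⟨W, hW, rfl⟩
      refine ⟨⁅Y, W⁆, 𝔮.lie_mem hY hW, ?_⟩
      change Ad (y * x) ⁅Y, W⁆ = ⁅(z : 𝔤), Ad (y * x) W⁆
      rw [LieEquiv.map_lie, hYz]
    · rintro _ ⟨W, hW, rfl⟩ hWU
      have h1 := Ad_mem_of_mem_expSubgroup hv (Subgroup.inv_mem _ hyU) hWU
      change Ad y⁻¹ (Ad (y * x) W) ∈ U at h1
      rw [← Ad_mul, inv_mul_cancel_left] at h1
      rw [hx W hW h1, map_zero]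
  have heq : Q.map (Ad (y * x)).toLinearEquiv.toLinearMap = Q :=
    Submodule.eq_of_le_of_finrank_eq hle (LinearEquiv.finrank_map_eq _ _)
  rw [mem_adNormalizer]
  intro W
  refine ⟨fun hW ↦ hle ⟨W, hW, rfl⟩, fun hW ↦ ?_⟩
  rw [← heq] at hW
  obtain ⟨W', hW', h⟩ := hW
  have : W' = W := (Ad (y * x)).injective h
  exact this ▸ hW'

end BigCell

/-! ### Entire curves in the group. -/

section Connected

open LieModule NormedSpace Filter Topology

variable {n : Type*} [Fintype n] [DecidableEq n] {𝔤 : LieSubalgebra ℂ (Matrix n n ℂ)}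

/-- The curve `s ↦ exp(s A₁) ⋯ exp(s A_m)`. -/
def expCurve (l : List 𝔤) (s : ℂ) : connectedGroup 𝔤 :=
  (l.map fun A ↦ expG (s • A)).prod

theorem expCurve_cons (A : 𝔤) (l : List 𝔤) (s : ℂ) :
    expCurve (A :: l) s = expG (s • A) * expCurve l s := by
  simp [expCurve]

theorem expCurve_zero (l : List 𝔤) : expCurve l 0 = 1 := by
  induction l with
  | nil => rfl
  | cons A l ih => rw [expCurve_cons, ih]; simp

theorem exists_expCurve_one (g : connectedGroup 𝔤) : ∃ l : List 𝔤, expCurve l 1 = g := by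
  refine connectedGroup_induction (p := fun g ↦ ∃ l : List 𝔤, expCurve l 1 = g) ⟨[], rfl⟩ ?_ g
  rintro X u ⟨l, rfl⟩
  exact ⟨X :: l, by rw [expCurve_cons, one_smul]⟩

open scoped Matrix.Norms.Operator in
theorem differentiable_expCurve (l : List 𝔤) :
    Differentiable ℂ (fun s ↦ toMatrix (expCurve l s)) ∧
      Differentiable ℂ (fun s ↦ toMatrix (expCurve l s)⁻¹) := by
  induction l with
  | nil => exact ⟨differentiable_const _, differentiable_const _⟩
  | cons A l ih =>
    have h1 : Differentiable ℂ fun s : ℂ ↦ exp (s • (A : Matrix n n ℂ)) :=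
      fun s ↦ (hasDerivAt_exp_smul _ s).differentiableAt
    have h2 : Differentiable ℂ fun s : ℂ ↦ exp (-(s • (A : Matrix n n ℂ))) :=
      fun s ↦ (hasDerivAt_exp_neg_smul _ s).differentiableAt
    refine ⟨?_, ?_⟩
    · have h3 := h1.mul ih.1
      have e (s : ℂ) : toMatrix (expCurve (A :: l) s) =
          exp (s • (A : Matrix n n ℂ)) * toMatrix (expCurve l s) := by
        rw [expCurve_cons]
        rfl
      simp only [e]
      exact h3
    · have h3 := ih.2.mul h2
      have e (s : ℂ) : toMatrix (expCurve (A :: l) s)⁻¹ =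
          toMatrix (expCurve l s)⁻¹ * exp (-(s • (A : Matrix n n ℂ))) := by
        rw [expCurve_cons, mul_inv_rev]
        rfl
      simp only [e]
      exact h3

open scoped Matrix.Norms.Operator in
theorem differentiable_apply_Ad_expCurve (l : List 𝔤) (f : Dual ℂ 𝔤) (Y : 𝔤) :
    Differentiable ℂ fun s ↦ f (Ad (expCurve l s) Y) := by
  obtain ⟨m, hm⟩ := LinearMap.exists_extend (p := 𝔤.toSubmodule) f
  have hm' (x : 𝔤) : m x = f x := LinearMap.congr_fun hm x
  simp only [← hm', coe_Ad]
  have h1 := ((differentiable_expCurve l).1.mul_const (Y : Matrix n n ℂ)).mul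
    (differentiable_expCurve l).2
  exact (LinearMap.toContinuousLinearMap m).differentiable.comp h1

end Connected

/-! ### Zeros of entire functions and local factorization along curves. -/

section NormalizerConnected

open LieModule NormedSpace Filter Topology

theorem countable_zeros_of_entire {F : ℂ → ℂ} (hF : Differentiable ℂ F) {s : ℂ} (hs : F s ≠ 0) :
    {s | F s = 0}.Countable := by
  have h1 : AnalyticOnNhd ℂ F Set.univ := fun x _ ↦ hF.analyticAt x
  have h2 := h1.preimage_zero_mem_codiscrete hs
  have h3 : {s | F s = 0}ᶜ ∈ codiscreteWithin (Set.univ : Set ℂ) := by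
    convert! h2 using 1
  have h4 := isDiscrete_of_codiscreteWithin h3
  rw [Set.inter_univ] at h4
  have := h4.to_subtype
  exact countable_of_Lindelof_of_discrete (X := {s | F s = 0})

/-- Complex parameters matter here: the zeros form a countable set, and removing a countable set
leaves the plane connected but not a line. -/
theorem isPreconnected_ne_zero_of_entire {F : ℂ → ℂ} (hF : Differentiable ℂ F) {s : ℂ}
    (hs : F s ≠ 0) : IsPreconnected {s | F s ≠ 0} :=
  ((countable_zeros_of_entire hF hs).isConnected_compl_of_one_lt_rank (by simp)).isPreconnected

variable {n : Type*} [Fintype n] [DecidableEq n] {𝔤 : LieSubalgebra ℂ (Matrix n n ℂ)}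

open scoped Matrix.Norms.Operator in
/-- Small elements of the group generated by `exp 𝔤` factor through a product of one-parameter
subgroups along a basis of `𝔤`. -/
theorem eventually_expCurve_eq_prod {ι : Type*} [Fintype ι] (e : Basis ι ℂ 𝔤) (L : List ι)
    (hL : ∀ c : ι → ℂ, (L.map fun j ↦ c j • e j).sum = ∑ j, c j • e j) (l : List 𝔤) (s₀ : ℂ)
    (h : connectedGroup 𝔤) {V : Set (ι → ℂ)} (hV : V ∈ 𝓝 0) :
    ∀ᶠ s in 𝓝 s₀, ∃ x ∈ V, h * ((expCurve l s₀)⁻¹ * expCurve l s) * h⁻¹ =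
      (L.map fun j ↦ expG (x j • e j)).prod := by
  let E : ι → Matrix n n ℂ := fun j ↦ (e j : Matrix n n ℂ)
  have hword (x : ι → ℂ) : toMatrix (L.map fun j ↦ expG (x j • e j)).prod = wordExp E L x := by
    clear hL
    induction L with
    | nil => rfl
    | cons j L ih =>
      rw [wordExp_cons, List.map_cons, List.prod_cons, toMatrix_mul, ih]
      rfl
  obtain ⟨p, hp⟩ := LinearMap.exists_extend (p := 𝔤.toSubmodule) e.equivFun.toLinearMap
  have hp' (x : 𝔤) : p x = e.equivFun x := LinearMap.congr_fun hp x
  have key (B : 𝔤) {V : Set (ι → ℂ)} (hV : V ∈ 𝓝 0) :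
      ∀ᶠ q : ℂ × (ι → ℂ) in 𝓝 0, ∃ x' ∈ V, exp (q.1 • (B : Matrix n n ℂ)) * wordExp E L q.2 =
        wordExp E L x' := by
    refine eventually_exp_mul_wordExp E (V := 𝔤.toSubmodule) (fun j ↦ (e j).2)
      (fun j s w hw ↦ conj_mem (expG (s • e j)) ⟨w, hw⟩) L (LinearMap.toContinuousLinearMap p)
      (fun w hw hw0 ↦ ?_) (fun c ↦ ?_) B.2 hV
    · have h1 : e.equivFun ⟨w, hw⟩ = 0 := (hp' ⟨w, hw⟩).symm.trans hw0
      have h2 := (LinearEquiv.map_eq_zero_iff e.equivFun).1 h1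
      exact congrArg Subtype.val h2
    · have h1 : (L.map fun j ↦ c j • E j).sum = ((L.map fun j ↦ c j • e j).sum : 𝔤) := by
        clear hL hword
        induction L with
        | nil => rfl
        | cons j L ih =>
          rw [List.map_cons, List.sum_cons, ih, List.map_cons, List.sum_cons]
          rfl
      rw [h1, hL]
      change p ((∑ j, c j • e j : 𝔤) : Matrix n n ℂ) = c
      rw [hp', ← e.equivFun_symm_apply, LinearEquiv.apply_symm_apply]
  induction l generalizing V with
  | nil =>
    refine Eventually.of_forall fun s ↦ ⟨0, mem_of_mem_nhds hV, ?_⟩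
    have : (L.map fun j ↦ expG ((0 : ι → ℂ) j • e j)).prod = (1 : connectedGroup 𝔤) := by
      simp
    rw [this]
    simp [expCurve]
  | cons A l ih =>
    -- Adding the letter `A` multiplies the conjugated increment on the left by the exponential of
    -- `(s - s₀) Ad(h g(s₀)⁻¹) A`, where `g` is the curve of the tail. For `s` near `s₀` this is
    -- absorbed into the coordinates.
    have h1 := key (Ad (h * (expCurve l s₀)⁻¹) A) hV
    rw [← Prod.mk_zero_zero, nhds_prod_eq, eventually_prod_iff] at h1
    obtain ⟨pa, hpa, pb, hpb, hpab⟩ := h1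
    have h2 : ∀ᶠ s in 𝓝 s₀, pa (s - s₀) := by
      have : Tendsto (fun s ↦ s - s₀) (𝓝 s₀) (𝓝 0) := by
        have := (continuous_id.sub continuous_const).tendsto (f := fun s : ℂ ↦ s - s₀) s₀
        simpa using this
      exact this.eventually hpa
    filter_upwards [h2, ih hpb] with s hs1 ⟨x, hx, hxs⟩
    obtain ⟨x', hx', hxx'⟩ := hpab hs1 hx
    refine ⟨x', hx', toMatrix_injective ?_⟩
    rw [hword, ← hxx', ← hword, ← hxs]
    have e1 : expG ((s - s₀) • A) = (expG (s₀ • A))⁻¹ * expG (s • A) := by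
      rw [sub_smul, sub_eq_neg_add, expG_add (by simp), inv_expG]
    have e2 : h * ((expCurve (A :: l) s₀)⁻¹ * expCurve (A :: l) s) * h⁻¹ =
        expG ((s - s₀) • Ad (h * (expCurve l s₀)⁻¹) A) *
          (h * ((expCurve l s₀)⁻¹ * expCurve l s) * h⁻¹) := by
      rw [← map_smul, expG_Ad, e1, expCurve_cons, expCurve_cons]
      group
    rw [e2]
    rfl

end NormalizerConnected

/-! ### Connectedness of the parabolic subgroup. -/

section ParabolicConnected

open LieModule Filter Topology

variable {n : Type*} [Fintype n] [DecidableEq n] {𝔤 : LieSubalgebra ℂ (Matrix n n ℂ)}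

/-- Near a point the group generated by `exp 𝔤` is covered by the product of the groups generated by
the exponentials of two complementary subspaces. -/
theorem eventually_conj_expCurve_mem {U Q : Submodule ℂ 𝔤} (hc : IsCompl U Q) (l : List 𝔤) (s₀ : ℂ)
    (h : connectedGroup 𝔤) :
    ∀ᶠ s in 𝓝 s₀, ∃ y ∈ expSubgroup U, ∃ q ∈ expSubgroup Q,
      h * ((expCurve l s₀)⁻¹ * expCurve l s) * h⁻¹ = y * q := by
  let bU := finBasis ℂ U
  let bQ := finBasis ℂ Q
  let e := (bU.prod bQ).map (Submodule.prodEquivOfIsCompl U Q hc)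
  have hl (j) : e (Sum.inl j) = bU j := by simp [e]
  have hr (j) : e (Sum.inr j) = bQ j := by simp [e]
  have hL (c : Fin (finrank ℂ U) ⊕ Fin (finrank ℂ Q) → ℂ) :
      (((List.finRange (finrank ℂ U)).map Sum.inl ++ (List.finRange (finrank ℂ Q)).map Sum.inr).map
        fun j ↦ c j • e j).sum = ∑ j, c j • e j := by
    rw [List.map_append, List.sum_append, List.map_map, List.map_map, Fintype.sum_sum_type,
      ← List.sum_ofFn, ← List.sum_ofFn, List.ofFn_eq_map, List.ofFn_eq_map]
    rfl
  filter_upwards [eventually_expCurve_eq_prod e _ hL l s₀ h univ_mem] with s ⟨x, _, hx⟩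
  rw [hx, List.map_append, List.prod_append, List.map_map, List.map_map]
  refine ⟨_, Subgroup.list_prod_mem _ fun u hu ↦ ?_, _, Subgroup.list_prod_mem _ fun u hu ↦ ?_, rfl⟩
  · obtain ⟨j, -, rfl⟩ := List.mem_map.1 hu
    refine expG_mem_expSubgroup (U.smul_mem _ ?_)
    rw [hl]
    exact (bU j).2
  · obtain ⟨j, -, rfl⟩ := List.mem_map.1 hu
    refine expG_mem_expSubgroup (Q.smul_mem _ ?_)
    rw [hr]
    exact (bQ j).2

/-- The determinant of the compression of `Ad` to a direct summand, along a curve in the group. -/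
def compressionDet {Q U : Submodule ℂ 𝔤} (hc : IsCompl Q U) (l : List 𝔤) (s : ℂ) : ℂ :=
  LinearMap.det (Q.projectionOnto U hc ∘ₗ (Ad (expCurve l s)).toLinearEquiv.toLinearMap ∘ₗ Q.subtype)

theorem differentiable_compressionDet {Q U : Submodule ℂ 𝔤} (hc : IsCompl Q U) (l : List 𝔤) :
    Differentiable ℂ (compressionDet hc l) := by
  let q := finBasis ℂ Q
  have h (s : ℂ) : compressionDet hc l s = ∑ σ : Equiv.Perm (Fin (finrank ℂ Q)),
      ((Equiv.Perm.sign σ : ℤ) : ℂ) * ∏ j, (q.coord (σ j) ∘ₗ Q.projectionOnto U hc)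
        (Ad (expCurve l s) (q j)) := by
    rw [compressionDet, ← LinearMap.det_toMatrix q, Matrix.det_apply']
    refine Finset.sum_congr rfl fun σ _ ↦ ?_
    congr 1
    refine Finset.prod_congr rfl fun j _ ↦ ?_
    rw [LinearMap.toMatrix_apply]
    rfl
  rw [funext h]
  refine Differentiable.fun_sum fun σ _ ↦ (Differentiable.fun_finsetProd fun j _ ↦ ?_).const_mul _
  exact differentiable_apply_Ad_expCurve l _ _

theorem compressionDet_ne_zero_iff {Q U : Submodule ℂ 𝔤} (hc : IsCompl Q U) (l : List 𝔤) (s : ℂ) :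
    compressionDet hc l s ≠ 0 ↔ ∀ Y ∈ Q, Ad (expCurve l s) Y ∈ U → Y = 0 := by
  rw [compressionDet, ne_eq, LinearMap.det_eq_zero_iff_ker_ne_bot, not_not, LinearMap.ker_eq_bot']
  constructor
  · intro h Y hY hYU
    exact congrArg Subtype.val (h ⟨Y, hY⟩ ((Submodule.projectionOnto_apply_eq_zero_iff hc).2 hYU))
  · intro h Y hY
    exact Subtype.ext (h Y Y.2 ((Submodule.projectionOnto_apply_eq_zero_iff hc).1 hY))

theorem compressionDet_ne_zero_of_mem_adNormalizer {Q U : Submodule ℂ 𝔤} (hc : IsCompl Q U)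
    {l : List 𝔤} {s : ℂ} (h : expCurve l s ∈ adNormalizer Q) : compressionDet hc l s ≠ 0 := by
  rw [compressionDet_ne_zero_iff]
  intro Y hY hYU
  have h1 := (Submodule.disjoint_def.1 hc.disjoint) _ ((mem_adNormalizer.1 h Y).1 hY) hYU
  exact (map_eq_zero_iff _ (Ad (expCurve l s)).injective).1 h1

variable [IsKilling ℂ 𝔤] {H : LieSubalgebra ℂ 𝔤} [H.IsCartanSubalgebra]
  {z : H} {v : Weight ℂ H 𝔤 → ℤ} (hv : ∀ χ : Weight ℂ H 𝔤, χ z = v χ)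

include hv

/-- The normalizer of `𝔤_{≥ 0}` in the group is generated by `exp 𝔤_{≥ 0}`. -/
theorem adNormalizer_le_expSubgroup :
    adNormalizer (weightSum {χ : Weight ℂ H 𝔤 | 0 ≤ v χ}) ≤
      expSubgroup (weightSum {χ : Weight ℂ H 𝔤 | 0 ≤ v χ}) := by
  intro g hg
  have hle : expSubgroup (weightSum {χ : Weight ℂ H 𝔤 | 0 ≤ v χ}) ≤
      adNormalizer (weightSum {χ : Weight ℂ H 𝔤 | 0 ≤ v χ}) :=
    expSubgroup_le_adNormalizer (nonnegSubalgebra z v hv)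
  have hone {x : connectedGroup 𝔤} := eq_one_of_mem_expSubgroup_of_mem_adNormalizer hv (x := x)
  have hcell {x : connectedGroup 𝔤} := exists_mul_mem_adNormalizer hv (x := x)
  have hc := isCompl_nonneg_neg v
  set Q := weightSum {χ : Weight ℂ H 𝔤 | 0 ≤ v χ}
  set U := weightSum {χ : Weight ℂ H 𝔤 | v χ < 0}
  obtain ⟨l, rfl⟩ := exists_expCurve_one g
  have hzero : compressionDet hc l 0 ≠ 0 := compressionDet_ne_zero_of_mem_adNormalizer hc (by
    rw [expCurve_zero]
    exact Subgroup.one_mem _)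
  -- Near `s₀` the factors of the curve in the big cell change only by elements of `expSubgroup U`
  -- and `expSubgroup Q`. The factor in `expSubgroup U` is unique, as this group meets the
  -- normalizer trivially, so the condition on the other factor is locally constant.
  have hconst (s₀ : ℂ) (hs₀ : compressionDet hc l s₀ ≠ 0) : ∃ p : Prop, ∀ᶠ s in 𝓝 s₀,
      ((∃ y ∈ expSubgroup U, y * expCurve l s ∈ expSubgroup Q) ↔ p) := by
    obtain ⟨y₀, hy₀, hN⟩ := hcell ((compressionDet_ne_zero_iff hc l s₀).1 hs₀)
    refine ⟨y₀ * expCurve l s₀ ∈ expSubgroup Q, ?_⟩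
    filter_upwards [eventually_conj_expCurve_mem hc.symm l s₀ (y₀ * expCurve l s₀)]
      with s ⟨y₁, hy₁, q₁, hq₁, h⟩
    have hs : expCurve l s = (y₁⁻¹ * y₀)⁻¹ * (q₁ * (y₀ * expCurve l s₀)) := by
      rw [mul_inv_eq_iff_eq_mul] at h
      have : expCurve l s = y₀⁻¹ * (y₀ * expCurve l s₀ * ((expCurve l s₀)⁻¹ * expCurve l s)) := by
        group
      rw [this, h]
      group
    constructor
    · rintro ⟨y, hy, hyq⟩
      rw [hs, ← mul_assoc] at hyq
      have h1 : y * (y₁⁻¹ * y₀)⁻¹ = 1 := by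
        refine hone (mul_mem hy (inv_mem (mul_mem (inv_mem hy₁) hy₀))) ?_
        exact (Subgroup.mul_mem_cancel_right _ (mul_mem (hle hq₁) hN)).1 (hle hyq)
      rw [h1, one_mul] at hyq
      exact (Subgroup.mul_mem_cancel_left _ hq₁).1 hyq
    · intro hn
      refine ⟨y₁⁻¹ * y₀, mul_mem (inv_mem hy₁) hy₀, ?_⟩
      rw [hs, mul_inv_cancel_left]
      exact mul_mem hq₁ hn
  have hiff := (isPreconnected_ne_zero_of_entire (differentiable_compressionDet hc l)
    hzero).induction₂' (fun s t ↦ (∃ y ∈ expSubgroup U, y * expCurve l s ∈ expSubgroup Q) ↔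
      (∃ y ∈ expSubgroup U, y * expCurve l t ∈ expSubgroup Q)) (fun s hs ↦ ?_)
    (fun _ _ _ _ _ _ h₁ h₂ ↦ h₁.trans h₂) hzero
    (compressionDet_ne_zero_of_mem_adNormalizer hc hg)
  -- At `s = 0` the curve is `1`, so the condition propagates to `s = 1`. There the curve is an
  -- element of the normalizer, which forces `y` into the normalizer and hence `y = 1`.
  · obtain ⟨y, hy, hyg⟩ := hiff.1 ⟨1, one_mem _, by rw [expCurve_zero, one_mul]; exact one_mem _⟩
    have h1 : y = 1 := hone hy ((Subgroup.mul_mem_cancel_right _ hg).1 (hle hyg))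
    rwa [h1, one_mul] at hyg
  · obtain ⟨p, hp⟩ := hconst s hs
    have hs' := hp.self_of_nhds
    filter_upwards [mem_nhdsWithin_of_mem_nhds hp] with t ht
    exact ⟨hs'.trans ht.symm, ht.trans hs'.symm⟩

end ParabolicConnected

end Cominuscule

end

open Cominuscule LieAlgebra LieAlgebra.IsKilling in
theorem mainTheorem3 {n : Type*} [Fintype n] [DecidableEq n]
    (𝔤 : LieSubalgebra ℂ (Matrix n n ℂ)) [LieAlgebra.IsSimple ℂ 𝔤]
    (H : LieSubalgebra ℂ 𝔤) [H.IsCartanSubalgebra]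
    (b : (rootSystem H).Base) (i : b.support) (hi : IsCominuscule b i)
    (w : (rootSystem H).weylGroup) (hw : w ∈ hasseDiagram b i)
    (hw_one : w ≠ 1) (hw_long : ¬ IsLongest b i w) :
    (∃! d : Finset b.support × ℕ, IsMarking b i w d.1 d.2) ∧
    ∀ (J : Finset b.support) (a : ℕ), IsMarking b i w J a →
      ∃ 𝔤w : LieSubalgebra ℂ 𝔤,
        IsGreatest {𝔰 : LieSubalgebra ℂ 𝔤 | inversionSubspace b w ≤ 𝔰.toSubmodule ∧
          𝔰.toSubmodule ⊔ nonnegPart (gradingElement b i) =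
            inversionSubspace b w ⊔ nonnegPart (gradingElement b i)} 𝔤w ∧
        𝔤w.toSubmodule = inversionSubspace b w ⊔
          bigradedGE (gradingElement b i) (markingElement b J) 0 0 ⊔
          bigradedGE (gradingElement b i) (markingElement b J) 1 a ∧
        iSupIndep ![inversionSubspace b w,
          bigradedGE (gradingElement b i) (markingElement b J) 0 0,
          bigradedGE (gradingElement b i) (markingElement b J) 1 a] ∧
        DirectSum.IsInternal (fun s : ℤ ↦
          gradedPiece (markingElement b J - (a : ℂ) • gradingElement b i) s) ∧
        𝔤w.toSubmodule =
          nonnegPart (markingElement b J - (a : ℂ) • gradingElement b i) ∧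
        IsParabolicSubalgebra 𝔤w ∧
        MulAction.stabilizer (connectedGroup 𝔤) (schubertVariety b i w) =
          adNormalizer 𝔤w.toSubmodule ∧
        MulAction.stabilizer (connectedGroup 𝔤) (schubertVariety b i w) =
          Subgroup.closure (expSet (𝔤w : Set 𝔤)) ∧
        lieAlgebraOf (MulAction.stabilizer (connectedGroup 𝔤) (schubertVariety b i w)) =
          (𝔤w : Set 𝔤) := by
  obtain ⟨hex, hroot⟩ := existsUnique_isMarking hi hw hw_one hw_long
  refine ⟨hex, fun J a hM ↦ ?_⟩
  have hJ := hroot J a hM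
  have hnorm : adNormalizer (schubertSubalgebra i J a).toSubmodule ≤
      Subgroup.closure (expSet (schubertSubalgebra i J a : Set 𝔤)) :=
    adNormalizer_le_expSubgroup (apply_levelDual b i J a)
  have hexp := closure_expSet_le_stabilizer_schubertVariety hi hw hJ
  have hstab := stabilizer_schubertVariety_le_adNormalizer hi hw hJ
  refine ⟨schubertSubalgebra i J a, schubertSubalgebra_isGreatest hi hw hJ,
    schubertSubalgebra_eq_sup hi hw hJ, iSupIndep_schubertSubalgebra hi hw hJ, ?_,
    (nonnegPart_level b i J a).symm, schubertSubalgebra_isParabolic hJ,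
    le_antisymm hstab (hnorm.trans hexp), le_antisymm (hstab.trans hnorm) hexp,
    lieAlgebraOf_stabilizer_schubertVariety hi hw hJ⟩
  rw [← coe_levelDual]
  exact isInternal_gradedPiece (apply_levelDual b i J a)
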